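/- **Theorem 1.** Let $m,k,p,d\ge 1$ be integers. For $s=1,\dots,p$ and $i=1,\dots,k$ let $|\varphi_s^i\rangle$ be independent random vectors, each uniformly distributed on the unit sphere of $\mathbb{C}^d$, put $|\varphi_s\rangle=|\varphi_s^1\rangle\otimes\cdots\otimes|\varphi_s^k\rangle\in(\mathbb{C}^d)^{\otimes k}$, and let $$M_{p,d,k}=\sum_{s=1}^p|\varphi_s\rangle\langle\varphi_s|,\qquad e^m_{p,d,k}=\frac1{d^k}\,\mathbb{E}\big[\operatorname{tr}(M_{p,d,k}^m)\big].$$ Let $\beta_m(x)=\sum_{\ell=1}^m N(m,\ell)x^\ell$, where $N(m,\ell)=\frac1m\binom{m}{\ell-1}\binom{m}{\ell}$ are the Narayana numbers. Then, with $x=p/d^k$, $$e^m_{p,d,k}\le\exp\!\left(\frac{3m^{k+4}}{x\,d^{1/k}}\right)\beta_m(x),$$ and, if $m<\sqrt p$, $$\left(1-\frac{m^2}{p}\right)\beta_m(x)\le e^m_{p,d,k}.$$ Consequently, for all fixed $m,k\ge1$ and $x>0$, $e^m_{p,d,k}\to\beta_m(x)$ as $d\to\infty$ with $p/d^k=x$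 fixed; more generally, since $p$ is an integer, $e^m_{p_n,d_n,k}\to\beta_m(x)$ for all sequences of positive integers $d_n\to\infty$ and $p_n$ with $p_n/d_n^k\to x$. -/

import Mathlib

open MeasureTheory Filter Topology

noncomputable section

/-- The unit sphere of `ℂ^d`, i.e. the set of unit vectors (pure states). -/
abbrev UnitVec (d : ℕ) : Type := Metric.sphere (0 : EuclideanSpace ℂ (Fin d)) 1

/-- The uniform probability distribution on the unit sphere of `ℂ^d`: the surface measure,
divided by its total mass. -/
def uniformUnitVec (d : ℕ) : Measure (UnitVec d) :=
  ((volume : Measure (EuclideanSpace ℂ (Fin d))).toSphere Set.univ)⁻¹ •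
    (volume : Measure (EuclideanSpace ℂ (Fin d))).toSphere

/-- The normalisation is the right one. -/
theorem isProbabilityMeasure_uniformUnitVec (d : ℕ) (hd : 1 ≤ d) :
    IsProbabilityMeasure (uniformUnitVec d) := by
  have : NeZero d := ⟨by omega⟩
  have : Nontrivial (EuclideanSpace ℂ (Fin d)) := inferInstance
  constructor
  have h0 : (volume : Measure (EuclideanSpace ℂ (Fin d))).toSphere Set.univ ≠ 0 :=
    Measure.measure_univ_ne_zero.mpr (Measure.toSphere_ne_zero _)
  simp only [uniformUnitVec, Measure.smul_apply, smul_eq_mul]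
  exact ENNReal.inv_mul_cancel h0 (measure_ne_top _ _)

/-- The product vector `v¹ ⊗ ⋯ ⊗ vᵏ ∈ (ℂ^d)^{⊗k}`, in the product basis, which is indexed by
`Fin k → Fin d`. -/
def productVec {d k : ℕ} (v : Fin k → UnitVec d) : (Fin k → Fin d) → ℂ :=
  fun a => ∏ i, (v i : EuclideanSpace ℂ (Fin d)) (a i)

/-- The matrix `M = ∑ₛ |φₛ⟩⟨φₛ|`, where `φₛ = φₛ¹ ⊗ ⋯ ⊗ φₛᵏ` for `s = 1, …, p`. -/
def stateSum {p d k : ℕ} (φ : Fin p → Fin k → UnitVec d) :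
    Matrix (Fin k → Fin d) (Fin k → Fin d) ℂ :=
  ∑ s, Matrix.vecMulVec (productVec (φ s)) (star (productVec (φ s)))

/-- The joint law of `p k` independent uniformly random unit vectors in `ℂ^d`. -/
def productEnsemble (p d k : ℕ) : Measure (Fin p → Fin k → UnitVec d) :=
  Measure.pi fun _ => Measure.pi fun _ => uniformUnitVec d

theorem stateSum_isHermitian {p d k : ℕ} (φ : Fin p → Fin k → UnitVec d) :
    (stateSum φ).IsHermitian := by
  unfold stateSum Matrix.IsHermitian
  rw [Matrix.conjTranspose_sum]
  refine Finset.sum_congr rfl fun s _ => ?_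
  rw [Matrix.conjTranspose_vecMulVec, star_star]

/-- The traces of the powers of `M` are real, so nothing is lost by taking real parts below. -/
theorem trace_stateSum_pow_im {p d k : ℕ} (m : ℕ) (φ : Fin p → Fin k → UnitVec d) :
    ((stateSum φ ^ m).trace).im = 0 := by
  have h : star ((stateSum φ ^ m).trace) = (stateSum φ ^ m).trace := by
    rw [← Matrix.trace_conjTranspose, ((stateSum_isHermitian φ).pow m).eq]
  exact Complex.conj_eq_iff_im.mp h

/-- The normalised moment `e^m_{p,d,k} = d^{-k} 𝔼[tr M^m]`. -/
def normMoment (p d k m : ℕ) : ℝ :=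
  1 / (d : ℝ) ^ k * ∫ φ, ((stateSum φ ^ m).trace).re ∂(productEnsemble p d k)

/-- The Narayana numbers `N(m, ℓ) = (1/m) C(m, ℓ-1) C(m, ℓ)`, used for `1 ≤ ℓ ≤ m`. -/
def narayana (m l : ℕ) : ℝ := 1 / (m : ℝ) * (m.choose (l - 1) : ℝ) * (m.choose l : ℝ)

/-- The Narayana polynomial `β_m(x) = ∑_{ℓ=1}^m N(m, ℓ) x^ℓ`. -/
def narayanaPoly (m : ℕ) (x : ℝ) : ℝ := ∑ l ∈ Finset.Icc 1 m, narayana m l * x ^ l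

end

/-! Let c be the rotation `finRotate m`, and write #σ for the number of cycles of σ. Since M = X X*,
the trace of M^m equals that of (X*X)^m, a sum over closed walks s : {1,…,m} → {1,…,p} of products
of overlaps, which factor over the k tensor legs. Moments of a uniform unit vector are Gaussian
moments divided by a radial factor, so Wick's formula gives (`normMoment_succ_eq`) e^m = d^{-k} ∑_s
(T(s)/R(s))^k, where T(s) (`twistedSum`) sums d^{#(σc)} over the σ preserving s, and R(s)
(`risingProd`) is the product of the rising factorials of d at the multiplicities of s.

Let l(s) be the number of distinct labels. The key estimate is T(s) d^{l(s)} ≤ d R(s)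
(`twistedSum_finRotate_mul_pow_le`), with equality when the level sets of s are the cycles of a
genus zero permutation, i.e. #σ + #(σc) = m + 1 (`twistedSum_mul_pow_eq`). Both follow by deleting
points one at a time, since T and R obey comparable recursions.

Lower bound: only the labellings of the equality case are kept. A genus zero σ is determined by its
cycles, so no labelling is counted twice. Each σ with l cycles has p(p-1)⋯(p-l+1) labellings
contributing d^{-kl} apiece, and N(m,l) such σ exist (`card_genusZero`). Bernoulli's inequality
compares the falling factorial with p^l.

Upper bound: the key estimate is applied to k - 1 of the k factors, and R ≥ d^m to the last one.
After exchanging sums, the labellings fixed by σ contribute at most (xd)^{#σ} exp(m²/(xd)). What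
remains is the genus expansion ∑_σ x^{#σ} d^{#σ + #(cσ) - m - 1} of a Wishart moment. Its genus zero
part is β_m(x). A permutation of positive genus can be sliced by a three-cycle, in at most m³ ways,
which lowers the defect m + 1 - #σ - #(cσ) by two; iterating gives the factor exp(2m⁵/(xd)). The
result exp(3m⁵/(xd)) is stronger than required. The limit follows by squeezing. -/

set_option linter.unusedSectionVars false

/-! ### Cycles of a permutation and multiplication by a transposition -/

namespace Equiv.Perm

variable {α β : Type*}

/-- The number of cycles of a permutation, fixed points included. -/
noncomputable def numCycles (σ : Perm α) : ℕ := Nat.card (Quotient (SameCycle.setoid σ))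

/-- Being on the same cycle is the smallest equivalence relation containing all pairs (x, σ x).
Later arguments bound cycles by exhibiting a suitable setoid. -/
theorem SameCycle.of_forall_apply {σ : Perm α} (s : Setoid α) (h : ∀ x, s x (σ x)) {a b : α}
    (hab : σ.SameCycle a b) : s a b := by
  obtain ⟨n, rfl⟩ := hab
  induction n using Int.induction_on with
  | zero => exact s.refl _
  | succ n ih =>
    refine s.trans ih ?_
    rw [zpow_add_one, zpow_mul_comm_apply σ n]
    exact h _
  | pred n ih =>
    refine s.trans ih (s.symm ?_)
    have := h ((σ ^ (-(n : ℤ) - 1)) a)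
    rwa [← Perm.mul_apply, ← zpow_one_add, add_sub_cancel] at this
where
  zpow_mul_comm_apply (σ : Perm α) (n : ℕ) : (σ ^ (n : ℤ) * σ) a = σ ((σ ^ (n : ℤ)) a) := by
    rw [← Perm.mul_apply, ← zpow_add_one, ← zpow_one_add, add_comm]

theorem sameCycle_permCongr (e : α ≃ β) (σ : Perm α) (a b : α) :
    (e.permCongr σ).SameCycle (e a) (e b) ↔ σ.SameCycle a b := by
  constructor
  · intro h
    have := SameCycle.of_forall_apply
      ((SameCycle.setoid σ).comap e.symm) (σ := e.permCongr σ) (fun x => ?_) h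
    · simpa [Setoid.comap_rel] using! this
    · change σ.SameCycle _ _
      exact ⟨1, by simp [Equiv.permCongr_apply]⟩
  · intro h
    refine SameCycle.of_forall_apply ((SameCycle.setoid (e.permCongr σ)).comap e) (fun x => ?_) h
    change (e.permCongr σ).SameCycle _ _
    exact ⟨1, by simp [Equiv.permCongr_apply]⟩

theorem numCycles_permCongr (e : α ≃ β) (σ : Perm α) :
    numCycles (e.permCongr σ) = numCycles σ := by
  refine (Nat.card_congr (Quotient.congr e fun a b => ?_)).symm
  exact (sameCycle_permCongr e σ a b).symm

theorem numCycles_conj (σ τ : Perm α) : numCycles (τ * σ * τ⁻¹) = numCycles σ :=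
  numCycles_permCongr τ σ

theorem numCycles_mul_comm (σ τ : Perm α) : numCycles (σ * τ) = numCycles (τ * σ) := by
  rw [← numCycles_conj (σ * τ) τ]
  congr 1
  group

theorem numCycles_inv (σ : Perm α) : numCycles σ⁻¹ = numCycles σ := by
  refine Nat.card_congr (Quotient.congr (Equiv.refl α) fun a b => ?_)
  exact sameCycle_inv

section Swap

variable [Finite α] [DecidableEq α]

/-- Follow x under σ until the first return to {x, y}. The orbit under `swap x y * σ` agrees with it
up to that moment, when the transposition exchanges the two possible outcomes. -/
theorem sameCycle_swap_mul_iff {σ : Perm α} {x y : α} (hxy : x ≠ y) :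
    (swap x y * σ).SameCycle x y ↔ ¬ σ.SameCycle x y := by
  classical
  have hex : ∃ n, 1 ≤ n ∧ ((σ ^ n) x = x ∨ (σ ^ n) x = y) :=
    ⟨orderOf σ, orderOf_pos σ, Or.inl (by simp [pow_orderOf_eq_one])⟩
  obtain ⟨n, ⟨hn, hnx⟩, hmin⟩ : ∃ n, (1 ≤ n ∧ ((σ ^ n) x = x ∨ (σ ^ n) x = y)) ∧
      ∀ t, 1 ≤ t → t < n → (σ ^ t) x ≠ x ∧ (σ ^ t) x ≠ y := by
    refine ⟨Nat.find hex, Nat.find_spec hex, fun t ht htn => ?_⟩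
    have := Nat.find_min hex htn
    tauto
  have hpow : ∀ t, t < n → ((swap x y * σ) ^ t) x = (σ ^ t) x := by
    intro t
    induction t with
    | zero => simp
    | succ t ih =>
      intro ht
      rw [pow_succ', pow_succ', Perm.mul_apply, ih (by omega), Perm.mul_apply, Perm.mul_apply]
      have := hmin (t + 1) (by omega) ht
      rw [pow_succ', Perm.mul_apply] at this
      exact swap_apply_of_ne_of_ne this.1 this.2
  have hlast : ((swap x y * σ) ^ n) x = swap x y ((σ ^ n) x) := by
    obtain ⟨k, rfl⟩ : ∃ k, n = k + 1 := ⟨n - 1, by omega⟩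
    rw [pow_succ', pow_succ', Perm.mul_apply, hpow k (by omega), Perm.mul_apply, Perm.mul_apply]
  have key : ∀ (τ : Perm α), (τ ^ n) x = x → (∀ t, 1 ≤ t → t < n → (τ ^ t) x ≠ y) →
      ¬ τ.SameCycle x y := by
    intro τ h1 h2 h3
    obtain ⟨i, hi⟩ := h3.exists_nat_pow_eq
    have hper : ∀ q, (τ ^ (n * q)) x = x := by
      intro q
      induction q with
      | zero => simp
      | succ q ih => rw [Nat.mul_succ, pow_add, Perm.mul_apply, h1, ih]
    have : (τ ^ (i % n)) x = y := by
      rw [← hi]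
      conv_rhs => rw [← Nat.mod_add_div i n, pow_add, Perm.mul_apply, hper]
    rcases Nat.eq_zero_or_pos (i % n) with h0 | h0
    · rw [h0] at this
      exact hxy (by simpa using this)
    · exact h2 _ h0 (Nat.mod_lt _ hn) this
  rcases hnx with hnx | hnx
  · have h1 := key σ hnx fun t h1 h2 => (hmin t h1 h2).2
    refine ⟨fun _ => h1, fun _ => ⟨n, ?_⟩⟩
    rw [zpow_natCast, hlast, hnx, swap_apply_left]
  · have h1 := key (swap x y * σ) (by rw [hlast, hnx, swap_apply_right]) fun t h1 h2 => by
      rw [hpow t h2]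
      exact (hmin t h1 h2).2
    refine ⟨fun h => absurd h h1, fun h => absurd ⟨n, ?_⟩ h⟩
    rw [zpow_natCast, hnx]

/-- Multiplying by the transposition of two points on different cycles merges these cycles. -/
theorem sameCycle_swap_mul_iff_of_not_sameCycle {σ : Perm α} {x y : α}
    (h : ¬ σ.SameCycle x y) (a b : α) :
    (swap x y * σ).SameCycle a b ↔ σ.SameCycle a b ∨
      ((σ.SameCycle a x ∨ σ.SameCycle a y) ∧ (σ.SameCycle b x ∨ σ.SameCycle b y)) := by
  have hxy : x ≠ y := fun e => h (e ▸ SameCycle.refl _ _)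
  have hm : (swap x y * σ).SameCycle x y := (sameCycle_swap_mul_iff hxy).mpr h
  have hle : ∀ {a b}, σ.SameCycle a b → (swap x y * σ).SameCycle a b := by
    intro a b hab
    refine SameCycle.of_forall_apply (SameCycle.setoid (swap x y * σ)) (fun z => ?_) hab
    change (swap x y * σ).SameCycle z (σ z)
    by_cases h1 : σ z = x
    · refine SameCycle.trans (y := y) ⟨1, by simp [h1]⟩ (h1 ▸ hm.symm)
    by_cases h2 : σ z = y
    · refine SameCycle.trans (y := x) ⟨1, by simp [h2]⟩ (h2 ▸ hm)
    exact ⟨1, by simp [swap_apply_of_ne_of_ne h1 h2]⟩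
  constructor
  · intro hab
    let s : Setoid α :=
      { r := fun a b => σ.SameCycle a b ∨
          ((σ.SameCycle a x ∨ σ.SameCycle a y) ∧ (σ.SameCycle b x ∨ σ.SameCycle b y))
        iseqv := by
          refine ⟨fun a => Or.inl (SameCycle.refl _ _), ?_, ?_⟩
          · rintro a b (h | h)
            · exact Or.inl h.symm
            · exact Or.inr h.symm
          · rintro a b c (h1 | h1) (h2 | h2)
            · exact Or.inl (h1.trans h2)
            · exact Or.inr ⟨h2.1.imp h1.trans h1.trans, h2.2⟩
            · exact Or.inr ⟨h1.1, h1.2.imp h2.symm.trans h2.symm.trans⟩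
            · exact Or.inr ⟨h1.1, h2.2⟩ }
    refine SameCycle.of_forall_apply s (fun z => ?_) hab
    change σ.SameCycle z _ ∨ _
    rw [Perm.mul_apply]
    by_cases h1 : σ z = x
    · right
      rw [h1, swap_apply_left]
      exact ⟨Or.inl (h1 ▸ ⟨1, by simp⟩), Or.inr (SameCycle.refl _ _)⟩
    by_cases h2 : σ z = y
    · right
      rw [h2, swap_apply_right]
      exact ⟨Or.inr (h2 ▸ ⟨1, by simp⟩), Or.inl (SameCycle.refl _ _)⟩
    rw [swap_apply_of_ne_of_ne h1 h2]
    exact Or.inl ⟨1, by simp⟩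
  · rintro (hab | ⟨ha | ha, hb | hb⟩)
    · exact hle hab
    · exact (hle ha).trans (hle hb).symm
    · exact ((hle ha).trans hm).trans (hle hb).symm
    · exact ((hle ha).trans hm.symm).trans (hle hb).symm
    · exact (hle ha).trans (hle hb).symm

/-- The cycles of the product correspond to the cycles of σ other than that of y, which has been
merged into that of x. -/
theorem numCycles_swap_mul_add_one {σ : Perm α} {x y : α} (h : ¬ σ.SameCycle x y) :
    numCycles (swap x y * σ) + 1 = numCycles σ := by
  classical
  have hiff := sameCycle_swap_mul_iff_of_not_sameCycle h
  let q : Quotient (SameCycle.setoid σ) := Quotient.mk _ y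
  let f : {p : Quotient (SameCycle.setoid σ) // p ≠ q} →
      Quotient (SameCycle.setoid (swap x y * σ)) := fun p =>
    Quotient.map (sa := SameCycle.setoid σ) (sb := SameCycle.setoid (swap x y * σ)) id
      (fun a b hab => (hiff a b).mpr (Or.inl hab)) p.1
  have hf : Function.Bijective f := by
    constructor
    · rintro ⟨p₁, h₁⟩ ⟨p₂, h₂⟩ he
      induction p₁ using Quotient.inductionOn with | _ a
      induction p₂ using Quotient.inductionOn with | _ b
      have h1 : ¬ σ.SameCycle a y := fun h => h₁ (Quotient.sound h)
      have h2 : ¬ σ.SameCycle b y := fun h => h₂ (Quotient.sound h)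
      have h3 : (swap x y * σ).SameCycle a b := Quotient.exact he
      have h4 := (hiff a b).mp h3
      have h5 : σ.SameCycle a b := by
        rcases h4 with h4 | ⟨h4 | h4, h5 | h5⟩
        · exact h4
        · exact h4.trans h5.symm
        · exact absurd h5 h2
        · exact absurd h4 h1
        · exact absurd h4 h1
      exact Subtype.ext (Quotient.sound h5)
    · intro p
      induction p using Quotient.inductionOn with | _ a
      by_cases ha : σ.SameCycle a y
      · refine ⟨⟨Quotient.mk _ x, fun he => h (Quotient.exact he)⟩, ?_⟩
        refine Quotient.sound ?_
        exact (hiff x a).mpr (Or.inr ⟨Or.inl (SameCycle.refl _ _), Or.inr ha⟩)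
      · exact ⟨⟨Quotient.mk _ a, fun he => ha (Quotient.exact he)⟩, rfl⟩
  have hc := Nat.card_congr (Equiv.ofBijective f hf)
  unfold numCycles
  rw [← hc]
  have := Finite.card_option (α := {p : Quotient (SameCycle.setoid σ) // p ≠ q})
  rw [← this]
  exact Nat.card_congr (optionSubtypeNe q)

theorem numCycles_swap_mul_of_sameCycle {σ : Perm α} {x y : α} (hxy : x ≠ y)
    (h : σ.SameCycle x y) : numCycles (swap x y * σ) = numCycles σ + 1 := by
  have h1 : ¬ (swap x y * σ).SameCycle x y := by
    rw [sameCycle_swap_mul_iff hxy]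
    simpa using h
  have := numCycles_swap_mul_add_one h1
  rw [swap_mul_self_mul] at this
  exact this.symm

theorem numCycles_mul_swap_add_one {σ : Perm α} {x y : α} (h : ¬ σ.SameCycle x y) :
    numCycles (σ * swap x y) + 1 = numCycles σ := by
  rw [numCycles_mul_comm, numCycles_swap_mul_add_one h]

theorem numCycles_mul_swap_of_sameCycle {σ : Perm α} {x y : α} (hxy : x ≠ y)
    (h : σ.SameCycle x y) : numCycles (σ * swap x y) = numCycles σ + 1 := by
  rw [numCycles_mul_comm, numCycles_swap_mul_of_sameCycle hxy h]

end Swap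

/-! ### Adjoining a point to a permutation -/

section Option

theorem optionCongr_mul' (σ τ : Perm α) :
    optionCongr (σ * τ) = optionCongr σ * optionCongr τ := by
  ext1 x
  cases x <;> simp

theorem sameCycle_optionCongr_some (σ : Perm α) (a b : α) :
    SameCycle (optionCongr σ) (some a) (some b) ↔ σ.SameCycle a b := by
  constructor
  · intro h
    let s : Setoid (Option α) :=
      { r := fun u v => (u = none ∧ v = none) ∨
          ∃ a b, u = some a ∧ v = some b ∧ σ.SameCycle a b
        iseqv := by
          refine ⟨?_, ?_, ?_⟩
          · rintro (_ | a)
            · simp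
            · exact Or.inr ⟨a, a, rfl, rfl, SameCycle.refl _ _⟩
          · rintro u v (h | ⟨a, b, rfl, rfl, h⟩)
            · exact Or.inl h.symm
            · exact Or.inr ⟨b, a, rfl, rfl, h.symm⟩
          · rintro u v w (⟨rfl, rfl⟩ | ⟨a, b, rfl, rfl, h⟩) (⟨h1, rfl⟩ | ⟨a', b', h1, rfl, h'⟩)
            · simp
            · simp at h1
            · simp at h1
            · obtain rfl : b = a' := by simpa using h1
              exact Or.inr ⟨a, b', rfl, rfl, h.trans h'⟩ }
    have := SameCycle.of_forall_apply s (σ := optionCongr σ) (fun u => ?_) h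
    · rcases this with h | ⟨a', b', h1, h2, h3⟩
      · simp at h
      · simp only [Option.some.injEq] at h1 h2
        subst h1 h2
        exact h3
    · rcases u with _ | a
      · exact Or.inl (by simp)
      · exact Or.inr ⟨a, σ a, rfl, by simp, ⟨1, by simp⟩⟩
  · intro h
    refine SameCycle.of_forall_apply ((SameCycle.setoid (optionCongr σ)).comap some)
      (fun x => ?_) h
    change SameCycle (optionCongr σ) _ _
    exact ⟨1, by simp⟩

theorem not_sameCycle_optionCongr_none_some (σ : Perm α) (a : α) :
    ¬ SameCycle (optionCongr σ) none (some a) := by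
  rintro ⟨n, hn⟩
  have : Function.IsFixedPt (optionCongr σ) none := by simp [Function.IsFixedPt]
  rw [this.perm_zpow n |>.eq] at hn
  simp at hn

theorem numCycles_optionCongr [Finite α] (σ : Perm α) :
    numCycles (optionCongr σ) = numCycles σ + 1 := by
  unfold numCycles
  rw [← Finite.card_option]
  symm
  let f : Option (Quotient (SameCycle.setoid σ)) →
      Quotient (SameCycle.setoid (optionCongr σ)) := fun p => p.elim (Quotient.mk _ none)
    (Quotient.map (sa := SameCycle.setoid σ) (sb := SameCycle.setoid (optionCongr σ)) some
      fun a b hab => (sameCycle_optionCongr_some σ a b).mpr hab)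
  refine Nat.card_congr (Equiv.ofBijective f ⟨?_, ?_⟩)
  · rintro (_ | p) (_ | q) h
    · rfl
    · induction q using Quotient.inductionOn with | _ b
      exact absurd (Quotient.exact h) (not_sameCycle_optionCongr_none_some σ b)
    · induction p using Quotient.inductionOn with | _ b
      exact absurd (Quotient.exact h.symm) (not_sameCycle_optionCongr_none_some σ b)
    · induction p using Quotient.inductionOn with | _ a
      induction q using Quotient.inductionOn with | _ b
      exact congrArg some (Quotient.sound ((sameCycle_optionCongr_some σ a b).mp (Quotient.exact h)))
  · intro p
    induction p using Quotient.inductionOn with | _ a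
    rcases a with _ | a
    · exact ⟨none, rfl⟩
    · exact ⟨some (Quotient.mk _ a), rfl⟩

section

variable [Finite α] [DecidableEq α]

/-- The fixed point `none` is merged into the cycle of j, so the new point creates no new cycle. -/
theorem numCycles_swap_none_mul_optionCongr (σ : Perm α) (j : α) :
    numCycles (swap none (some j) * optionCongr σ) = numCycles σ := by
  have := numCycles_swap_mul_add_one (not_sameCycle_optionCongr_none_some σ j)
  rw [numCycles_optionCongr] at this
  omega

theorem sameCycle_swap_none_mul_optionCongr_some (σ : Perm α) (j a b : α) :
    (swap none (some j) * optionCongr σ).SameCycle (some a) (some b) ↔ σ.SameCycle a b := by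
  rw [sameCycle_swap_mul_iff_of_not_sameCycle (not_sameCycle_optionCongr_none_some σ j),
    sameCycle_optionCongr_some, sameCycle_optionCongr_some, sameCycle_optionCongr_some]
  have h1 : ∀ a, ¬ SameCycle (optionCongr σ) (some a) none := fun a h =>
    not_sameCycle_optionCongr_none_some σ a h.symm
  simp only [h1, false_or, or_iff_left_iff_imp, and_imp]
  exact fun h h' => h.trans h'.symm

end

/-- Brings a product of two transpositions moving the new point n to a form where only the leftmost
moves n; the other acts on the old points. -/
theorem swap_mul_swap_eq_swap_mul_swap {α : Type*} [DecidableEq α] (n x y : α) (hx : x ≠ n) (hy : y ≠ n) (hxy : x ≠ y) :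
    swap n x * swap n y = swap n y * swap x y := by
  ext1 z
  simp only [Perm.mul_apply, swap_apply_def]
  grind

end Option

end Equiv.Perm

/-! ### The twisted sum of a labelling and its recursion under deletion of a point -/

namespace Equiv.Perm

section TwistedSum

variable {ι Λ β : Type*} [Fintype ι] [DecidableEq ι] [Fintype β] [DecidableEq β] [DecidableEq Λ]

/-- The permutations preserving the labelling `s`. -/
def labelPerms (s : ι → Λ) : Finset (Perm ι) :=
  Finset.univ.filter fun σ : Perm ι => s ∘ σ = s

theorem mem_labelPerms {s : ι → Λ} {σ : Perm ι} : σ ∈ labelPerms s ↔ ∀ i, s (σ i) = s i := by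
  simp [labelPerms, funext_iff]

/-- The sum of `d ^ #cycles(σ γ)` over the permutations `σ` preserving the labelling `s`. -/
noncomputable def twistedSum (d : ℕ) (γ : Perm ι) (s : ι → Λ) : ℕ :=
  ∑ σ ∈ labelPerms s, d ^ numCycles (σ * γ)

/-- The product of the rising factorials of the multiplicities of the labels. -/
def risingProd [Fintype Λ] (d : ℕ) (s : ι → Λ) : ℕ :=
  ∏ b, d.ascFactorial (Finset.card {i | s i = b})

theorem twistedSum_congr (d : ℕ) (e : β ≃ ι) (γ : Perm ι) (s : ι → Λ) :
    twistedSum d (e.symm.permCongr γ) (s ∘ e) = twistedSum d γ s := by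
  unfold twistedSum
  refine Finset.sum_equiv e.permCongr (fun σ => ?_) (fun σ _ => ?_)
  · rw [mem_labelPerms, mem_labelPerms]
    constructor
    · intro h x
      have := h (e.symm x)
      simpa [Equiv.permCongr_apply] using this
    · intro h x
      have := h (e x)
      simpa [Equiv.permCongr_apply] using this
  · have : e.permCongr (σ * e.symm.permCongr γ) = e.permCongr σ * γ := by
      ext x
      simp [Equiv.permCongr_apply]
    rw [← this, numCycles_permCongr]

theorem risingProd_congr [Fintype Λ] (d : ℕ) (e : β ≃ ι) (s : ι → Λ) :
    risingProd d (s ∘ e) = risingProd d s := by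
  unfold risingProd
  refine Finset.prod_congr rfl fun b _ => ?_
  congr 1
  refine Finset.card_equiv e fun i => ?_
  simp

theorem risingProd_option [Fintype Λ] (d : ℕ) (s : Option β → Λ) :
    risingProd d s =
      (d + Finset.card {j : β | s (some j) = s none}) * risingProd d (s ∘ some) := by
  have hcard : ∀ b, Finset.card {i : Option β | s i = b} =
      (if s none = b then 1 else 0) + Finset.card {j : β | s (some j) = b} := by
    intro b
    simp only [Finset.card_filter, Fintype.sum_option]
  unfold risingProd
  rw [← Finset.mul_prod_erase Finset.univ _ (Finset.mem_univ (s none)),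
    ← Finset.mul_prod_erase Finset.univ (fun b => d.ascFactorial
      (Finset.card {i | (s ∘ some) i = b})) (Finset.mem_univ (s none)), ← mul_assoc]
  congr 1
  · rw [hcard, if_pos rfl, add_comm 1, Nat.ascFactorial_succ]
    rfl
  · refine Finset.prod_congr rfl fun b hb => ?_
    rw [hcard, if_neg (Finset.ne_of_mem_erase hb).symm, zero_add]
    rfl

/-- A permutation of `Option β` is uniquely `swap none j * optionCongr σ₀`. It preserves the labels
exactly when j has the label of `none` and σ₀ preserves the restricted labels. -/
theorem sum_perm_option (s : Option β → Λ) (F : Perm (Option β) → ℕ) :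
    ∑ σ ∈ labelPerms s, F σ =
      ∑ j : Option β with s j = s none, ∑ σ₀ ∈ labelPerms (s ∘ some),
        F (swap none j * optionCongr σ₀) := by
  rw [Finset.sum_sigma']
  refine Finset.sum_bij' (fun σ _ => ⟨σ none, removeNone σ⟩)
    (fun p _ => swap none p.1 * optionCongr p.2) ?_ ?_ ?_ ?_ ?_
  · intro σ hσ
    simp only [Finset.mem_filter, Finset.mem_univ, true_and, Finset.mem_sigma, mem_labelPerms] at hσ ⊢
    have h1 : s (σ none) = s none := hσ none
    refine ⟨h1, ?_⟩
    have h2 : ∀ x, s (swap none (σ none) x) = s x := by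
      intro x
      rw [swap_apply_def]
      split_ifs with h h'
      · rw [h1, h]
      · rw [h', h1]
      · rfl
    intro x
    have h3 := congrArg (fun τ : Perm (Option β) => s (τ (some x))) (map_equiv_removeNone σ)
    simp only [optionCongr_apply, Option.map_some, Perm.mul_apply, h2] at h3
    simpa [h3] using hσ (some x)
  · rintro ⟨j, σ₀⟩ h
    simp only [Finset.mem_filter, Finset.mem_univ, true_and, Finset.mem_sigma, mem_labelPerms] at h ⊢
    have h2 : ∀ x, s (swap none j x) = s x := by
      intro x
      rw [swap_apply_def]
      split_ifs with h1 h'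
      · rw [h.1, h1]
      · rw [h', h.1]
      · rfl
    intro x
    simp only [Perm.mul_apply, h2]
    rcases x with _ | x
    · simp
    · simpa using h.2 x
  · intro σ _
    exact decomposeOption.left_inv σ
  · rintro ⟨j, σ₀⟩ _
    have := decomposeOption.right_inv (j, σ₀)
    simp only [decomposeOption, Prod.mk.injEq] at this
    ext1
    · exact this.1
    · exact heq_of_eq this.2
  · intro σ _
    exact congrArg F (decomposeOption.left_inv σ).symm

theorem sum_perm_swap_mul (s : ι → Λ) (F : Perm ι → ℕ) {a j : ι} (h : s a = s j) :
    ∑ σ ∈ labelPerms s, F (swap a j * σ) = ∑ σ ∈ labelPerms s, F σ := by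
  refine Finset.sum_equiv (Equiv.mulLeft (swap a j)) (fun σ => ?_) (fun σ _ => rfl)
  have h2 : ∀ x, s (swap a j x) = s x := by
    intro x
    rw [swap_apply_def]
    split_ifs with h1 h'
    · rw [h1, h]
    · rw [h', h]
    · rfl
  simp [mem_labelPerms, h2]

theorem numCycles_option_aux (σ₀ γ₀ : Perm β) (a j : Option β) :
    numCycles (swap none j * optionCongr σ₀ * (optionCongr γ₀ * swap none a)) =
      numCycles (swap none a * swap none j * optionCongr (σ₀ * γ₀)) := by
  rw [← mul_assoc, numCycles_mul_comm, optionCongr_mul']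
  simp only [mul_assoc]

theorem numCycles_option_self (σ₀ γ₀ : Perm β) (a : Option β) :
    numCycles (swap none a * optionCongr σ₀ * (optionCongr γ₀ * swap none a)) =
      numCycles (σ₀ * γ₀) + 1 := by
  rw [numCycles_option_aux, swap_mul_self, one_mul, numCycles_optionCongr]

theorem numCycles_option_none (σ₀ γ₀ : Perm β) (a : β) :
    numCycles (swap none none * optionCongr σ₀ * (optionCongr γ₀ * swap none (some a))) =
      numCycles (σ₀ * γ₀) := by
  rw [numCycles_option_aux, swap_self, ← one_def, mul_one, numCycles_swap_none_mul_optionCongr]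

theorem numCycles_option_some_none (σ₀ γ₀ : Perm β) (j : β) :
    numCycles (swap none (some j) * optionCongr σ₀ * (optionCongr γ₀ * swap none none)) =
      numCycles (σ₀ * γ₀) := by
  rw [numCycles_option_aux, swap_self, ← one_def, one_mul, numCycles_swap_none_mul_optionCongr]

theorem numCycles_option_some_some (σ₀ γ₀ : Perm β) {a j : β} (h : a ≠ j) :
    numCycles (swap none (some j) * optionCongr σ₀ * (optionCongr γ₀ * swap none (some a))) =
      numCycles (swap a j * σ₀ * γ₀) := by
  rw [numCycles_option_aux, swap_mul_swap_eq_swap_mul_swap _ _ _ (by simp) (by simp) (by simpa),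
    ← optionCongr_swap, mul_assoc, ← optionCongr_mul', numCycles_swap_none_mul_optionCongr,
    mul_assoc]

/-- Deleting a point whose predecessor has the same label. -/
theorem twistedSum_option_of_eq (d : ℕ) (γ₀ : Perm β) (a : Option β) (s : Option β → Λ)
    (h : s a = s none) :
    twistedSum d (optionCongr γ₀ * swap none a) s =
      (d + Finset.card {j : β | s (some j) = s none}) * twistedSum d γ₀ (s ∘ some) := by
  have key : ∀ j : Option β, s j = s none →
      ∑ σ₀ ∈ labelPerms (s ∘ some),
        d ^ numCycles (swap none j * optionCongr σ₀ * (optionCongr γ₀ * swap none a)) =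
      (if j = a then d else 1) * twistedSum d γ₀ (s ∘ some) := by
    intro j hj
    unfold twistedSum
    split_ifs with hja
    · subst hja
      rw [Finset.mul_sum]
      refine Finset.sum_congr rfl fun σ₀ _ => ?_
      rw [numCycles_option_self, pow_succ']
    · rw [one_mul]
      rcases a with _ | a <;> rcases j with _ | j
      · exact absurd rfl hja
      · exact Finset.sum_congr rfl fun σ₀ _ => by rw [numCycles_option_some_none]
      · exact Finset.sum_congr rfl fun σ₀ _ => by rw [numCycles_option_none]
      · have hne : a ≠ j := fun e => hja (by rw [e])
        -- The points a and j carry the same label, so `swap a j` is absorbed by reindexing the sum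
        -- over σ₀. Only j = a produces an extra cycle.
        rw [← sum_perm_swap_mul (s ∘ some) (fun σ => d ^ numCycles (σ * γ₀))
          (a := a) (j := j) (h.trans hj.symm)]
        exact Finset.sum_congr rfl fun σ₀ _ => by rw [numCycles_option_some_some _ _ hne]
  rw [twistedSum, sum_perm_option s fun σ => d ^ numCycles (σ * (optionCongr γ₀ * swap none a)),
    Finset.sum_congr rfl fun j hj => key j (Finset.mem_filter.mp hj).2, ← Finset.sum_mul]
  congr 1
  rw [← Finset.add_sum_erase _ _ (Finset.mem_filter.mpr ⟨Finset.mem_univ a, h⟩), if_pos rfl]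
  congr 1
  rw [Finset.sum_congr rfl (g := fun _ => 1)
    fun j hj => if_neg (Finset.ne_of_mem_erase hj)]
  rw [Finset.sum_const, smul_eq_mul, mul_one, Finset.card_erase_of_mem (by simp [h]),
    Finset.card_filter, Finset.card_filter, Fintype.sum_option]
  simp

/-- Deleting a point whose predecessor has a different label. -/
theorem twistedSum_option_of_ne (d : ℕ) (γ₀ : Perm β) (a : β) (s : Option β → Λ)
    (h : s (some a) ≠ s none) :
    twistedSum d (optionCongr γ₀ * swap none (some a)) s =
      twistedSum d γ₀ (s ∘ some) +
        ∑ j : β with s (some j) = s none, twistedSum d (γ₀ * swap a j) (s ∘ some) := by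
  rw [twistedSum, sum_perm_option s fun σ =>
    d ^ numCycles (σ * (optionCongr γ₀ * swap none (some a))), Finset.sum_filter,
    Fintype.sum_option, if_pos rfl, ← Finset.sum_filter]
  congr 1
  · exact Finset.sum_congr rfl fun σ₀ _ => by rw [numCycles_option_none]
  · refine Finset.sum_congr rfl fun j hj => Finset.sum_congr rfl fun σ₀ _ => ?_
    have hne : a ≠ j := by
      rintro rfl
      exact h (Finset.mem_filter.mp hj).2
    -- Here a carries a different label, so the transposition cannot be absorbed into σ₀; cyclic
    -- invariance moves it into γ₀.
    rw [numCycles_option_some_some _ _ hne, mul_assoc, numCycles_mul_comm, mul_assoc]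

end TwistedSum

end Equiv.Perm

/-! ### The upper bound for the twisted sum -/

namespace Equiv.Perm

section UpperBound

variable {Λ : Type*} [DecidableEq Λ] [Fintype Λ]

theorem card_image_option {β : Type*} [Fintype β] (s : Option β → Λ) :
    (Finset.univ.image s).card =
      (Finset.univ.image (s ∘ some)).card +
        if Finset.card {j : β | s (some j) = s none} = 0 then 1 else 0 := by
  classical
  have h1 : Finset.univ.image s = insert (s none) (Finset.univ.image (s ∘ some)) := by
    ext b
    simp only [Finset.mem_image, Finset.mem_univ, true_and, Finset.mem_insert, Function.comp_apply]
    constructor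
    · rintro ⟨_ | j, rfl⟩
      · exact Or.inl rfl
      · exact Or.inr ⟨j, rfl⟩
    · rintro (rfl | ⟨j, rfl⟩)
      · exact ⟨none, rfl⟩
      · exact ⟨some j, rfl⟩
  rw [h1]
  have h2 : s none ∈ Finset.univ.image (s ∘ some) ↔
      Finset.card {j : β | s (some j) = s none} ≠ 0 := by
    rw [← Nat.pos_iff_ne_zero, Finset.card_pos]
    simp [Finset.Nonempty]
  split_ifs with h
  · rw [Finset.card_insert_of_notMem (fun hc => h2.mp hc h)]
  · rw [Finset.insert_eq_of_mem (h2.mpr h), add_zero]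

/-- The labels are linked: each label which does not have minimal rank is joined by an edge
`j → γ j` to a label of smaller rank. -/
def LinkedLabels {ι : Type*} (r : Λ → ℕ) (γ : Perm ι) (s : ι → Λ) : Prop :=
  ∀ i, (∃ k, r (s k) < r (s i)) →
    ∃ j, (s j = s i ∧ r (s (γ j)) < r (s i)) ∨ (s (γ j) = s i ∧ r (s j) < r (s i))

theorem exists_eq_optionCongr_mul_swap {β : Type*} [DecidableEq β] (γ : Perm (Option β)) :
    γ = optionCongr (removeNone γ) * swap none (γ⁻¹ none) := by
  have h : γ⁻¹ (γ none) = none := by simp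
  rw [map_equiv_removeNone, swap_mul_eq_mul_swap, h, swap_comm,
    mul_assoc, swap_mul_self, mul_one]

theorem twistedSum_of_isEmpty {ι : Type*} [Fintype ι] [DecidableEq ι] [IsEmpty ι]
    (d : ℕ) (γ : Perm ι) (s : ι → Λ) : twistedSum d γ s = 1 := by
  have h1 : labelPerms s = {1} := by
    ext σ
    simp [mem_labelPerms, Subsingleton.elim σ 1]
  have : IsEmpty (Quotient (SameCycle.setoid (1 * γ))) := ⟨fun q => q.inductionOn isEmptyElim⟩
  rw [twistedSum, h1, Finset.sum_singleton, numCycles, Nat.card_of_isEmpty, pow_zero]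

section Step

variable {β : Type*} [Fintype β] [DecidableEq β] {r : Λ → ℕ} {d : ℕ}

/-- Both sides acquire the factor d + μ, where μ counts the other points with the deleted label. So
nothing is lost if the label survives; if it does not, linkedness forces the deleted point to be the
only one. -/
theorem twistedSum_option_le_of_eq (hr : Function.Injective r) {γ₀ : Perm β} {a : Option β}
    {s : Option β → Λ} (hmax : ∀ i, r (s i) ≤ r (s none)) (ha : s a = s none)
    (hL : LinkedLabels r (optionCongr γ₀ * swap none a) s)
    (ih : LinkedLabels r γ₀ (s ∘ some) →
      twistedSum d γ₀ (s ∘ some) * d ^ (Finset.univ.image (s ∘ some)).card ≤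
        d * risingProd d (s ∘ some)) :
    twistedSum d (optionCongr γ₀ * swap none a) s * d ^ (Finset.univ.image s).card ≤
      d * risingProd d s := by
  set γ := optionCongr γ₀ * swap none a with hγ
  rw [twistedSum_option_of_eq d γ₀ a s ha, risingProd_option, card_image_option]
  set μ := Finset.card {j : β | s (some j) = s none} with hμ
  by_cases h0 : μ = 0
  · have hno : ∀ j : β, s (some j) ≠ s none := by
      intro j hj
      rw [hμ, Finset.card_eq_zero] at h0
      exact absurd (Finset.mem_filter.mpr ⟨Finset.mem_univ j, hj⟩) (h0 ▸ Finset.notMem_empty j)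
    have ha' : a = none := by
      rcases a with _ | a
      · rfl
      · exact absurd ha (hno a)
    -- The label of `none` occurs only there and γ fixes `none`, so no edge could link it to a label
    -- of smaller rank.
    have hempty : IsEmpty β := by
      refine ⟨fun j => ?_⟩
      have hlt : r (s (some j)) < r (s none) :=
        lt_of_le_of_ne (hmax _) fun e => hno j (hr e)
      obtain ⟨i, ⟨h1, h2⟩ | ⟨h1, h2⟩⟩ := hL none ⟨some j, hlt⟩
      · rcases i with _ | i
        · rw [hγ, ha'] at h2
          simp at h2
        · exact hno i h1
      · rcases i with _ | i
        · simp at h2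
        · rw [hγ, ha'] at h1
          simp at h1
          exact hno _ h1
    rw [h0, twistedSum_of_isEmpty]
    have h3 : risingProd d (s ∘ some) = 1 := by
      unfold risingProd
      exact Finset.prod_eq_one fun b _ => by simp
    have h4 : (Finset.univ.image (s ∘ some)).card = 0 := by simp
    rw [h3, h4]
    simp
  · rw [if_neg h0, add_zero, mul_assoc, mul_left_comm d]
    refine Nat.mul_le_mul_left _ (ih ?_)
    rintro i ⟨k, hk⟩
    obtain ⟨j, hj⟩ := hL (some i) ⟨some k, hk⟩
    have hγa : γ a = none := by simp [hγ]
    rcases j with _ | j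
    · rcases a with _ | a
      · rw [hγa] at hj
        rcases hj with ⟨h1, h2⟩ | ⟨h1, h2⟩
        · rw [h1] at h2; exact absurd h2 (lt_irrefl _)
        · rw [h1] at h2; exact absurd h2 (lt_irrefl _)
      -- The link left the deleted point. Its predecessor a has the same label and inherits its
      -- image under γ₀.
      · have h1 : γ none = some (γ₀ a) := by simp [hγ]
        rw [h1, ← ha] at hj
        exact ⟨a, hj⟩
    · by_cases hja : some j = a
      · rw [hja, hγa, ha] at hj
        rcases hj with ⟨h1, h2⟩ | ⟨h1, h2⟩
        · rw [h1] at h2; exact absurd h2 (lt_irrefl _)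
        · rw [h1] at h2; exact absurd h2 (lt_irrefl _)
      · have h1 : γ (some j) = some (γ₀ j) := by
          simp [hγ, swap_apply_of_ne_of_ne (Option.some_ne_none j) hja]
        rw [h1] at hj
        exact ⟨j, hj⟩

/-- The recursion has 1 + μ terms, each bounded by induction, against the factor d + μ gained by the
rising product. The deleted label has top rank, so links between lower labels do not touch it and
survive. If the top label persists, `hloop` supplies its link in each new permutation. -/
theorem twistedSum_option_le_of_ne (hd : 1 ≤ d) (hr : Function.Injective r) {γ₀ : Perm β} {a : β}
    {s : Option β → Λ} (hmax : ∀ i, r (s i) ≤ r (s none))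
    (hloop : ∀ i, s i = s none → s ((optionCongr γ₀ * swap none (some a)) i) ≠ s none)
    (ha : s (some a) ≠ s none)
    (hL : LinkedLabels r (optionCongr γ₀ * swap none (some a)) s)
    (ih : ∀ γ' : Perm β, LinkedLabels r γ' (s ∘ some) →
      twistedSum d γ' (s ∘ some) * d ^ (Finset.univ.image (s ∘ some)).card ≤
        d * risingProd d (s ∘ some)) :
    twistedSum d (optionCongr γ₀ * swap none (some a)) s * d ^ (Finset.univ.image s).card ≤
      d * risingProd d s := by
  set γ := optionCongr γ₀ * swap none (some a) with hγ
  have hγa : γ (some a) = none := by simp [hγ]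
  have hγn : γ none = some (γ₀ a) := by simp [hγ]
  have hγs : ∀ j, j ≠ a → γ (some j) = some (γ₀ j) := fun j hj => by
    simp [hγ, swap_apply_of_ne_of_ne (Option.some_ne_none j) (Option.some_injective β |>.ne hj)]
  have hlt : ∀ i, s i ≠ s none → r (s i) < r (s none) := fun i hi =>
    lt_of_le_of_ne (hmax _) fun e => hi (hr e)
  -- The link of a label below the top has both ends below the top. Hence it avoids a, which γ sends
  -- to the top label, and is not affected by the transpositions of a with top points.
  have hlow : ∀ i : β, s (some i) ≠ s none → (∃ k : β, r (s (some k)) < r (s (some i))) →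
      ∃ j : β, j ≠ a ∧ s (some j) ≠ s none ∧
        ((s (some j) = s (some i) ∧ r (s (some (γ₀ j))) < r (s (some i))) ∨
        (s (some (γ₀ j)) = s (some i) ∧ r (s (some j)) < r (s (some i)))) := by
    rintro i hi ⟨k, hk⟩
    have h0 := hlt _ hi
    obtain ⟨j, hj⟩ := hL (some i) ⟨some k, hk⟩
    have hjn : s j ≠ s none := by
      intro e
      rcases hj with ⟨h1, h2⟩ | ⟨h1, h2⟩
      · exact hi (h1 ▸ e)
      · rw [e] at h2; omega
    rcases j with _ | j
    · exact absurd rfl hjn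
    have hja : j ≠ a := by
      rintro rfl
      rw [hγa] at hj
      rcases hj with ⟨h1, h2⟩ | ⟨h1, h2⟩
      · omega
      · exact hi h1.symm
    rw [hγs j hja] at hj
    exact ⟨j, hja, hjn, hj⟩
  rw [twistedSum_option_of_ne d γ₀ a s ha, risingProd_option, card_image_option]
  set μ := Finset.card {j : β | s (some j) = s none} with hμ
  by_cases h0 : μ = 0
  · have hno : ∀ j : β, s (some j) ≠ s none := by
      intro j hj
      rw [hμ, Finset.card_eq_zero] at h0
      exact absurd (Finset.mem_filter.mpr ⟨Finset.mem_univ j, hj⟩) (h0 ▸ Finset.notMem_empty j)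
    have hemp : Finset.filter (fun j : β => s (some j) = s none) Finset.univ = ∅ :=
      Finset.card_eq_zero.mp h0
    rw [if_pos h0, h0, hemp, Finset.sum_empty, add_zero, add_zero,
      pow_succ', mul_left_comm]
    refine Nat.mul_le_mul_left _ (ih γ₀ ?_)
    rintro i hk
    obtain ⟨j, _, _, hj⟩ := hlow i (hno i) hk
    exact ⟨j, hj⟩
  · have key : ∀ γ' ∈ insert γ₀ (Finset.image (fun j => γ₀ * swap a j)
        {j : β | s (some j) = s none}), LinkedLabels r γ' (s ∘ some) := by
      have hj₀ : ∃ j : β, s (some j) = s none := by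
        obtain ⟨j, hj⟩ := Finset.card_pos.mp (Nat.pos_of_ne_zero h0)
        exact ⟨j, (Finset.mem_filter.mp hj).2⟩
      intro γ' hγ'
      rw [Finset.mem_insert, Finset.mem_image] at hγ'
      rintro i hk
      change ∃ k : β, r (s (some k)) < r (s (some i)) at hk
      change ∃ j : β, (s (some j) = s (some i) ∧ r (s (some (γ' j))) < r (s (some i))) ∨
        (s (some (γ' j)) = s (some i) ∧ r (s (some j)) < r (s (some i)))
      by_cases hi : s (some i) = s none
      · rw [hi]
        rcases hγ' with rfl | ⟨j, hj, rfl⟩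
        · obtain ⟨j, hj⟩ := hj₀
          have hja : j ≠ a := by rintro rfl; exact ha hj
          have := hloop (some j) hj
          rw [hγs j hja] at this
          exact ⟨j, Or.inl ⟨hj, hlt _ this⟩⟩
        · have hj := (Finset.mem_filter.mp hj).2
          have := hloop none rfl
          rw [hγn] at this
          exact ⟨j, Or.inl ⟨hj, by simpa using hlt _ this⟩⟩
      · obtain ⟨j, hja, hjn, hj⟩ := hlow i hi hk
        refine ⟨j, ?_⟩
        rcases hγ' with rfl | ⟨k, hk, rfl⟩
        · exact hj
        · have hk := (Finset.mem_filter.mp hk).2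
          have hjk : j ≠ k := by rintro rfl; exact hjn hk
          rw [Perm.mul_apply, swap_apply_of_ne_of_ne hja hjk]
          exact hj
    rw [if_neg h0, add_zero, add_mul, Finset.sum_mul]
    calc _ ≤ d * risingProd d (s ∘ some) +
          ∑ j : β with s (some j) = s none, d * risingProd d (s ∘ some) := by
          refine add_le_add (ih _ (key _ (Finset.mem_insert_self _ _)))
            (Finset.sum_le_sum fun j hj => ih _ (key _ (Finset.mem_insert_of_mem
              (Finset.mem_image_of_mem _ hj))))
      _ = d * ((1 + μ) * risingProd d (s ∘ some)) := by
          rw [Finset.sum_const, smul_eq_mul]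
          ring
      -- The only loss in the estimate: 1 + μ ≤ d + μ.
      _ ≤ _ := by gcongr

end Step

/-- Points of the highest rank are deleted first, because links descend in rank. Preferring a point
preceded by its own label ensures that in the other case no edge of γ joins two top points. -/
theorem twistedSum_mul_pow_le {r : Λ → ℕ} {d : ℕ} (hd : 1 ≤ d) (hr : Function.Injective r)
    (n : ℕ) : ∀ (ι : Type) [Fintype ι] [DecidableEq ι], Fintype.card ι = n →
      ∀ (γ : Perm ι) (s : ι → Λ), LinkedLabels r γ s →
      twistedSum d γ s * d ^ (Finset.univ.image s).card ≤ d * risingProd d s := by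
  induction n with
  | zero =>
    intro ι _ _ hι γ s _
    have : IsEmpty ι := Fintype.card_eq_zero_iff.mp hι
    have h3 : risingProd d s = 1 := by
      unfold risingProd
      exact Finset.prod_eq_one fun b _ => by simp
    have h4 : (Finset.univ.image s).card = 0 := by simp
    rw [twistedSum_of_isEmpty, h3, h4]
    simpa using hd
  | succ n ih =>
    intro ι _ _ hι γ s hL
    have : Nonempty ι := Fintype.card_pos_iff.mp (by omega)
    obtain ⟨t, ht⟩ := Finite.exists_max fun i => r (s i)
    -- choose a point with the label of highest rank, preceded by the same label if possible
    obtain ⟨i₀, hi₀, hchoice⟩ : ∃ i₀, s i₀ = s t ∧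
        (s (γ⁻¹ i₀) = s t ∨ ∀ i, s i = s t → s (γ i) ≠ s t) := by
      by_cases h : ∃ i, s i = s t ∧ s (γ i) = s t
      · obtain ⟨i, h1, h2⟩ := h
        exact ⟨γ i, h2, Or.inl (by simpa using h1)⟩
      · push Not at h
        exact ⟨t, rfl, Or.inr h⟩
    let e := optionSubtypeNe i₀
    have hcard : Fintype.card {j // j ≠ i₀} = n := by
      rw [Fintype.card_subtype_compl, Fintype.card_subtype_eq, hι]
      omega
    rw [← twistedSum_congr d e, ← risingProd_congr d e]
    have himg : Finset.univ.image s = Finset.univ.image (s ∘ e) := by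
      ext b
      simp only [Finset.mem_image, Finset.mem_univ, true_and, Function.comp_apply]
      exact ⟨fun ⟨i, hi⟩ => ⟨e.symm i, by simpa using hi⟩, fun ⟨i, hi⟩ => ⟨e i, hi⟩⟩
    rw [himg]
    have hL' : LinkedLabels r (e.symm.permCongr γ) (s ∘ e) := by
      rintro i ⟨k, hk⟩
      obtain ⟨j, hj⟩ := hL (e i) ⟨e k, hk⟩
      exact ⟨e.symm j, by simpa [Equiv.permCongr_apply] using hj⟩
    have hen : e none = i₀ := rfl
    have hmax : ∀ i, r ((s ∘ e) i) ≤ r ((s ∘ e) none) := by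
      intro i
      simp only [Function.comp_apply, hen, hi₀]
      exact ht _
    set γ' := e.symm.permCongr γ with hγ'
    have hinv : (s ∘ e) (γ'⁻¹ none) = s (γ⁻¹ i₀) := by
      have : γ'⁻¹ none = e.symm (γ⁻¹ i₀) := by
        rw [Perm.inv_eq_iff_eq]
        simp [hγ', Equiv.permCongr_apply, ← hen]
      simp [this]
    have hdec := exists_eq_optionCongr_mul_swap γ'
    have hnone : (s ∘ e) none = s t := hi₀
    by_cases hcase : s (γ⁻¹ i₀) = s t
    · rw [hdec] at hL' ⊢
      refine twistedSum_option_le_of_eq hr hmax ?_ hL' fun h => ih _ hcard _ _ h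
      rw [hinv, hcase, hnone]
    · have hloop := hchoice.resolve_left hcase
      obtain ⟨a, ha⟩ : ∃ a, γ'⁻¹ none = some a := by
        rw [← Option.ne_none_iff_exists']
        intro h
        rw [h, hnone] at hinv
        exact hcase hinv.symm
      rw [ha] at hdec hinv
      have hloop' : ∀ i, (s ∘ e) i = (s ∘ e) none → (s ∘ e) (γ' i) ≠ (s ∘ e) none := by
        intro i hi
        rw [hnone] at hi ⊢
        simpa [hγ', Equiv.permCongr_apply] using hloop (e i) hi
      rw [hdec] at hL' hloop' ⊢
      refine twistedSum_option_le_of_ne hd hr hmax hloop' ?_ hL' fun γ' h => ih _ hcard _ _ h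
      rw [hinv, hnone]
      exact hcase

open Classical in
/-- Labels ordered by first appearance, the ones which do not appear coming last. -/
noncomputable def firstRank {n p : ℕ} (s : Fin n → Fin p) (b : Fin p) : ℕ :=
  if h : ∃ i, ∃ hi : i < n, s ⟨i, hi⟩ = b then Nat.find h else n + b

theorem firstRank_le {n p : ℕ} (s : Fin n → Fin p) (i : Fin n) : firstRank s (s i) ≤ i := by
  classical
  have h : ∃ j, ∃ hj : j < n, s ⟨j, hj⟩ = s i := ⟨i, i.2, rfl⟩
  rw [firstRank, dif_pos h]
  exact Nat.find_min' h ⟨i.2, rfl⟩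

theorem exists_firstRank_eq {n p : ℕ} (s : Fin n → Fin p) (i : Fin n) :
    ∃ j : Fin n, s j = s i ∧ firstRank s (s i) = j := by
  classical
  have h : ∃ j, ∃ hj : j < n, s ⟨j, hj⟩ = s i := ⟨i, i.2, rfl⟩
  obtain ⟨h1, h2⟩ := Nat.find_spec h
  exact ⟨⟨_, h1⟩, h2, by rw [firstRank, dif_pos h]⟩

theorem firstRank_injective {n p : ℕ} (s : Fin n → Fin p) :
    Function.Injective (firstRank s) := by
  classical
  have hlt : ∀ b (h : ∃ i, ∃ hi : i < n, s ⟨i, hi⟩ = b), Nat.find h < n ∧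
      ∀ hi, s ⟨Nat.find h, hi⟩ = b := fun b h =>
    ⟨(Nat.find_spec h).choose, fun _ => (Nat.find_spec h).choose_spec⟩
  intro b b' h
  unfold firstRank at h
  split_ifs at h with h1 h2 h2
  · rw [← (hlt b h1).2 (hlt b h1).1, ← (hlt b' h2).2 (hlt b' h2).1]
    simp [h]
  · have := (hlt b h1).1
    omega
  · have := (hlt b' h2).1
    omega
  · exact Fin.ext (by omega)

/-- The point just before the first occurrence of a label carries a label that occurred earlier, so
the rotation links all labels ranked by first appearance. -/
theorem twistedSum_finRotate_mul_pow_le {n p d : ℕ} (hd : 1 ≤ d) (s : Fin n → Fin p) :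
    twistedSum d (finRotate n) s * d ^ (Finset.univ.image s).card ≤ d * risingProd d s := by
  refine twistedSum_mul_pow_le hd (firstRank_injective s) n _ (Fintype.card_fin n) _ _ ?_
  rintro i ⟨k, hk⟩
  obtain ⟨j, hj, hr⟩ := exists_firstRank_eq s i
  obtain ⟨j, hjn⟩ := j
  rw [hr] at hk ⊢
  rcases j with _ | j
  · simp at hk
  · obtain ⟨n, rfl⟩ : ∃ n', n = n' + 1 := ⟨n - 1, by omega⟩
    have h1 : finRotate (n + 1) ⟨j, by omega⟩ = ⟨j + 1, hjn⟩ :=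
      finRotate_of_lt (by omega)
    refine ⟨⟨j, by omega⟩, Or.inr ⟨by rw [h1, hj], ?_⟩⟩
    exact (firstRank_le s _).trans_lt (by simp)

end UpperBound

end Equiv.Perm

/-! ### Equality for labellings by the cycles of a genus zero permutation -/

namespace Equiv.Perm

section GenusZero

variable {Λ : Type*} [DecidableEq Λ] [Fintype Λ]

/-- Each cycle contains a representative and its image, which are distinct. -/
theorem two_mul_numCycles_le {ι : Type*} [Fintype ι] {σ : Perm ι} (h : ∀ x, σ x ≠ x) :
    2 * numCycles σ ≤ Fintype.card ι := by
  classical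
  let f : Quotient (SameCycle.setoid σ) × Bool → ι := fun q => if q.2 then σ q.1.out else q.1.out
  have hf : Function.Injective f := by
    have key : ∀ q : Quotient (SameCycle.setoid σ), ∀ b,
        Quotient.mk (SameCycle.setoid σ) (f (q, b)) = q := by
      intro q b
      have h1 : Quotient.mk (SameCycle.setoid σ) q.out = q := Quotient.out_eq q
      rcases b with _ | _
      · exact h1
      · refine Eq.trans (Quotient.sound ?_) h1
        change σ.SameCycle (σ q.out) q.out
        exact SameCycle.symm ⟨1, by simp⟩
    rintro ⟨q, b⟩ ⟨q', b'⟩ he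
    have : q = q' := by rw [← key q b, ← key q' b', he]
    subst this
    rcases b with _ | _ <;> rcases b' with _ | _
    · rfl
    · exact absurd he.symm (h _)
    · exact absurd he (h _)
    · rfl
  have := Nat.card_le_card_of_injective f hf
  rw [Nat.card_prod, Nat.card_eq_fintype_card (α := ι)] at this
  simpa [numCycles, mul_comm] using this

theorem sameCycle_of_numCycles_eq_one {ι : Type*} [Finite ι] {c : Perm ι} (h : numCycles c = 1)
    (x y : ι) : c.SameCycle x y := by
  have := (Nat.card_eq_one_iff_unique.mp h).1
  exact Quotient.exact (Subsingleton.elim (Quotient.mk (SameCycle.setoid c) x) (Quotient.mk _ y))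

theorem not_sameCycle_of_isFixed {ι : Type*} {σ : Perm ι} {x y : ι} (h : σ x = x) (hxy : x ≠ y) :
    ¬ σ.SameCycle x y := by
  rintro ⟨n, hn⟩
  have : Function.IsFixedPt σ x := h
  rw [this.perm_zpow n |>.eq] at hn
  exact hxy hn

/-- Every cycle of `σ` is noncrossing and traversed in the right direction, relative to the cyclic
order given by `c`. -/
def GenusZero {ι : Type*} (c σ : Perm ι) : Prop :=
  numCycles σ + numCycles (σ * c) = Nat.card ι + 1

section Step

variable {β : Type*} [Fintype β] [DecidableEq β] {d : ℕ}

/-- The deleted point is alone with its label: the sum over j in the recursion is empty, and both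
sides gain exactly one factor d. -/
theorem twistedSum_option_eq_of_fixed {c₀ σ₀ : Perm β} {a : β} {s : Option β → Λ}
    (hs : ∀ i j, s i = s j ↔ SameCycle (optionCongr σ₀) i j)
    (ih : twistedSum d c₀ (s ∘ some) * d ^ numCycles σ₀ = d * risingProd d (s ∘ some)) :
    twistedSum d (optionCongr c₀ * swap none (some a)) s * d ^ numCycles (optionCongr σ₀) =
      d * risingProd d s := by
  have hno : ∀ j : β, s (some j) ≠ s none := fun j h =>
    not_sameCycle_optionCongr_none_some σ₀ j ((hs _ _).mp h.symm)
  have hemp : Finset.filter (fun j : β => s (some j) = s none) Finset.univ = ∅ :=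
    Finset.filter_eq_empty_iff.mpr fun j _ => hno j
  rw [twistedSum_option_of_ne d c₀ a s (hno a), risingProd_option, hemp, Finset.sum_empty,
    Finset.card_empty, add_zero, add_zero, numCycles_optionCongr, pow_succ', mul_left_comm, ih]

theorem twistedSum_option_eq_of_swap {c₀ σ₀ : Perm β} {a : β} {s : Option β → Λ}
    (hs : ∀ i j, s i = s j ↔ SameCycle (swap none (some a) * optionCongr σ₀) i j)
    (ih : twistedSum d c₀ (s ∘ some) * d ^ numCycles σ₀ = d * risingProd d (s ∘ some)) :
    twistedSum d (optionCongr c₀ * swap none (some a)) s *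
      d ^ numCycles (swap none (some a) * optionCongr σ₀) = d * risingProd d s := by
  have h : s (some a) = s none := (hs _ _).mpr (SameCycle.symm ⟨1, by simp⟩)
  rw [twistedSum_option_of_eq d c₀ (some a) s h, risingProd_option,
    numCycles_swap_none_mul_optionCongr, mul_assoc, ih, mul_left_comm]

end Step

/-- With at least two points, a genus zero σ has a point that is fixed or is sent to its predecessor
under c. Deleting it keeps c long and σ of genus zero, and in both cases the recursion for the
twisted sum is exact. -/
theorem twistedSum_mul_pow_eq {d : ℕ} (n : ℕ) : ∀ (ι : Type) [Fintype ι] [DecidableEq ι],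
    Fintype.card ι = n + 1 → ∀ (c σ : Perm ι) (s : ι → Λ), numCycles c = 1 → GenusZero c σ →
      (∀ i j, s i = s j ↔ σ.SameCycle i j) →
      twistedSum d c s * d ^ numCycles σ = d * risingProd d s := by
  induction n with
  | zero =>
    intro ι _ _ hι c σ s hc hg hs
    obtain ⟨i, hi⟩ := Fintype.card_eq_one_iff.mp hι
    have hsub : Subsingleton ι := ⟨fun x y => (hi x).trans (hi y).symm⟩
    have h1 : labelPerms s = {c} := by
      ext τ
      simp [mem_labelPerms, Subsingleton.elim τ c, fun j => hi j]
    have h2 : risingProd d s = d := by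
      unfold risingProd
      rw [Finset.prod_eq_single (s i)]
      · rw [Finset.filter_true_of_mem (fun j _ => by rw [hi j]), Finset.card_univ, hι,
          Nat.ascFactorial_succ]
        simp
      · intro b _ hb
        rw [Finset.filter_false_of_mem (fun j _ => by rw [hi j]; exact hb.symm)]
        simp
      · simp
    rw [twistedSum, h1, Finset.sum_singleton, h2, Subsingleton.elim σ c,
      Subsingleton.elim (c * c) c, hc, pow_one]
  | succ n ih =>
    intro ι _ _ hι c σ s hc hg hs
    rw [GenusZero, Nat.card_eq_fintype_card, hι] at hg
    -- Otherwise neither σ nor σ c has a fixed point, and each has at most half as many cycles as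
    -- there are points, one short in total of genus zero.
    obtain ⟨i₀, hi₀⟩ : ∃ i, σ i = i ∨ σ i = c⁻¹ i := by
      by_contra! h
      have h1 := two_mul_numCycles_le fun i => (h i).1
      have h2 : 2 * numCycles (σ * c) ≤ Fintype.card ι := by
        refine two_mul_numCycles_le fun i hi => (h (c i)).2 ?_
        simpa using hi
      omega
    let e := optionSubtypeNe i₀
    have hcard : Fintype.card {j // j ≠ i₀} = n + 1 := by
      rw [Fintype.card_subtype_compl, Fintype.card_subtype_eq, hι]
      omega
    rw [← twistedSum_congr d e, ← risingProd_congr d e, ← numCycles_permCongr e.symm]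
    have hs' : ∀ i j, (s ∘ e) i = (s ∘ e) j ↔ (e.symm.permCongr σ).SameCycle i j := by
      intro i j
      have := sameCycle_permCongr e.symm σ (e i) (e j)
      simp only [Equiv.symm_apply_apply] at this
      rw [this]
      exact hs _ _
    rw [← numCycles_permCongr e.symm] at hc
    rw [← numCycles_permCongr e.symm σ, ← numCycles_permCongr e.symm (σ * c)] at hg
    have hmul : e.symm.permCongr (σ * c) = e.symm.permCongr σ * e.symm.permCongr c := by
      ext x
      simp [Equiv.permCongr_apply]
    rw [hmul] at hg
    have hen : e none = i₀ := rfl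
    have hi₀' : e.symm.permCongr σ none = none ∨
        e.symm.permCongr σ none = (e.symm.permCongr c)⁻¹ none := by
      refine hi₀.imp (fun h => ?_) (fun h => ?_)
      · rw [← e.symm_apply_eq.mpr hen.symm]
        simp [Equiv.permCongr_apply, h]
      · rw [eq_comm, Perm.inv_eq_iff_eq]
        simp only [Equiv.permCongr_apply, Equiv.symm_symm, hen, h]
        simp [← hen]
    set c' := e.symm.permCongr c with hc'
    set σ' := e.symm.permCongr σ with hσ'
    have hdec := exists_eq_optionCongr_mul_swap c'
    have hnone : c'⁻¹ none ≠ none := by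
      intro h
      have h1 : c' none = none := by
        rw [Perm.inv_eq_iff_eq] at h
        exact h.symm
      have : 0 < Fintype.card {j // j ≠ i₀} := by omega
      obtain ⟨j⟩ := Fintype.card_pos_iff.mp this
      exact not_sameCycle_of_isFixed h1 (Option.some_ne_none j).symm
        (sameCycle_of_numCycles_eq_one hc _ _)
    obtain ⟨a, ha⟩ := Option.ne_none_iff_exists'.mp hnone
    rw [ha] at hdec hi₀'
    set c₀ := removeNone c' with hc₀
    have hlong : numCycles c₀ = 1 := by
      rw [hdec, numCycles_mul_comm, numCycles_swap_none_mul_optionCongr] at hc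
      exact hc
    have hσdec : σ' = swap none (σ' none) * optionCongr (removeNone σ') := by
      rw [map_equiv_removeNone, swap_mul_self_mul]
    set σ₀ := removeNone σ' with hσ₀
    rw [hdec] at hg ⊢
    rcases hi₀' with h | h
    · rw [h, swap_self, ← one_def, one_mul] at hσdec
      rw [hσdec] at hs' hg ⊢
      refine twistedSum_option_eq_of_fixed hs' (ih _ hcard c₀ σ₀ _ hlong ?_ fun i j => ?_)
      · rw [← mul_assoc, ← optionCongr_mul', numCycles_mul_comm _ (swap _ _),
          numCycles_swap_none_mul_optionCongr, numCycles_optionCongr] at hg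
        rw [GenusZero, Nat.card_eq_fintype_card, hcard]
        omega
      · exact (hs' _ _).trans (sameCycle_optionCongr_some _ _ _)
    · rw [h] at hσdec
      rw [hσdec] at hs' hg ⊢
      refine twistedSum_option_eq_of_swap hs' (ih _ hcard c₀ σ₀ _ hlong ?_ fun i j => ?_)
      · rw [numCycles_option_self, numCycles_swap_none_mul_optionCongr] at hg
        rw [GenusZero, Nat.card_eq_fintype_card, hcard]
        omega
      · exact (hs' _ _).trans (sameCycle_swap_none_mul_optionCongr_some _ _ _ _)

end GenusZero

end Equiv.Perm

/-! ### Exceedances, the genus inequality and rigidity of genus zero permutations -/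

namespace Equiv.Perm

section Exceedances

@[simp]
theorem sameCycle_self {ι : Type*} (σ : Perm ι) (x : ι) : σ.SameCycle x x := SameCycle.refl σ x

/-- Long cycles on sets of equal size are conjugate. For fewer than two points, where `IsCycle` does
not apply, the claim is trivial. -/
theorem exists_permCongr_eq_finRotate {ι : Type*} [Fintype ι] {n : ℕ} (hn : Fintype.card ι = n)
    {c : Perm ι} (hc : numCycles c = 1) : ∃ e : ι ≃ Fin n, e.permCongr c = finRotate n := by
  classical
  let e₀ := Fintype.equivFinOfCardEq hn
  rcases lt_or_ge n 2 with h | h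
  · have : Subsingleton (Fin n) := by
      have : n = 0 ∨ n = 1 := by omega
      rcases this with rfl | rfl <;> infer_instance
    exact ⟨e₀, Subsingleton.elim _ _⟩
  obtain ⟨n, rfl⟩ : ∃ k, n = k + 2 := ⟨n - 2, by omega⟩
  have hc' : numCycles (e₀.permCongr c) = 1 := by rw [numCycles_permCongr, hc]
  set c' := e₀.permCongr c
  have hall := sameCycle_of_numCycles_eq_one hc'
  have hne : ∀ x, c' x ≠ x := by
    intro x hx
    obtain ⟨y, hy⟩ := exists_ne x
    exact not_sameCycle_of_isFixed hx hy.symm (hall x y)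
  have hcyc : c'.IsCycle := ⟨0, hne 0, fun y _ => hall 0 y⟩
  have hsupp : c'.support = Finset.univ := by
    ext x
    simp [hne x]
  have hconj : IsConj c' (finRotate (n + 2)) :=
    hcyc.isConj isCycle_finRotate (by rw [hsupp, support_finRotate])
  obtain ⟨u, hu⟩ := isConj_iff.mp hconj
  refine ⟨e₀.trans u, ?_⟩
  rw [← hu]
  ext x
  simp [c', Equiv.permCongr_apply]

variable {n : ℕ}

theorem exists_le_apply (σ : Perm (Fin n)) (x : Fin n) : ∃ y, σ.SameCycle x y ∧ y ≤ σ y := by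
  classical
  obtain ⟨y, hy, hmin⟩ := Finset.exists_min_image
    (Finset.univ.filter fun y => σ.SameCycle x y) id ⟨x, by simp⟩
  have h1 := (Finset.mem_filter.mp hy).2
  refine ⟨y, h1, hmin (σ y) ?_⟩
  simpa using h1

theorem exists_apply_le (σ : Perm (Fin n)) (x : Fin n) : ∃ y, σ.SameCycle x y ∧ σ y ≤ y := by
  classical
  obtain ⟨y, hy, hmax⟩ := Finset.exists_max_image
    (Finset.univ.filter fun y => σ.SameCycle x y) id ⟨x, by simp⟩
  have h1 := (Finset.mem_filter.mp hy).2
  refine ⟨y, h1, hmax (σ y) ?_⟩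
  simpa using h1

/-- A set which meets each cycle has at least as many elements as there are cycles, and strictly
more if it has two elements on one cycle. -/
theorem numCycles_le_card {ι : Type*} [Fintype ι] {σ : Perm ι} {S : Finset ι}
    (hS : ∀ x, ∃ y, σ.SameCycle x y ∧ y ∈ S) : numCycles σ ≤ S.card := by
  classical
  have hsurj : Function.Surjective fun y : S => Quotient.mk (SameCycle.setoid σ) y.1 := by
    intro q
    induction q using Quotient.inductionOn with | _ x
    obtain ⟨y, hy, hyS⟩ := hS x
    exact ⟨⟨y, hyS⟩, Quotient.sound hy.symm⟩
  have := Nat.card_le_card_of_surjective _ hsurj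
  simpa [numCycles] using this

theorem exists_sameCycle_of_numCycles_lt {ι : Type*} [Fintype ι] {σ : Perm ι} {S : Finset ι}
    (hS : numCycles σ < S.card) : ∃ x ∈ S, ∃ y ∈ S, x ≠ y ∧ σ.SameCycle x y := by
  classical
  have := Fintype.ofFinite (Quotient (SameCycle.setoid σ))
  obtain ⟨x, hx, y, hy, hxy, h⟩ := Finset.exists_ne_map_eq_of_card_lt_of_maps_to
    (s := S) (t := (Finset.univ : Finset (Quotient (SameCycle.setoid σ))))
    (by rwa [Finset.card_univ, ← Nat.card_eq_fintype_card])
    (f := fun y => Quotient.mk (SameCycle.setoid σ) y) (fun _ _ => Finset.mem_univ _)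
  exact ⟨x, hx, y, hy, hxy, Quotient.exact h⟩

/-- The weak exceedances. -/
def exceedances (σ : Perm (Fin n)) : Finset (Fin n) := {i | i ≤ σ i}

/-- The weak antiexceedances. -/
def antiExceedances (σ : Perm (Fin n)) : Finset (Fin n) := {i | σ i ≤ i}

theorem mem_exceedances {σ : Perm (Fin n)} {i : Fin n} : i ∈ exceedances σ ↔ i ≤ σ i := by
  simp [exceedances]

theorem mem_antiExceedances {σ : Perm (Fin n)} {i : Fin n} :
    i ∈ antiExceedances σ ↔ σ i ≤ i := by
  simp [antiExceedances]

theorem numCycles_le_card_exceedances (σ : Perm (Fin n)) :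
    numCycles σ ≤ (exceedances σ).card :=
  numCycles_le_card fun x => by simpa [exceedances] using exists_le_apply σ x

theorem numCycles_le_card_antiExceedances (σ : Perm (Fin n)) :
    numCycles σ ≤ (antiExceedances σ).card :=
  numCycles_le_card fun x => by simpa [antiExceedances] using exists_apply_le σ x

/-- After rotation, i is a weak antiexceedance iff σ i < i or σ i is the last point, which wraps to
0. The last point has exactly one preimage, and that preimage is a weak exceedance. -/
theorem card_exceedances_add (σ : Perm (Fin (n + 1))) :
    (exceedances σ).card + (antiExceedances (finRotate (n + 1) * σ)).card = n + 2 := by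
  classical
  have h1 : antiExceedances (finRotate (n + 1) * σ) =
      insert (σ⁻¹ (Fin.last n)) (Finset.univ.filter fun i => ¬ i ≤ σ i) := by
    ext i
    simp only [mem_antiExceedances, Finset.mem_filter, Finset.mem_univ, true_and, Perm.mul_apply,
      Finset.mem_insert, not_le]
    by_cases hi : σ i = Fin.last n
    · have : i = σ⁻¹ (Fin.last n) := by rw [eq_comm, Perm.inv_eq_iff_eq, hi]
      simp [hi, ← this]
    · have h2 : i ≠ σ⁻¹ (Fin.last n) := by
        rintro rfl
        exact hi (by simp)
      have h3 : ((finRotate (n + 1) (σ i) : Fin (n + 1)) : ℕ) = σ i + 1 :=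
        coe_finRotate_of_ne_last hi
      rw [Fin.le_def, h3]
      simp only [h2, false_or, Fin.lt_def]
      omega
  have h2 : σ⁻¹ (Fin.last n) ∉ Finset.univ.filter fun i => ¬ i ≤ σ i := by
    simp [Fin.le_last]
  rw [h1, Finset.card_insert_of_notMem h2, ← add_assoc, exceedances,
    Finset.card_filter_add_card_filter_not, Finset.card_univ, Fintype.card_fin]

/-- Cycles of σ are at most its exceedances, cycles of cσ at most its antiexceedances, and these two
numbers add up to one more than the number of points. -/
theorem numCycles_add_le_of_long {ι : Type*} [Fintype ι] {c : Perm ι} (hc : numCycles c = 1)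
    (σ : Perm ι) : numCycles σ + numCycles (σ * c) ≤ Fintype.card ι + 1 := by
  have hpos : 0 < Fintype.card ι := by
    rw [Fintype.card_pos_iff]
    obtain ⟨q⟩ := (Nat.card_eq_one_iff_unique.mp hc).2
    exact ⟨q.out⟩
  obtain ⟨n, hn⟩ : ∃ n, Fintype.card ι = n + 1 := ⟨Fintype.card ι - 1, by omega⟩
  obtain ⟨e, he⟩ := exists_permCongr_eq_finRotate hn hc
  rw [← numCycles_permCongr e, ← numCycles_permCongr e, hn]
  have hmul : e.permCongr (σ * c) = e.permCongr σ * e.permCongr c := by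
    ext x
    simp [Equiv.permCongr_apply]
  rw [hmul, he, numCycles_mul_comm (e.permCongr σ)]
  have h1 := numCycles_le_card_exceedances (e.permCongr σ)
  have h2 := numCycles_le_card_antiExceedances (finRotate (n + 1) * e.permCongr σ)
  have h3 := card_exceedances_add (e.permCongr σ)
  omega

/-- The cycles of a permutation of genus zero are decreasing. -/
theorem GenusZero.apply_lt {σ : Perm (Fin (n + 1))} (h : GenusZero (finRotate (n + 1)) σ)
    {x y : Fin (n + 1)} (hxy : σ.SameCycle x y) (hlt : y < x) : σ x < x := by
  rw [GenusZero, numCycles_mul_comm, Nat.card_eq_fintype_card, Fintype.card_fin] at h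
  have h2 := numCycles_le_card_antiExceedances (finRotate (n + 1) * σ)
  have h3 := card_exceedances_add σ
  by_contra! hx
  obtain ⟨z, hz, hmin⟩ := Finset.exists_min_image
    (Finset.univ.filter fun y => σ.SameCycle x y) id ⟨x, by simp⟩
  have hz' := (Finset.mem_filter.mp hz).2
  have hzy : z ≤ y := hmin y (by simpa using hxy)
  -- the exceedances other than `x` still meet each cycle
  have hle : numCycles σ ≤ ((exceedances σ).erase x).card := by
    refine numCycles_le_card fun w => ?_
    by_cases hw : σ.SameCycle w x
    · refine ⟨z, hw.trans hz', Finset.mem_erase.mpr ⟨(hzy.trans_lt hlt).ne, ?_⟩⟩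
      simp only [exceedances, Finset.mem_filter, Finset.mem_univ, true_and]
      exact hmin (σ z) (by simpa using hz')
    · obtain ⟨v, hv, hv'⟩ := exists_le_apply σ w
      refine ⟨v, hv, Finset.mem_erase.mpr ⟨fun e => hw (e ▸ hv), ?_⟩⟩
      simpa [exceedances] using hv'
  rw [Finset.card_erase_of_mem (by simpa [exceedances] using hx)] at hle
  have : 0 < (exceedances σ).card := Finset.card_pos.mpr ⟨x, by simpa [exceedances] using hx⟩
  omega

/-- A decreasing cycle maps an element to its predecessor on the cycle. -/
theorem GenusZero.not_lt_of_sameCycle {σ : Perm (Fin (n + 1))}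
    (h : GenusZero (finRotate (n + 1)) σ)
    {x y : Fin (n + 1)} (hxy : σ.SameCycle x y) (h1 : σ x < y) : ¬ y < x := by
  intro h2
  let D : Finset (Fin (n + 1)) := Finset.univ.filter fun z => σ.SameCycle x z ∧ z < y
  have hσxD : σ x ∈ D := by simp [D, h1]
  obtain ⟨z, hz, hmin⟩ := Finset.exists_min_image D id ⟨_, hσxD⟩
  have hz' := (Finset.mem_filter.mp hz).2
  have hmaps : ∀ w ∈ insert x (insert y (D.erase z)), σ w ∈ D := by
    intro w hw
    simp only [Finset.mem_insert, Finset.mem_erase] at hw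
    rcases hw with rfl | rfl | ⟨hwz, hw⟩
    · exact hσxD
    · have := h.apply_lt (hxy.symm.trans (sameCycle_apply_right.mpr (SameCycle.refl σ x))) h1
      simp [D, this, hxy]
    · have hw' := (Finset.mem_filter.mp hw).2
      have hzw : z < w := lt_of_le_of_ne (hmin w hw) hwz.symm
      have := h.apply_lt (hw'.1.symm.trans hz'.1) hzw
      simp only [D, Finset.mem_filter, Finset.mem_univ, true_and, sameCycle_apply_right]
      exact ⟨hw'.1, this.trans hw'.2⟩
  -- If σ x < y < x, then σ maps x, y and all of D but its minimum injectively into D, which is one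
  -- point too many.
  have hcard := Finset.card_le_card_of_injOn σ hmaps (σ.injective.injOn)
  have hyD : y ∉ D.erase z := by simp [D]
  have hxD : x ∉ insert y (D.erase z) := by
    simp only [D, Finset.mem_insert, Finset.mem_erase, Finset.mem_filter, not_or]
    exact ⟨h2.ne', fun hh => absurd hh.2.2.2 h2.le.not_gt⟩
  rw [Finset.card_insert_of_notMem hxD, Finset.card_insert_of_notMem hyD,
    Finset.card_erase_of_mem hz] at hcard
  have : 0 < D.card := Finset.card_pos.mpr ⟨z, hz⟩
  omega

/-- A permutation of genus zero is determined by its orbits. -/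
theorem GenusZero.eq_of_sameCycle_iff {σ τ : Perm (Fin (n + 1))}
    (hσ : GenusZero (finRotate (n + 1)) σ) (hτ : GenusZero (finRotate (n + 1)) τ)
    (h : ∀ x y, σ.SameCycle x y ↔ τ.SameCycle x y) : σ = τ := by
  have key : ∀ {σ τ : Perm (Fin (n + 1))}, GenusZero (finRotate (n + 1)) σ →
      GenusZero (finRotate (n + 1)) τ → (∀ x y, σ.SameCycle x y ↔ τ.SameCycle x y) →
      ∀ x, (∃ y, σ.SameCycle x y ∧ y < x) → σ x ≤ τ x → σ x = τ x := by
    rintro σ τ hσ hτ h x ⟨y, hy, hyx⟩ hle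
    by_contra hne
    have h1 : τ x < x := hτ.apply_lt ((h _ _).mp hy) hyx
    refine hσ.not_lt_of_sameCycle ?_ (lt_of_le_of_ne hle hne) h1
    rw [h]
    simp
  have hnonmin : ∀ x, (∃ y, σ.SameCycle x y ∧ y < x) → σ x = τ x := by
    intro x hx
    rcases le_total (σ x) (τ x) with hle | hle
    · exact key hσ hτ h x hx hle
    · obtain ⟨y, hy, hyx⟩ := hx
      exact (key hτ hσ (fun a b => (h a b).symm) x ⟨y, (h _ _).mp hy, hyx⟩ hle).symm
  ext1 x
  by_cases hx : ∃ y, σ.SameCycle x y ∧ y < x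
  · exact hnonmin x hx
  · -- the preimage of `σ x` under `τ` is not different from `x`
    by_contra hne
    set z := τ⁻¹ (σ x) with hz
    have hτz : τ z = σ x := by simp [hz]
    have hzx : z ≠ x := by
      intro e
      rw [e] at hτz
      exact hne hτz.symm
    have hsame : σ.SameCycle z x := by
      rw [h]
      have h1 : τ.SameCycle z (σ x) := ⟨1, by simp [hτz]⟩
      have h2 : τ.SameCycle (σ x) x := by
        rw [← h]
        simp
      exact h1.trans h2
    have hxz : x < z := by
      push Not at hx
      exact lt_of_le_of_ne (hx z hsame.symm) hzx.symm
    have := hnonmin z ⟨x, hsame, hxz⟩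
    rw [hτz] at this
    exact hzx (σ.injective this)

end Exceedances

end Equiv.Perm

/-! ### A recursion for genus zero permutations, refined by the period of a marked point -/

namespace Equiv.Perm

section GenusZeroCount

open Function

variable {β : Type*} [Fintype β] [DecidableEq β]

theorem minimalPeriod_eq_of_forall {α : Type*} {f : α → α} {x : α} {n : ℕ} (hn : 1 ≤ n)
    (h : f^[n] x = x) (hlt : ∀ t, 1 ≤ t → t < n → f^[t] x ≠ x) : minimalPeriod f x = n := by
  have h1 : IsPeriodicPt f n x := h
  have h2 := h1.minimalPeriod_le hn
  have h3 := h1.minimalPeriod_pos hn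
  by_contra hne
  exact hlt _ h3 (lt_of_le_of_ne h2 hne) (iterate_minimalPeriod (f := f) (x := x))

theorem minimalPeriod_pos_of_finite (ρ : Perm β) (a : β) : 0 < minimalPeriod ρ a :=
  minimalPeriod_pos_of_mem_periodicPts
    ⟨orderOf ρ, orderOf_pos ρ, by
      rw [IsPeriodicPt, IsFixedPt, iterate_eq_pow, pow_orderOf_eq_one, one_apply]⟩

theorem minimalPeriod_option_none (ρ : Perm β) (a : β) :
    minimalPeriod (optionCongr ρ * swap none (some a) : Perm (Option β)) none =
      minimalPeriod ρ a + 1 := by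
  set f : Perm (Option β) := optionCongr ρ * swap none (some a) with hf
  have hpos := minimalPeriod_pos_of_finite ρ a
  have hiter : ∀ t, t < minimalPeriod ρ a → f^[t + 1] none = some (ρ^[t + 1] a) := by
    intro t
    induction t with
    | zero => intro _; simp [hf]
    | succ t ih =>
      intro ht
      rw [iterate_succ_apply', ih (by omega), iterate_succ_apply' _ (t + 1)]
      have : ρ^[t + 1] a ≠ a := fun h =>
        not_isPeriodicPt_of_pos_of_lt_minimalPeriod (Nat.succ_ne_zero t) ht h
      simp [hf, swap_apply_of_ne_of_ne, this, -iterate_succ]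
  refine minimalPeriod_eq_of_forall (by omega) ?_ ?_
  · obtain ⟨t, ht⟩ : ∃ t, minimalPeriod ρ a = t + 1 := ⟨minimalPeriod ρ a - 1, by omega⟩
    rw [iterate_succ_apply', ht, hiter t (by omega), ← ht, iterate_minimalPeriod]
    simp [hf]
  · intro t h1 h2
    obtain ⟨t, rfl⟩ : ∃ k, t = k + 1 := ⟨t - 1, by omega⟩
    rw [hiter t (by omega)]
    simp

/-- The new point enters the orbit of a in place of a, and the inserted transposition closes this
orbit after n steps. -/
theorem minimalPeriod_option_some (ρ : Perm β) (a : β) {n : ℕ} (hn : 1 ≤ n)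
    (hn' : n ≤ minimalPeriod ρ a) :
    minimalPeriod (swap none (some (ρ^[n] a)) * optionCongr ρ * swap none (some a) :
      Perm (Option β)) none = n := by
  set f : Perm (Option β) := swap none (some (ρ^[n] a)) * optionCongr ρ * swap none (some a) with hf
  have hinj : ∀ t, 1 ≤ t → t < n → ρ^[t] a ≠ ρ^[n] a := by
    intro t h1 h2 h
    have h3 : ρ^[n - t] a = a := by
      have : ρ^[t] (ρ^[n - t] a) = ρ^[t] a := by
        rw [← iterate_add_apply, h]
        congr 1
        omega
      exact (ρ.injective.iterate t) this
    exact not_isPeriodicPt_of_pos_of_lt_minimalPeriod (by omega) (by omega) h3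
  have hiter : ∀ t, t + 1 < n → f^[t + 1] none = some (ρ^[t + 1] a) := by
    intro t
    induction t with
    | zero =>
      intro h
      have := hinj 1 le_rfl (by omega)
      rw [iterate_one] at this
      simp [hf, swap_apply_of_ne_of_ne, this]
    | succ t ih =>
      intro ht
      rw [iterate_succ_apply', ih (by omega)]
      have h1 : ρ^[t + 1] a ≠ a := fun h =>
        not_isPeriodicPt_of_pos_of_lt_minimalPeriod (Nat.succ_ne_zero t) (by omega) h
      have h2 := hinj (t + 1 + 1) (by omega) ht
      have h3 : f (some (ρ^[t + 1] a)) = swap none (some (ρ^[n] a)) (some (ρ (ρ^[t + 1] a))) := by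
        rw [hf, Perm.mul_apply, Perm.mul_apply, swap_apply_of_ne_of_ne (Option.some_ne_none _)
          (by simpa using h1), optionCongr_apply, Option.map_some]
      rw [h3, ← iterate_succ_apply' ρ (t + 1), swap_apply_of_ne_of_ne (Option.some_ne_none _)
        (by simpa using h2)]
  refine minimalPeriod_eq_of_forall hn ?_ ?_
  · obtain ⟨t, rfl⟩ : ∃ t, n = t + 1 := ⟨n - 1, by omega⟩
    rcases t with _ | t
    · simp [hf]
    · rw [iterate_succ_apply', hiter t (by omega)]
      have h1 : ρ^[t + 1] a ≠ a := fun h =>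
        not_isPeriodicPt_of_pos_of_lt_minimalPeriod (Nat.succ_ne_zero t) (by omega) h
      have h3 : ρ^[t + 1 + 1] a = ρ (ρ^[t + 1] a) := iterate_succ_apply' _ _ _
      rw [hf, h3]
      simp [swap_apply_of_ne_of_ne, h1, -iterate_succ]
  · intro t h1 h2
    obtain ⟨t, rfl⟩ : ∃ k, t = k + 1 := ⟨t - 1, by omega⟩
    rw [hiter t (by omega)]
    simp

variable {c : Perm β} {a : β}

theorem genusZero_option_none (σ : Perm β) :
    GenusZero (optionCongr c * swap none (some a)) (swap none none * optionCongr σ) ↔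
      GenusZero c σ := by
  rw [GenusZero, GenusZero, numCycles_option_none, swap_self, ← one_def, one_mul,
    numCycles_optionCongr, Finite.card_option]
  omega

/-- The number of points grows by one and #σ does not, so σ c must gain a cycle. Given the genus
inequality, this means that genus zero held before and that `swap a j` splits a cycle of σ c (for a
= j the new point is its own cycle). -/
theorem genusZero_option_some (hc : numCycles c = 1) (σ : Perm β) (j : β) :
    GenusZero (optionCongr c * swap none (some a)) (swap none (some j) * optionCongr σ) ↔
      GenusZero c σ ∧ (σ * c).SameCycle a j := by
  have hle := numCycles_add_le_of_long hc σ
  rw [GenusZero, GenusZero, numCycles_swap_none_mul_optionCongr, Finite.card_option]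
  rw [← Nat.card_eq_fintype_card] at hle
  by_cases haj : a = j
  · subst haj
    rw [numCycles_option_self]
    simp
    omega
  · rw [numCycles_option_some_some _ _ haj, mul_assoc]
    by_cases h : (σ * c).SameCycle a j
    · rw [numCycles_swap_mul_of_sameCycle haj h]
      simp only [h, and_true]
      omega
    · have := numCycles_swap_mul_add_one h
      simp only [h, and_false, iff_false]
      omega

open Classical in
/-- The number of permutations of genus zero with `l` cycles for which `a` has period `v`
under `σ c`. -/
noncomputable def genusZeroCount (c : Perm β) (a : β) (l v : ℕ) : ℕ :=
  ∑ σ : Perm β, if GenusZero c σ ∧ numCycles σ = l ∧ minimalPeriod (σ * c : Perm β) a = v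
    then 1 else 0

open Classical in
/-- The number of permutations of genus zero with `l` cycles for which `a` has period at least `v`
under `σ c`. -/
noncomputable def genusZeroTailCount (c : Perm β) (a : β) (l v : ℕ) : ℕ :=
  ∑ σ : Perm β, if GenusZero c σ ∧ numCycles σ = l ∧ v ≤ minimalPeriod (σ * c : Perm β) a
    then 1 else 0

theorem genusZeroTailCount_eq_add (c : Perm β) (a : β) (l v : ℕ) :
    genusZeroTailCount c a l v = genusZeroCount c a l v + genusZeroTailCount c a l (v + 1) := by
  classical
  unfold genusZeroTailCount genusZeroCount
  rw [← Finset.sum_add_distrib]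
  refine Finset.sum_congr rfl fun σ _ => ?_
  by_cases h : GenusZero c σ ∧ numCycles σ = l
  · simp only [h, true_and]
    split_ifs <;> omega
  · have h1 : ∀ P : Prop, ¬ (GenusZero c σ ∧ numCycles σ = l ∧ P) := fun P hP => h ⟨hP.1, hP.2.1⟩
    simp [h1]

theorem genusZeroTailCount_of_card_lt (c : Perm β) (a : β) (l : ℕ) {v : ℕ}
    (hv : Fintype.card β < v) : genusZeroTailCount c a l v = 0 := by
  classical
  unfold genusZeroTailCount
  refine Finset.sum_eq_zero fun σ _ => if_neg fun h => ?_
  have : minimalPeriod (σ * c : Perm β) a ≤ Fintype.card β := by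
    have h1 : Set.InjOn (fun t => (σ * c : Perm β)^[t] a)
        (Finset.range (minimalPeriod (σ * c : Perm β) a)) := by
      have := iterate_injOn_Iio_minimalPeriod (f := (σ * c : Perm β)) (x := a)
      rwa [Finset.coe_range]
    have := Finset.card_le_card_of_injOn (s := Finset.range _) (t := Finset.univ) _
      (fun _ _ => Finset.mem_univ _) h1
    simpa using this
  omega

/-- If the new point is fixed, the cycle count and the period both grow by one. If it is inserted
into a cycle, genus zero forces j = ρ^t a with 1 ≤ t ≤ period, and the new period is t; hence
exactly one j for each ρ whose period is at least v + 1. -/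
theorem genusZeroCount_option (hc : numCycles c = 1) (l v : ℕ) :
    genusZeroCount (optionCongr c * swap none (some a) : Perm (Option β)) none (l + 1) (v + 1) =
      genusZeroCount c a l v + genusZeroTailCount c a (l + 1) (v + 1) := by
  classical
  unfold genusZeroCount genusZeroTailCount
  rw [← Equiv.sum_comp decomposeOption.symm, Fintype.sum_prod_type_right,
    ← Finset.sum_add_distrib]
  refine Finset.sum_congr rfl fun σ _ => ?_
  rw [Fintype.sum_option]
  simp only [decomposeOption, Equiv.coe_fn_symm_mk]
  congr 1
  · refine if_congr ?_ rfl rfl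
    rw [genusZero_option_none, swap_self, ← one_def, one_mul, numCycles_optionCongr,
      ← mul_assoc, ← optionCongr_mul', minimalPeriod_option_none]
    simp
  · simp only [genusZero_option_some hc, numCycles_swap_none_mul_optionCongr]
    have hrew : ∀ j : β, swap none (some j) * optionCongr σ * (optionCongr c * swap none (some a)) =
        swap none (some j) * optionCongr (σ * c) * swap none (some a) := fun j => by
      rw [optionCongr_mul']
      simp only [mul_assoc]
    simp only [hrew]
    set ρ := σ * c with hρ
    by_cases h : GenusZero c σ ∧ numCycles σ = l + 1 ∧ v + 1 ≤ minimalPeriod ρ a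
    · rw [if_pos h, Finset.sum_eq_single (ρ^[v + 1] a), if_pos]
      · refine ⟨⟨h.1, ⟨(v + 1 : ℕ), ?_⟩⟩, h.2.1, minimalPeriod_option_some ρ a (by omega) h.2.2⟩
        rw [zpow_natCast, iterate_eq_pow]
      · rintro j - hj
        rw [if_neg]
        rintro ⟨⟨-, h1⟩, -, h2⟩
        obtain ⟨i, hi⟩ := h1.exists_nat_pow_eq
        rw [← iterate_eq_pow] at hi
        have hpos := minimalPeriod_pos_of_finite ρ a
        -- write `j` as an iterate with exponent between `1` and the period
        obtain ⟨t, ht1, ht2, ht⟩ : ∃ t, 1 ≤ t ∧ t ≤ minimalPeriod ρ a ∧ ρ^[t] a = j := by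
          rcases Nat.eq_zero_or_pos (i % minimalPeriod ρ a) with h0 | h0
          · refine ⟨minimalPeriod ρ a, hpos, le_rfl, ?_⟩
            rw [iterate_minimalPeriod, ← hi, ← iterate_mod_minimalPeriod_eq, h0, iterate_zero, id]
          · exact ⟨_, h0, (Nat.mod_lt _ hpos).le, by rw [iterate_mod_minimalPeriod_eq, hi]⟩
        rw [← ht, minimalPeriod_option_some ρ a ht1 ht2] at h2
        rw [h2] at ht
        exact hj ht.symm
      · simp
    · rw [if_neg h]
      refine Finset.sum_eq_zero fun j _ => if_neg ?_
      rintro ⟨⟨h0, h1⟩, h3, h2⟩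
      obtain ⟨i, hi⟩ := h1.exists_nat_pow_eq
      rw [← iterate_eq_pow] at hi
      have hpos := minimalPeriod_pos_of_finite ρ a
      obtain ⟨t, ht1, ht2, ht⟩ : ∃ t, 1 ≤ t ∧ t ≤ minimalPeriod ρ a ∧ ρ^[t] a = j := by
        rcases Nat.eq_zero_or_pos (i % minimalPeriod ρ a) with h0 | h0
        · refine ⟨minimalPeriod ρ a, hpos, le_rfl, ?_⟩
          rw [iterate_minimalPeriod, ← hi, ← iterate_mod_minimalPeriod_eq, h0, iterate_zero, id]
        · exact ⟨_, h0, (Nat.mod_lt _ hpos).le, by rw [iterate_mod_minimalPeriod_eq, hi]⟩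
      rw [← ht, minimalPeriod_option_some ρ a ht1 ht2] at h2
      exact h ⟨h0, h3, by omega⟩

end GenusZeroCount

end Equiv.Perm

/-! ### Narayana numbers count genus zero permutations -/

namespace Equiv.Perm

section Narayana

/-- Closed form of `genusZeroCount`. -/
noncomputable def genusZeroNumber (m l v : ℕ) : ℝ :=
  if v ≤ l ∧ l ≤ m then (v : ℝ) / m * m.choose l * (m - v - 1).choose (l - v) else 0

/-- Closed form of `genusZeroTailCount`. -/
noncomputable def genusZeroTailNumber (m l v : ℕ) : ℝ :=
  if v ≤ l ∧ l ≤ m then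
    ((m - v).choose (l - v) : ℝ) * m.choose (l - 1) * ((v : ℝ) / l - ((v : ℝ) - 1) / m) else 0

theorem genusZeroNumber_succ {m l v : ℕ} (hm : 1 ≤ m) :
    genusZeroNumber (m + 1) (l + 1) (v + 1) =
      genusZeroNumber m l v + genusZeroTailNumber m (l + 1) (v + 1) := by
  unfold genusZeroNumber genusZeroTailNumber
  by_cases h : v ≤ l ∧ l ≤ m
  · have hm' : (m : ℝ) ≠ 0 := by positivity
    have h1 : ((m + 1).choose (l + 1) : ℝ) = (m + 1) * m.choose l / (l + 1) := by
      rw [eq_div_iff (by positivity)]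
      exact_mod_cast (Nat.add_one_mul_choose_eq m l).symm
    rw [if_pos (by omega), if_pos h, h1]
    by_cases hl : l + 1 ≤ m
    · rw [if_pos (by omega), show m + 1 - (v + 1) - 1 = m - v - 1 by omega,
        show l + 1 - (v + 1) = l - v by omega, show m - (v + 1) = m - v - 1 by omega,
        show l + 1 - 1 = l by omega]
      push_cast
      field_simp
      ring
    · rw [if_neg (by omega), add_zero]
      obtain rfl : l = m := by omega
      rw [show l + 1 - (v + 1) - 1 = l - v - 1 by omega, show l + 1 - (v + 1) = l - v by omega]
      -- At l = m the count vanishes unless v = m, where truncated subtraction yields C(0, 0) = 1,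
      -- as it should.
      rcases Nat.eq_or_lt_of_le h.1 with rfl | hv
      · push_cast
        field_simp
      · rw [Nat.choose_eq_zero_of_lt (show l - v - 1 < l - v by omega)]
        simp
  · rw [if_neg (by omega), if_neg h, if_neg (by omega), add_zero]

/-- Pascal's rule. As the tail vanishes for v > m, downward induction on v identifies it with the
tail count. -/
theorem genusZeroTailNumber_eq_add {m l v : ℕ} (hv : 1 ≤ v) :
    genusZeroTailNumber m l v = genusZeroNumber m l v + genusZeroTailNumber m l (v + 1) := by
  unfold genusZeroNumber genusZeroTailNumber
  by_cases h : v ≤ l ∧ l ≤ m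
  · obtain ⟨l, rfl⟩ : ∃ k, l = k + 1 := ⟨l - 1, by omega⟩
    have hm' : (m : ℝ) ≠ 0 := by
      have : 0 < m := by omega
      positivity
    obtain ⟨e, rfl⟩ : ∃ e, m = l + 1 + e := ⟨m - (l + 1), by omega⟩
    have h1 : ((l + 1 + e).choose (l + 1) : ℝ) = (l + 1 + e).choose l * (e + 1) / (l + 1) := by
      rw [eq_div_iff (by positivity)]
      have := Nat.choose_succ_right_eq (l + 1 + e) l
      rw [show l + 1 + e - l = e + 1 by omega] at this
      exact_mod_cast this
    rw [if_pos h, if_pos h, h1, show l + 1 - 1 = l by omega]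
    by_cases hvl : v = l + 1
    · subst hvl
      rw [if_neg (by omega), add_zero]
      simp only [Nat.sub_self, Nat.choose_zero_right]
      push_cast at hm' ⊢
      field_simp
      ring
    · rw [if_pos (by omega)]
      obtain ⟨b, rfl⟩ : ∃ b, l = v + b := ⟨l - v, by omega⟩
      rw [show v + b + 1 + e - v = b + e + 1 by omega, show v + b + 1 - v = b + 1 by omega,
        show b + e + 1 - 1 = b + e by omega,
        show v + b + 1 + e - (v + 1) = b + e by omega,
        show v + b + 1 - (v + 1) = b by omega, Nat.choose_succ_succ]
      have h2 : ((b + e).choose b : ℝ) * e = (b + e).choose (b + 1) * (b + 1) := by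
        have := Nat.choose_succ_right_eq (b + e) b
        rw [show b + e - b = e by omega] at this
        exact_mod_cast this.symm
      push_cast at hm' ⊢
      field_simp
      linear_combination (-((v + b + 1 + e).choose (v + b) : ℝ)) * h2
  · rw [if_neg h, if_neg h, if_neg (by omega), add_zero]

theorem genusZeroTailNumber_one {m l : ℕ} (hl : 1 ≤ l) (hlm : l ≤ m) :
    genusZeroTailNumber m l 1 = narayana m l := by
  rw [genusZeroTailNumber, if_pos ⟨hl, hlm⟩, narayana]
  obtain ⟨m, rfl⟩ : ∃ k, m = k + 1 := ⟨m - 1, by omega⟩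
  obtain ⟨l, rfl⟩ : ∃ k, l = k + 1 := ⟨l - 1, by omega⟩
  have h1 : ((m + 1).choose (l + 1) : ℝ) = (m + 1) * m.choose l / (l + 1) := by
    rw [eq_div_iff (by positivity)]
    exact_mod_cast (Nat.add_one_mul_choose_eq m l).symm
  rw [h1]
  simp only [Nat.add_sub_cancel]
  push_cast
  field_simp
  ring

theorem genusZeroTailCount_eq {β : Type*} [Fintype β] [DecidableEq β] {c : Perm β} {a : β}
    (h : ∀ l v, (genusZeroCount c a l v : ℝ) = genusZeroNumber (Fintype.card β) l v)
    (l : ℕ) {v : ℕ} (hv : 1 ≤ v) :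
    (genusZeroTailCount c a l v : ℝ) = genusZeroTailNumber (Fintype.card β) l v := by
  obtain ⟨k, hk⟩ : ∃ k, Fintype.card β + 1 ≤ v + k := ⟨Fintype.card β + 1, by omega⟩
  induction k generalizing v with
  | zero =>
    rw [genusZeroTailCount_of_card_lt c a l (by omega), genusZeroTailNumber, if_neg (by omega)]
    simp
  | succ k ih =>
    rw [genusZeroTailCount_eq_add, genusZeroTailNumber_eq_add hv, Nat.cast_add, h,
      ih (v := v + 1) (by omega) (by omega)]

theorem numCycles_pos {β : Type*} [Finite β] [Nonempty β] (σ : Perm β) : 0 < numCycles σ := by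
  have : Nonempty (Quotient (SameCycle.setoid σ)) := ⟨Quotient.mk _ (Classical.arbitrary β)⟩
  exact Nat.card_pos

/-- One model of each size suffices, since all long cycles of that size are conjugate. The models
are iterated `Option` types, on which the recursion applies directly. -/
theorem exists_genusZeroCount_eq (n : ℕ) :
    ∃ (β : Type) (_ : Fintype β) (_ : DecidableEq β) (c : Perm β) (a : β),
      Fintype.card β = n + 1 ∧ numCycles c = 1 ∧
      ∀ l v, (genusZeroCount c a l v : ℝ) = genusZeroNumber (n + 1) l v := by
  classical
  induction n with
  | zero =>
    have hcyc : ∀ σ : Perm Unit, numCycles σ = 1 := fun σ => by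
      have h1 := numCycles_pos σ
      have h2 : numCycles σ ≤ 1 := by
        have := numCycles_le_card (σ := σ) (S := Finset.univ) fun x => ⟨x, by simp⟩
        simpa using this
      omega
    refine ⟨Unit, inferInstance, inferInstance, 1, (), by simp, hcyc _, fun l v => ?_⟩
    have hper : Function.minimalPeriod (1 : Perm Unit) () = 1 := by
      simp
    unfold genusZeroCount genusZeroNumber
    rw [Fintype.sum_eq_single 1 (fun σ h => absurd (Subsingleton.elim σ 1) h)]
    simp only [GenusZero, hcyc, mul_one, hper, Nat.card_eq_fintype_card, Fintype.card_unit, true_and]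
    by_cases h : 1 = l ∧ 1 = v
    · obtain ⟨rfl, rfl⟩ := h
      simp
    · rw [if_neg h]
      split_ifs with h'
      · have : v = 0 := by omega
        simp [this]
      · simp
  | succ n ih =>
    obtain ⟨β, _, _, c, a, hcard, hc, h⟩ := ih
    refine ⟨Option β, inferInstance, inferInstance, optionCongr c * swap none (some a), none,
      by simp [hcard], ?_, ?_⟩
    · rw [numCycles_mul_comm, numCycles_swap_none_mul_optionCongr, hc]
    · intro l v
      rcases l with _ | l
      · have : genusZeroNumber (n + 1 + 1) 0 v = 0 := by
          unfold genusZeroNumber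
          split_ifs with h'
          · have : v = 0 := by omega
            simp [this]
          · rfl
        rw [this, genusZeroCount, Finset.sum_eq_zero]
        · simp
        · exact fun σ _ => if_neg fun h => (numCycles_pos σ).ne' h.2.1
      rcases v with _ | v
      · have : genusZeroNumber (n + 1 + 1) (l + 1) 0 = 0 := by
          unfold genusZeroNumber
          split_ifs <;> simp
        rw [this, genusZeroCount, Finset.sum_eq_zero]
        · simp
        · exact fun σ _ => if_neg fun h => (minimalPeriod_pos_of_finite _ _).ne' h.2.2
      rw [genusZeroNumber_succ (by omega), ← h l v, ← hcard, ← genusZeroTailCount_eq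
        (fun l v => by rw [h, hcard]) _ (by omega), ← Nat.cast_add]
      congr 1
      exact genusZeroCount_option hc l v

theorem genusZero_permCongr {ι β : Type*} (e : ι ≃ β) (c σ : Perm ι) :
    GenusZero (e.permCongr c) (e.permCongr σ) ↔ GenusZero c σ := by
  have hmul : e.permCongr σ * e.permCongr c = e.permCongr (σ * c) := by
    ext x
    simp [Equiv.permCongr_apply]
  rw [GenusZero, GenusZero, hmul, numCycles_permCongr, numCycles_permCongr, Nat.card_congr e]

/-- The number of permutations of genus zero with `l` cycles is a Narayana number. -/
theorem card_genusZero {n l : ℕ} (hl : 1 ≤ l) (hln : l ≤ n + 1) :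
    (Nat.card {σ : Perm (Fin (n + 1)) // GenusZero (finRotate (n + 1)) σ ∧ numCycles σ = l} : ℝ) =
      narayana (n + 1) l := by
  classical
  obtain ⟨β, _, _, c, a, hcard, hc, h⟩ := exists_genusZeroCount_eq n
  obtain ⟨e, he⟩ := exists_permCongr_eq_finRotate hcard hc
  have hT := genusZeroTailCount_eq (c := c) (a := a) (fun l v => by rw [h, hcard]) l le_rfl
  rw [hcard] at hT
  rw [← genusZeroTailNumber_one hl hln, ← hT]
  congr 1
  have h1 : genusZeroTailCount c a l 1 =
      Nat.card {σ : Perm β // GenusZero c σ ∧ numCycles σ = l} := by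
    rw [Nat.card_eq_fintype_card, Fintype.card_subtype, Finset.card_filter, genusZeroTailCount]
    refine Finset.sum_congr rfl fun σ _ => if_congr ?_ rfl rfl
    have := minimalPeriod_pos_of_finite (σ * c) a
    simp only [and_congr_right_iff, and_iff_left_iff_imp]
    exact fun _ _ => this
  rw [h1]
  refine (Nat.card_congr (e.permCongr.subtypeEquiv fun σ => ?_)).symm
  rw [← he, genusZero_permCongr, numCycles_permCongr]

end Narayana

end Equiv.Perm

/-! ### Slicing permutations of positive genus by three-cycles -/

namespace Equiv.Perm

section Slicing

variable {n : ℕ}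

/-- The three-cycle `e ↦ i ↦ μ ↦ e`, for `t = (e, μ, i)`. -/
def threeCycle (t : Fin n × Fin n × Fin n) : Perm (Fin n) := swap t.1 t.2.1 * swap t.2.2 t.1

/-- The first transposition splits off i as a fixed point. The points μ and σ i remain on one cycle,
which the second transposition splits again. -/
theorem numCycles_threeCycle_mul {σ : Perm (Fin n)} {μ i : Fin n} (h : σ.SameCycle μ i)
    (hμi : μ ≠ i) (hi : σ i ≠ i) (hμe : μ ≠ σ i) :
    numCycles (threeCycle (σ i, μ, i) * σ) = numCycles σ + 2 := by
  set e := σ i with he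
  have hie : σ.SameCycle i e := ⟨1, by simp [he]⟩
  have h1 := numCycles_swap_mul_of_sameCycle hi.symm hie
  have hnot : ¬ (swap i e * σ).SameCycle i e := by
    rw [sameCycle_swap_mul_iff hi.symm]
    simpa using hie
  have hfix : (swap i e * σ) i = i := by simp [← he]
  have h2 := sameCycle_swap_mul_iff_of_not_sameCycle hnot μ e
  rw [swap_mul_self_mul] at h2
  have h3 : (swap i e * σ).SameCycle μ e := by
    rcases h2.mp (h.trans hie) with h4 | ⟨h4 | h4, -⟩
    · exact h4
    · exact absurd h4.symm (not_sameCycle_of_isFixed hfix hμi.symm)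
    · exact h4
  rw [threeCycle, mul_assoc, numCycles_swap_mul_of_sameCycle hμe.symm h3.symm, h1]

theorem numCycles_finRotate : numCycles (finRotate (n + 1)) = 1 := by
  obtain ⟨β, _, _, c, a, hcard, hc, -⟩ := exists_genusZeroCount_eq n
  obtain ⟨e, he⟩ := exists_permCongr_eq_finRotate hcard hc
  rw [← he, numCycles_permCongr, hc]

theorem coe_finRotate_of_lt {x y : Fin (n + 1)} (h : x < y) :
    ((finRotate (n + 1) x : Fin (n + 1)) : ℕ) = x + 1 :=
  coe_finRotate_of_ne_last (ne_of_lt (h.trans_le (Fin.le_last y)))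

theorem coe_finRotate_le (x : Fin (n + 1)) :
    ((finRotate (n + 1) x : Fin (n + 1)) : ℕ) = x + 1 ∨
      ((finRotate (n + 1) x : Fin (n + 1)) : ℕ) = 0 := by
  by_cases h : x = Fin.last n
  · right
    simp [h]
  · exact Or.inl (coe_finRotate_of_ne_last h)

/-- Multiplying the rotation by `swap i e` cuts off the interval (i, e]. It contains e but not μ, so
`swap e μ` merges the two cycles again. -/
theorem numCycles_finRotate_mul_threeCycle_inv {μ i e : Fin (n + 1)} (h1 : μ < i) (h2 : i < e) :
    numCycles (finRotate (n + 1) * (threeCycle (e, μ, i))⁻¹) = 1 := by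
  have hinv : (threeCycle (e, μ, i))⁻¹ = swap i e * swap e μ := by
    simp [threeCycle, mul_inv_rev]
  rw [hinv, ← mul_assoc]
  have h3 := numCycles_mul_swap_of_sameCycle h2.ne
    (sameCycle_of_numCycles_eq_one (numCycles_finRotate (n := n)) i e)
  have h4 : ¬ (finRotate (n + 1) * swap i e).SameCycle e μ := by
    intro h
    let s : Setoid (Fin (n + 1)) :=
      { r := fun a b => (i < a ∧ a ≤ e) ↔ (i < b ∧ b ≤ e)
        iseqv := ⟨fun _ => Iff.rfl, Iff.symm, Iff.trans⟩ }
    have := SameCycle.of_forall_apply s (fun x => ?_) h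
    · have h5 : i < μ ∧ μ ≤ e := this.mp ⟨h2, le_rfl⟩
      exact absurd h5.1 h1.le.not_gt
    · change (i < x ∧ x ≤ e) ↔ _
      rw [Perm.mul_apply]
      by_cases hxi : x = i
      · rw [hxi, swap_apply_left]
        have := coe_finRotate_le e
        simp only [Fin.lt_def, Fin.le_def] at *
        omega
      by_cases hxe : x = e
      · rw [hxe, swap_apply_right]
        have := coe_finRotate_of_lt h2
        simp only [Fin.lt_def, Fin.le_def] at *
        omega
      rw [swap_apply_of_ne_of_ne hxi hxe]
      have h6 := coe_finRotate_le x
      have h7 := fun h : x < e => coe_finRotate_of_lt h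
      simp only [Fin.lt_def, Fin.le_def, Fin.ext_iff] at *
      omega
  have := numCycles_mul_swap_add_one h4
  rw [numCycles_finRotate] at h3
  omega

/-- Two exceedances lie on one cycle. With i the larger and μ the smaller, μ < i < σ i, which is the
configuration required by both three-cycle lemmas. -/
theorem exists_threeCycle_of_lt_exceedances {σ : Perm (Fin (n + 1))}
    (h : numCycles σ < (exceedances σ).card) :
    ∃ t, numCycles (threeCycle t * σ) = numCycles σ + 2 ∧
      numCycles (finRotate (n + 1) * (threeCycle t)⁻¹) = 1 := by
  have key : ∀ μ i, μ < i → i ≤ σ i → σ.SameCycle μ i →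
      ∃ t, numCycles (threeCycle t * σ) = numCycles σ + 2 ∧
      numCycles (finRotate (n + 1) * (threeCycle t)⁻¹) = 1 := by
    intro μ i h1 h2 h3
    have hi : σ i ≠ i := fun h => not_sameCycle_of_isFixed h h1.ne' h3.symm
    have hie : i < σ i := lt_of_le_of_ne h2 hi.symm
    exact ⟨_, numCycles_threeCycle_mul h3 h1.ne hi (h1.trans hie).ne,
      numCycles_finRotate_mul_threeCycle_inv h1 hie⟩
  obtain ⟨x, hx, y, hy, hxy, hs⟩ := exists_sameCycle_of_numCycles_lt h
  rw [mem_exceedances] at hx hy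
  rcases lt_or_gt_of_ne hxy with hlt | hlt
  · exact key x y hlt hy hs
  · exact key y x hlt hx hs.symm

theorem permCongr_revPerm_finRotate :
    (Fin.revPerm (n := n + 1)).permCongr (finRotate (n + 1)) = (finRotate (n + 1))⁻¹ := by
  rw [eq_inv_iff_mul_eq_one]
  ext x
  simp only [Perm.mul_apply, Equiv.permCongr_apply, Fin.revPerm_symm, Fin.revPerm_apply, one_apply]
  by_cases hx : x = Fin.last n
  · simp [hx]
  · have h1 := coe_finRotate_of_ne_last hx
    have h2 : (finRotate (n + 1) x).rev ≠ Fin.last n := by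
      rw [Ne, Fin.ext_iff, Fin.val_rev, Fin.val_last]
      omega
    have h3 := coe_finRotate_of_ne_last h2
    rw [Fin.val_rev, h3, Fin.val_rev, h1]
    omega

/-- Mirror image of the previous case: order reversal exchanges exceedances with antiexceedances and
conjugates the rotation to its inverse. -/
theorem exists_threeCycle_of_lt_antiExceedances {ρ : Perm (Fin (n + 1))}
    (h : numCycles ρ < (antiExceedances ρ).card) :
    ∃ t, numCycles (threeCycle t * ρ) = numCycles ρ + 2 ∧
      numCycles (threeCycle t * finRotate (n + 1)) = 1 := by
  let r : Perm (Fin (n + 1)) := Fin.revPerm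
  have hmul : ∀ a b : Perm (Fin (n + 1)), r.permCongr (a * b) = r.permCongr a * r.permCongr b := by
    intro a b
    ext x
    simp
  have hrr : ∀ a : Perm (Fin (n + 1)), r.permCongr (r.permCongr a) = a := by
    intro a
    ext x
    simp [r]
  have hinv : ∀ a : Perm (Fin (n + 1)), r.permCongr a⁻¹ = (r.permCongr a)⁻¹ := by
    intro a
    rw [eq_inv_iff_mul_eq_one, ← hmul, inv_mul_cancel]
    ext x
    simp
  have hcard : (exceedances (r.permCongr ρ)).card = (antiExceedances ρ).card := by
    refine Finset.card_equiv r fun i => ?_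
    rw [mem_exceedances, mem_antiExceedances]
    simp only [Equiv.permCongr_apply, r, Fin.revPerm_symm, Fin.revPerm_apply]
    rw [Fin.le_rev_iff]
  obtain ⟨t, h1, h2⟩ := exists_threeCycle_of_lt_exceedances (σ := r.permCongr ρ)
    (by rwa [numCycles_permCongr, hcard])
  have ht : r.permCongr (threeCycle t) = threeCycle (r t.1, r t.2.1, r t.2.2) := by
    have hswap : ∀ a b, r.permCongr (swap a b) = swap (r a) (r b) := fun a b =>
      symm_trans_swap_trans a b r
    rw [threeCycle, hmul, hswap, hswap]
    rfl
  refine ⟨(r t.1, r t.2.1, r t.2.2), ?_, ?_⟩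
  · rw [← ht, ← numCycles_permCongr r, hmul, hrr, h1, numCycles_permCongr]
  · rw [← numCycles_permCongr r, hmul, hinv, permCongr_revPerm_finRotate, ← mul_inv_rev,
      numCycles_inv, ht] at h2
    exact h2

/-- The number of permutations `σ` with `l` cycles for which `i ↦ σ i + 1` has `w` cycles. -/
noncomputable def cycleCount (n l w : ℕ) : ℕ :=
  Nat.card {σ : Perm (Fin n) // numCycles σ = l ∧ numCycles (finRotate n * σ) = w}

theorem cycleCount_eq_zero {l w : ℕ} (h : n + 2 < l + w) : cycleCount (n + 1) l w = 0 := by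
  have : IsEmpty {σ : Perm (Fin (n + 1)) //
      numCycles σ = l ∧ numCycles (finRotate (n + 1) * σ) = w} := by
    refine ⟨fun ⟨σ, h1, h2⟩ => ?_⟩
    have := numCycles_add_le_of_long (numCycles_finRotate (n := n)) σ
    rw [numCycles_mul_comm, Fintype.card_fin] at this
    omega
  exact Nat.card_of_isEmpty

theorem exists_conj_eq_finRotate {c : Perm (Fin (n + 1))} (hc : numCycles c = 1) :
    ∃ u : Perm (Fin (n + 1)), u * c * u⁻¹ = finRotate (n + 1) :=
  exists_permCongr_eq_finRotate (Fintype.card_fin _) hc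

/-- Below genus zero equality, σ has a surplus exceedance or cσ a surplus antiexceedance. In the
first case (c t⁻¹)(tσ) = cσ, in the second (tc)σ = t(cσ). The factor c t⁻¹ or tc is again long, so
conjugation restores c. For fixed t the assignment is injective, and there are (n+1)³ triples t. -/
theorem cycleCount_le_of_slice {l w : ℕ} (h : l + w < n + 2) :
    cycleCount (n + 1) l w ≤
      (n + 1) ^ 3 * (cycleCount (n + 1) (l + 2) w + cycleCount (n + 1) l (w + 2)) := by
  classical
  set c := finRotate (n + 1) with hc
  let A : Finset (Perm (Fin (n + 1))) :=
    Finset.univ.filter fun σ => numCycles σ = l ∧ numCycles (c * σ) = w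
  let B : Fin (n + 1) × Fin (n + 1) × Fin (n + 1) → Finset (Perm (Fin (n + 1))) := fun t =>
    A.filter fun σ => numCycles (threeCycle t * σ) = l + 2 ∧ numCycles (c * (threeCycle t)⁻¹) = 1
  let C : Fin (n + 1) × Fin (n + 1) × Fin (n + 1) → Finset (Perm (Fin (n + 1))) := fun t =>
    A.filter fun σ => numCycles (threeCycle t * (c * σ)) = w + 2 ∧ numCycles (threeCycle t * c) = 1
  have hcount : ∀ l w, cycleCount (n + 1) l w = (Finset.univ.filter fun σ : Perm (Fin (n + 1)) =>
      numCycles σ = l ∧ numCycles (c * σ) = w).card := fun l w => by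
    rw [cycleCount, Nat.card_eq_fintype_card, Fintype.card_subtype]
  have hsub : A ⊆ Finset.univ.biUnion fun t => B t ∪ C t := by
    intro σ hσ
    obtain ⟨-, h1, h2⟩ := Finset.mem_filter.mp hσ
    have h3 := card_exceedances_add σ
    rw [← hc] at h3
    rw [Finset.mem_biUnion]
    by_cases h4 : numCycles σ < (exceedances σ).card
    · obtain ⟨t, h5, h6⟩ := exists_threeCycle_of_lt_exceedances h4
      exact ⟨t, Finset.mem_univ _, Finset.mem_union_left _
        (Finset.mem_filter.mpr ⟨hσ, by rw [h5, h1], h6⟩)⟩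
    · obtain ⟨t, h5, h6⟩ := exists_threeCycle_of_lt_antiExceedances (ρ := c * σ) (by omega)
      exact ⟨t, Finset.mem_univ _, Finset.mem_union_right _
        (Finset.mem_filter.mpr ⟨hσ, by rw [h5, h2], h6⟩)⟩
  have hB : ∀ t, (B t).card ≤ cycleCount (n + 1) (l + 2) w := by
    intro t
    by_cases ht : numCycles (c * (threeCycle t)⁻¹) = 1
    · obtain ⟨u, hu⟩ := exists_conj_eq_finRotate ht
      rw [hcount]
      refine Finset.card_le_card_of_injOn (fun σ => u * (threeCycle t * σ) * u⁻¹) ?_ ?_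
      · intro σ hσ
        obtain ⟨hσ, h1, -⟩ := Finset.mem_filter.mp hσ
        obtain ⟨-, -, h2⟩ := Finset.mem_filter.mp hσ
        refine Finset.mem_coe.mpr (Finset.mem_filter.mpr ⟨Finset.mem_univ _, ?_, ?_⟩)
        · rw [numCycles_conj, h1]
        · have : c * (u * (threeCycle t * σ) * u⁻¹) = u * (c * σ) * u⁻¹ := by
            conv_lhs => rw [hc, ← hu]
            group
          rw [this, numCycles_conj, h2]
      · intro σ _ σ' _ h
        simpa using h
    · rw [Finset.card_eq_zero.mpr]
      · exact Nat.zero_le _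
      · exact Finset.filter_eq_empty_iff.mpr fun σ _ h => ht h.2
  have hC : ∀ t, (C t).card ≤ cycleCount (n + 1) l (w + 2) := by
    intro t
    by_cases ht : numCycles (threeCycle t * c) = 1
    · obtain ⟨u, hu⟩ := exists_conj_eq_finRotate ht
      rw [hcount]
      refine Finset.card_le_card_of_injOn (fun σ => u * σ * u⁻¹) ?_ ?_
      · intro σ hσ
        obtain ⟨hσ, h1, -⟩ := Finset.mem_filter.mp hσ
        obtain ⟨-, h2, -⟩ := Finset.mem_filter.mp hσ
        refine Finset.mem_coe.mpr (Finset.mem_filter.mpr ⟨Finset.mem_univ _, ?_, ?_⟩)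
        · rw [numCycles_conj, h2]
        · have : c * (u * σ * u⁻¹) = u * (threeCycle t * (c * σ)) * u⁻¹ := by
            rw [← mul_assoc (threeCycle t)]
            conv_lhs => rw [hc, ← hu]
            group
          rw [this, numCycles_conj, h1]
      · intro σ _ σ' _ h
        simpa using h
    · rw [Finset.card_eq_zero.mpr]
      · exact Nat.zero_le _
      · exact Finset.filter_eq_empty_iff.mpr fun σ _ h => ht h.2
  calc cycleCount (n + 1) l w = A.card := hcount l w
    _ ≤ ∑ t, (B t ∪ C t).card := (Finset.card_le_card hsub).trans Finset.card_biUnion_le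
    _ ≤ ∑ _t : Fin (n + 1) × Fin (n + 1) × Fin (n + 1),
        (cycleCount (n + 1) (l + 2) w + cycleCount (n + 1) l (w + 2)) :=
      Finset.sum_le_sum fun t _ => (Finset.card_union_le _ _).trans (add_le_add (hB t) (hC t))
    _ = _ := by
      rw [Finset.sum_const, Finset.card_univ, Fintype.card_prod, Fintype.card_prod,
        Fintype.card_fin, smul_eq_mul]
      ring

theorem cycleCount_eq_narayana {l w : ℕ} (hl : 1 ≤ l) (hw : 1 ≤ w) (h : l + w = n + 2) :
    (cycleCount (n + 1) l w : ℝ) = narayana (n + 1) l := by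
  rw [← card_genusZero hl (by omega), cycleCount]
  congr 1
  refine Nat.card_congr (Equiv.subtypeEquivRight fun σ => ?_)
  rw [GenusZero, numCycles_mul_comm σ, Nat.card_eq_fintype_card, Fintype.card_fin]
  omega

end Slicing

/-! ### Domination of the genus expansion by its genus zero part -/

section Estimate

theorem _root_.narayana_nonneg (m l : ℕ) : 0 ≤ narayana m l := by
  unfold narayana
  positivity

theorem _root_.narayana_le_mul {m l : ℕ} (hl : 1 ≤ l) (hlm : l + 2 ≤ m) :
    narayana m l ≤ (m : ℝ) ^ 4 * narayana m (l + 2) := by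
  have key : ∀ j, j + 1 ≤ m → (m.choose j : ℝ) ≤ m * m.choose (j + 1) := by
    intro j hj
    have h1 := Nat.choose_succ_right_eq m j
    have h2 : m.choose j ≤ m * m.choose (j + 1) := by
      calc m.choose j ≤ m.choose j * (m - j) := Nat.le_mul_of_pos_right _ (by omega)
        _ = m.choose (j + 1) * (j + 1) := h1.symm
        _ ≤ m.choose (j + 1) * m := Nat.mul_le_mul_left _ hj
        _ = _ := mul_comm _ _
    exact_mod_cast h2
  have key2 : ∀ j, j + 2 ≤ m → (m.choose j : ℝ) ≤ (m : ℝ) ^ 2 * m.choose (j + 2) := by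
    intro j hj
    calc (m.choose j : ℝ) ≤ m * m.choose (j + 1) := key j (by omega)
      _ ≤ m * (m * m.choose (j + 2)) := by gcongr; exact key (j + 1) hj
      _ = _ := by ring
  unfold narayana
  obtain ⟨l, rfl⟩ : ∃ k, l = k + 1 := ⟨l - 1, by omega⟩
  have h1 := key2 l (by omega)
  have h2 := key2 (l + 1) (by omega)
  rw [show l + 1 - 1 = l by omega, show l + 1 + 2 - 1 = l + 2 by omega]
  calc 1 / (m : ℝ) * m.choose l * m.choose (l + 1)
      ≤ 1 / (m : ℝ) * ((m : ℝ) ^ 2 * m.choose (l + 2)) *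
          ((m : ℝ) ^ 2 * m.choose (l + 1 + 2)) := by gcongr
    _ = _ := by ring

/-- Induction on the defect j in steps of two. Slicing costs M³, and raising the Narayana index by
two costs at most M⁴; M³(1 + M⁴) ≤ 4M⁸ = (2M⁴)². For j = 1 both sliced counts exceed the genus bound
and vanish. -/
theorem cycleCount_le {n : ℕ} (j : ℕ) : ∀ {l w : ℕ}, 1 ≤ l → 1 ≤ w → l + w + j = n + 2 →
    (cycleCount (n + 1) l w : ℝ) ≤
      (2 * ((n + 1 : ℕ) : ℝ) ^ 4) ^ j * narayana (n + 1) (l + j) := by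
  induction j using Nat.strong_induction_on with
  | _ j ih =>
    intro l w hl hw h
    rcases j with _ | _ | j
    · rw [cycleCount_eq_narayana hl hw (by omega)]
      simp
    · have h1 := cycleCount_le_of_slice (n := n) (l := l) (w := w) (by omega)
      rw [cycleCount_eq_zero (show n + 2 < l + 2 + w by omega),
        cycleCount_eq_zero (show n + 2 < l + (w + 2) by omega)] at h1
      have : cycleCount (n + 1) l w = 0 := by simpa using h1
      rw [this, Nat.cast_zero]
      exact mul_nonneg (by positivity) (narayana_nonneg _ _)
    · have h1 := cycleCount_le_of_slice (n := n) (l := l) (w := w) (by omega)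
      have h2 := ih j (by omega) (l := l + 2) (w := w) (by omega) hw (by omega)
      have h3 := ih j (by omega) (l := l) (w := w + 2) hl (by omega) (by omega)
      set M : ℝ := ((n + 1 : ℕ) : ℝ) with hM
      have hM1 : (1 : ℝ) ≤ M := by
        rw [hM]
        exact_mod_cast Nat.succ_le_succ (Nat.zero_le n)
      have h4 : narayana (n + 1) (l + j) ≤ M ^ 4 * narayana (n + 1) (l + (j + 1 + 1)) :=
        narayana_le_mul (by omega) (by omega)
      rw [show l + 2 + j = l + (j + 1 + 1) by omega] at h2
      set N := narayana (n + 1) (l + (j + 1 + 1)) with hN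
      have hN0 : 0 ≤ N := narayana_nonneg _ _
      have h5 : (cycleCount (n + 1) l w : ℝ) ≤
          M ^ 3 * (cycleCount (n + 1) (l + 2) w + cycleCount (n + 1) l (w + 2)) := by
        rw [hM]
        exact_mod_cast h1
      have h6 : M ^ 3 * (1 + M ^ 4) ≤ 4 * M ^ 8 := by
        have h7 : M ^ 3 ≤ M ^ 8 := pow_le_pow_right₀ hM1 (by norm_num)
        have h8 : M ^ 7 ≤ M ^ 8 := pow_le_pow_right₀ hM1 (by norm_num)
        have h9 : 0 ≤ M ^ 8 := by positivity
        nlinarith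
      calc (cycleCount (n + 1) l w : ℝ)
          ≤ M ^ 3 * ((2 * M ^ 4) ^ j * N + (2 * M ^ 4) ^ j * (M ^ 4 * N)) := by
            refine h5.trans ?_
            gcongr
            exact h3.trans (by gcongr)
        _ = (2 * M ^ 4) ^ j * (M ^ 3 * (1 + M ^ 4)) * N := by ring
        _ ≤ (2 * M ^ 4) ^ j * (4 * M ^ 8) * N := by gcongr
        _ = _ := by ring

/-- For j < M one has j! ≤ M^j, hence q^j ≤ (Mq)^j / j!. -/
theorem sum_range_pow_le_exp {M : ℕ} {q : ℝ} (hq : 0 ≤ q) :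
    ∑ j ∈ Finset.range M, q ^ j ≤ Real.exp (M * q) := by
  refine le_trans (Finset.sum_le_sum fun j hj => ?_)
    (Real.sum_le_exp_of_nonneg (mul_nonneg M.cast_nonneg hq) M)
  rw [le_div_iff₀ (by positivity), mul_pow, mul_comm]
  gcongr
  have h1 : j.factorial ≤ M ^ j :=
    (Nat.factorial_le_pow j).trans (Nat.pow_le_pow_left (Finset.mem_range.mp hj).le j)
  exact_mod_cast h1

/-- The genus expansion of the moments of a complex Wishart matrix is dominated by its genus zero
part. -/
theorem sum_pow_numCycles_le {n : ℕ} {x d : ℝ} (hx : 0 < x) (hd : 0 < d) :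
    ∑ σ : Perm (Fin (n + 1)), x ^ numCycles σ *
        d ^ (numCycles σ + numCycles (finRotate (n + 1) * σ)) ≤
      d ^ (n + 2) * (Real.exp (2 * ((n + 1 : ℕ) : ℝ) ^ 5 / (x * d)) * narayanaPoly (n + 1) x) := by
  classical
  set M : ℝ := ((n + 1 : ℕ) : ℝ) with hM
  have hrange : ∀ σ : Perm (Fin (n + 1)), numCycles σ ∈ Finset.Icc 1 (n + 1) := by
    intro σ
    have h1 := numCycles_pos σ
    have h2 := numCycles_le_card (σ := σ) (S := Finset.univ) fun x => ⟨x, by simp⟩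
    rw [Finset.card_univ, Fintype.card_fin] at h2
    exact Finset.mem_Icc.mpr ⟨h1, h2⟩
  have hsum : ∑ σ : Perm (Fin (n + 1)), x ^ numCycles σ *
        d ^ (numCycles σ + numCycles (finRotate (n + 1) * σ)) =
      ∑ w ∈ Finset.Icc 1 (n + 1), ∑ l ∈ Finset.Icc 1 (n + 1),
        (cycleCount (n + 1) l w : ℝ) * (x ^ l * d ^ (l + w)) := by
    rw [← Finset.sum_fiberwise_of_maps_to (s := Finset.univ) (t := Finset.Icc 1 (n + 1))
      (g := fun σ : Perm (Fin (n + 1)) => numCycles (finRotate (n + 1) * σ)) (fun σ _ => hrange _)]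
    refine Finset.sum_congr rfl fun w _ => ?_
    rw [← Finset.sum_fiberwise_of_maps_to (t := Finset.Icc 1 (n + 1))
      (g := fun σ : Perm (Fin (n + 1)) => numCycles σ) (fun σ _ => hrange _)]
    refine Finset.sum_congr rfl fun l _ => ?_
    rw [Finset.sum_congr rfl (g := fun _ => x ^ l * d ^ (l + w))]
    · rw [Finset.sum_const, nsmul_eq_mul, cycleCount, Nat.card_eq_fintype_card,
        Fintype.card_subtype, Finset.filter_filter]
      congr 3
      ext σ
      simp [and_comm]
    · intro σ hσ
      obtain ⟨h1, h2⟩ := Finset.mem_filter.mp hσ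
      rw [h2, (Finset.mem_filter.mp h1).2]
  -- For fixed w, a unit of defect costs a factor 2M⁴ and lowers both the power of x and that of d
  -- by one.
  set q : ℝ := 2 * M ^ 4 / (x * d) with hq
  have hq0 : 0 ≤ q := by positivity
  have hexp : ∑ j ∈ Finset.range (n + 1), q ^ j ≤ Real.exp (2 * M ^ 5 / (x * d)) := by
    refine (sum_range_pow_le_exp hq0).trans_eq ?_
    rw [← hM, hq]
    congr 1
    ring
  have hinner : ∀ w ∈ Finset.Icc 1 (n + 1), ∑ l ∈ Finset.Icc 1 (n + 1),
        (cycleCount (n + 1) l w : ℝ) * (x ^ l * d ^ (l + w)) ≤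
      d ^ (n + 2) * (Real.exp (2 * M ^ 5 / (x * d)) *
        (narayana (n + 1) (n + 2 - w) * x ^ (n + 2 - w))) := by
    intro w hw
    rw [Finset.mem_Icc] at hw
    set N := narayana (n + 1) (n + 2 - w) with hN
    have hN0 : 0 ≤ N := narayana_nonneg _ _
    have hterm : ∀ l ∈ Finset.Icc 1 (n + 2 - w),
        (cycleCount (n + 1) l w : ℝ) * (x ^ l * d ^ (l + w)) ≤
          d ^ (n + 2) * (N * x ^ (n + 2 - w)) * q ^ (n + 2 - w - l) := by
      intro l hl
      rw [Finset.mem_Icc] at hl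
      obtain ⟨j, hj⟩ : ∃ j, l + w + j = n + 2 := ⟨n + 2 - w - l, by omega⟩
      have h1 := cycleCount_le j hl.1 hw.1 hj
      rw [show l + j = n + 2 - w by omega, ← hM] at h1
      rw [show n + 2 - w - l = j by omega]
      calc (cycleCount (n + 1) l w : ℝ) * (x ^ l * d ^ (l + w))
          ≤ (2 * M ^ 4) ^ j * N * (x ^ l * d ^ (l + w)) := by gcongr
        _ = d ^ (n + 2) * (N * x ^ (n + 2 - w)) * q ^ j := by
          rw [← hj, show l + w + j - w = l + j by omega, hq, div_pow, mul_pow x d, pow_add,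
            pow_add x]
          field_simp
          ring
    calc ∑ l ∈ Finset.Icc 1 (n + 1), (cycleCount (n + 1) l w : ℝ) * (x ^ l * d ^ (l + w))
        = ∑ l ∈ Finset.Icc 1 (n + 2 - w),
            (cycleCount (n + 1) l w : ℝ) * (x ^ l * d ^ (l + w)) := by
          symm
          refine Finset.sum_subset (Finset.Icc_subset_Icc_right (by omega)) fun l hl hl' => ?_
          rw [Finset.mem_Icc] at hl hl'
          rw [cycleCount_eq_zero (by omega), Nat.cast_zero, zero_mul]
      _ ≤ ∑ l ∈ Finset.Icc 1 (n + 2 - w),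
            d ^ (n + 2) * (N * x ^ (n + 2 - w)) * q ^ (n + 2 - w - l) :=
          Finset.sum_le_sum hterm
      _ = d ^ (n + 2) * (N * x ^ (n + 2 - w)) *
            ∑ l ∈ Finset.Icc 1 (n + 2 - w), q ^ (n + 2 - w - l) := by rw [Finset.mul_sum]
      _ = d ^ (n + 2) * (N * x ^ (n + 2 - w)) *
            ∑ j ∈ Finset.range (n + 2 - w), q ^ j := by
          congr 1
          refine Finset.sum_bij' (fun l _ => n + 2 - w - l) (fun j _ => n + 2 - w - j)
            ?_ ?_ ?_ ?_ ?_
          all_goals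
            intro a ha
            simp only [Finset.mem_Icc, Finset.mem_range] at ha ⊢
            try omega
      _ ≤ d ^ (n + 2) * (N * x ^ (n + 2 - w)) * Real.exp (2 * M ^ 5 / (x * d)) := by
          refine mul_le_mul_of_nonneg_left ?_ (by positivity)
          refine le_trans (Finset.sum_le_sum_of_subset_of_nonneg ?_ fun _ _ _ => by positivity) hexp
          exact Finset.range_subset_range.mpr (by omega)
      _ = _ := by ring
  rw [hsum]
  refine (Finset.sum_le_sum hinner).trans_eq ?_
  rw [← Finset.mul_sum, ← Finset.mul_sum, narayanaPoly]
  congr 2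
  refine Finset.sum_bij' (fun w _ => n + 2 - w) (fun l _ => n + 2 - l) ?_ ?_ ?_ ?_ ?_
  all_goals
    intro a ha
    simp only [Finset.mem_Icc] at ha ⊢
    try omega

end Estimate

end Equiv.Perm

/-! ### Moments of a uniform unit vector via Gaussian integrals -/

section SphereMoments

open Set

/-- Polar coordinates: by homogeneity the Gaussian integral splits into the sphere integral and a
radial Gamma integral. -/
theorem integral_mul_exp_neg_norm_sq {E : Type*} [NormedAddCommGroup E] [NormedSpace ℝ E]
    [MeasurableSpace E] [BorelSpace E] [FiniteDimensional ℝ E] [Nontrivial E] (μ : Measure E)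
    [μ.IsAddHaarMeasure] (P : E → ℂ) (t : ℕ)
    (hP : ∀ (r : ℝ) (u : E), 0 < r → P (r • u) = (r : ℂ) ^ t * P u) :
    ∫ x, P x * (Real.exp (-‖x‖ ^ 2) : ℝ) ∂μ =
      (∫ u : Metric.sphere (0 : E) 1, P u ∂μ.toSphere) *
        ((1 / 2 * Real.Gamma ((t + Module.finrank ℝ E : ℕ) / 2) : ℝ) : ℂ) := by
  have hdim : 0 < Module.finrank ℝ E := Module.finrank_pos
  let g : ℝ → ℂ := fun r => ((r ^ t * Real.exp (-r ^ 2) : ℝ) : ℂ)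
  calc ∫ x, P x * (Real.exp (-‖x‖ ^ 2) : ℝ) ∂μ
      = ∫ x : ({(0)}ᶜ : Set E), P x.1 * (Real.exp (-‖x.1‖ ^ 2) : ℝ) ∂(μ.comap (↑)) := by
        rw [integral_subtype_comap (measurableSet_singleton _).compl
          fun x => P x * (Real.exp (-‖x‖ ^ 2) : ℝ), restrict_compl_singleton]
    _ = ∫ x, P x.1 * g x.2 ∂μ.toSphere.prod (.volumeIoiPow (Module.finrank ℝ E - 1)) := by
        rw [← μ.measurePreserving_homeomorphUnitSphereProd.integral_comp
          (Homeomorph.measurableEmbedding _)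
          (fun x : Metric.sphere (0 : E) 1 × Ioi (0 : ℝ) => P x.1 * g x.2)]
        refine integral_congr_ae (Eventually.of_forall fun x => ?_)
        have hx : 0 < ‖x.1‖ := norm_pos_iff.mpr x.2
        have h1 : x.1 = ‖x.1‖ • ((‖x.1‖)⁻¹ • x.1) := by
          rw [smul_smul, mul_inv_cancel₀ hx.ne', one_smul]
        simp only [homeomorphUnitSphereProd_apply_snd_coe, homeomorphUnitSphereProd_apply_fst_coe, g]
        conv_lhs => rw [h1, hP _ _ hx, ← h1]
        push_cast
        ring
    _ = (∫ u : Metric.sphere (0 : E) 1, P u ∂μ.toSphere) *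
          ∫ r : Ioi (0 : ℝ), g r ∂.volumeIoiPow (Module.finrank ℝ E - 1) :=
        integral_prod_mul (fun u : Metric.sphere (0 : E) 1 => P u) (fun r : Ioi (0 : ℝ) => g r)
    _ = _ := by
        congr 1
        simp only [Measure.volumeIoiPow, ENNReal.ofReal]
        rw [integral_withDensity_eq_integral_smul,
          integral_subtype_comap measurableSet_Ioi fun a : ℝ =>
            Real.toNNReal (a ^ (Module.finrank ℝ E - 1)) • g a]
        · have h2 := integral_rpow_mul_exp_neg_rpow (p := 2)
            (q := ((t + (Module.finrank ℝ E - 1) : ℕ) : ℝ)) (by norm_num)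
            (by have : (0 : ℝ) ≤ ((t + (Module.finrank ℝ E - 1) : ℕ) : ℝ) := Nat.cast_nonneg _
                linarith)
          have h3 : (((t + (Module.finrank ℝ E - 1) : ℕ) : ℝ) + 1) / 2 =
              (t + Module.finrank ℝ E : ℕ) / 2 := by
            rw [show t + Module.finrank ℝ E = t + (Module.finrank ℝ E - 1) + 1 by omega]
            push_cast
            ring
          rw [h3] at h2
          rw [← h2, ← integral_complex_ofReal]
          refine setIntegral_congr_fun measurableSet_Ioi fun x hx => ?_
          simp only [NNReal.smul_def, g]
          rw [Real.coe_toNNReal _ (pow_nonneg hx.out.le _), Real.rpow_natCast,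
            ← Real.rpow_natCast x 2, Complex.real_smul, ← Complex.ofReal_mul]
          congr 1
          rw [pow_add]
          push_cast
          ring
        · exact (measurable_subtype_coe.pow_const _).real_toNNReal

theorem integral_pow_mul_conj_pow_mul_exp (a b : ℕ) :
    ∫ z : ℂ, z ^ a * (starRingEnd ℂ z) ^ b * (Real.exp (-‖z‖ ^ 2) : ℝ) =
      if a = b then (Real.pi * a.factorial : ℂ) else 0 := by
  split_ifs with hab
  · subst hab
    have h1 := Complex.integral_rpow_mul_exp_neg_rpow (p := 2) (q := ((2 * a : ℕ) : ℝ))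
      (by norm_num) (by have : (0 : ℝ) ≤ ((2 * a : ℕ) : ℝ) := Nat.cast_nonneg _
                        linarith)
    have h2 : (((2 * a : ℕ) : ℝ) + 2) / 2 = a + 1 := by push_cast; ring
    rw [h2, Real.Gamma_nat_eq_factorial] at h1
    have h3 : (Real.pi * a.factorial : ℂ) =
        ((2 * Real.pi / 2 * (a.factorial : ℝ) : ℝ) : ℂ) := by
      push_cast
      ring
    rw [h3, ← h1, ← integral_complex_ofReal]
    refine integral_congr_ae (Eventually.of_forall fun z => ?_)
    simp only
    rw [← mul_pow, Complex.mul_conj, Complex.normSq_eq_norm_sq, Real.rpow_natCast,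
      ← Real.rpow_natCast ‖z‖ 2, pow_mul]
    push_cast
    simp
  · -- rotate by an angle for which the integrand changes sign
    have hne : ((a : ℝ) - b) ≠ 0 := sub_ne_zero.mpr (by exact_mod_cast hab)
    let w : Circle := Circle.exp (Real.pi / (a - b))
    have hw : (w : ℂ) ^ a * (starRingEnd ℂ (w : ℂ)) ^ b = -1 := by
      have h1 : (w : ℂ) = Complex.exp ((Real.pi / (a - b) : ℝ) * Complex.I) := Circle.coe_exp _
      rw [h1, ← Complex.exp_conj, ← Complex.exp_nat_mul, ← Complex.exp_nat_mul, ← Complex.exp_add,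
        ← Complex.exp_pi_mul_I]
      congr 1
      simp only [map_mul, Complex.conj_ofReal, Complex.conj_I]
      have h2 : (((a : ℝ) - b : ℝ) : ℂ) * ((Real.pi / (a - b) : ℝ) : ℂ) = Real.pi := by
        rw [← Complex.ofReal_mul]
        congr 1
        field_simp
      push_cast at h2 ⊢
      linear_combination Complex.I * h2
    set F : ℂ → ℂ := fun z => z ^ a * (starRingEnd ℂ z) ^ b * (Real.exp (-‖z‖ ^ 2) : ℝ) with hF
    have h4 : ∫ z, F (rotation w z) = ∫ z, F z :=
      (rotation w).measurePreserving.integral_comp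
        (rotation w).toHomeomorph.measurableEmbedding F
    have h5 : ∀ z, F (rotation w z) = -F z := by
      intro z
      simp only [hF, rotation_apply, map_mul, norm_mul, Circle.norm_coe, one_mul, mul_pow]
      linear_combination (z ^ a * (starRingEnd ℂ z) ^ b * (Real.exp (-‖z‖ ^ 2) : ℝ)) * hw
    simp only [h5, integral_neg] at h4
    exact self_eq_neg.mp h4.symm

/-- The monomial `∏ u_c ^ n_c * conj(u_c) ^ m_c`. -/
def monomialConj {d : ℕ} (n m : Fin d → ℕ) (u : EuclideanSpace ℂ (Fin d)) : ℂ :=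
  ∏ c, (u c) ^ n c * (starRingEnd ℂ (u c)) ^ m c

theorem monomialConj_smul {d : ℕ} (n m : Fin d → ℕ) (r : ℝ) (u : EuclideanSpace ℂ (Fin d)) :
    monomialConj n m (r • u) = (r : ℂ) ^ (∑ c, (n c + m c)) * monomialConj n m u := by
  simp only [monomialConj, PiLp.smul_apply, Complex.real_smul, map_mul, Complex.conj_ofReal,
    mul_pow]
  rw [← Finset.prod_pow_eq_pow_sum, ← Finset.prod_mul_distrib]
  refine Finset.prod_congr rfl fun c _ => ?_
  rw [pow_add]
  ring

/-- The Gaussian weight makes the coordinates independent. The constant κ includes the normalisation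
of the volume and need not be known, because it cancels against the case n = m = 0. -/
theorem exists_integral_monomialConj (d : ℕ) : ∃ κ : ℂ, ∀ n m : Fin d → ℕ,
    ∫ x : EuclideanSpace ℂ (Fin d), monomialConj n m x * (Real.exp (-‖x‖ ^ 2) : ℝ) =
      κ * if n = m then ∏ c, ((n c).factorial : ℂ) else 0 := by
  let e : EuclideanSpace ℂ (Fin d) ≃L[ℝ] (Fin d → ℂ) :=
    (PiLp.continuousLinearEquiv 2 ℝ fun _ : Fin d => ℂ)
  let ν : Measure (EuclideanSpace ℂ (Fin d)) := (volume : Measure (Fin d → ℂ)).map e.symm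
  have hν : ν.IsAddHaarMeasure := e.symm.isAddHaarMeasure_map _
  obtain ⟨κ, hκ⟩ : ∃ κ : NNReal, (volume : Measure (EuclideanSpace ℂ (Fin d))) = κ • ν :=
    ⟨_, Measure.isAddLeftInvariant_eq_smul _ _⟩
  refine ⟨κ * Real.pi ^ d, fun n m => ?_⟩
  rw [hκ, integral_smul_nnreal_measure, NNReal.smul_def, Complex.real_smul, mul_assoc]
  congr 1
  have h1 : ∫ x, monomialConj n m x * (Real.exp (-‖x‖ ^ 2) : ℝ) ∂ν =
      ∫ z : Fin d → ℂ, ∏ c, (z c ^ n c * (starRingEnd ℂ (z c)) ^ m c *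
        (Real.exp (-‖z c‖ ^ 2) : ℝ)) := by
    refine (e.symm.toHomeomorph.measurableEmbedding.integral_map _).trans ?_
    refine integral_congr_ae (Eventually.of_forall fun z => ?_)
    have h2 : ‖e.symm z‖ ^ 2 = ∑ c, ‖z c‖ ^ 2 := EuclideanSpace.norm_sq_eq _
    change monomialConj n m (e.symm z) * (Real.exp (-‖e.symm z‖ ^ 2) : ℝ) = _
    simp only
    rw [h2, Finset.prod_mul_distrib, ← Complex.ofReal_prod, ← Real.exp_sum, Finset.sum_neg_distrib]
    rfl
  rw [h1, integral_fintype_prod_volume_eq_prod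
    (fun c (w : ℂ) => w ^ n c * (starRingEnd ℂ w) ^ m c * (Real.exp (-‖w‖ ^ 2) : ℝ))]
  simp only [integral_pow_mul_conj_pow_mul_exp]
  split_ifs with hnm
  · subst hnm
    simp [Finset.prod_mul_distrib]
  · obtain ⟨c, hc⟩ := Function.ne_iff.mp hnm
    rw [mul_zero]
    exact Finset.prod_eq_zero (Finset.mem_univ c) (if_neg hc)

/-- The moments of a uniformly random unit vector of `ℂ^d`. -/
theorem integral_monomialConj_uniformUnitVec {d : ℕ} (hd : 1 ≤ d) (n m : Fin d → ℕ) :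
    ∫ u : UnitVec d, monomialConj n m u ∂uniformUnitVec d =
      if n = m then (∏ c, ((n c).factorial : ℂ)) / (d.ascFactorial (∑ c, n c) : ℂ) else 0 := by
  have : NeZero d := ⟨by omega⟩
  have : Nontrivial (EuclideanSpace ℂ (Fin d)) := inferInstance
  have hfin : Module.finrank ℝ (EuclideanSpace ℂ (Fin d)) = 2 * d := by
    rw [← Module.finrank_mul_finrank ℝ ℂ, Complex.finrank_real_complex, finrank_euclideanSpace_fin]
  obtain ⟨κ, hκ⟩ := exists_integral_monomialConj d
  set ς := (volume : Measure (EuclideanSpace ℂ (Fin d))).toSphere with hς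
  have hpolar : ∀ n m : Fin d → ℕ, (κ * if n = m then ∏ c, ((n c).factorial : ℂ) else 0) =
      (∫ u, monomialConj n m u ∂ς) *
        ((1 / 2 * Real.Gamma ((∑ c, (n c + m c) + 2 * d : ℕ) / 2) : ℝ) : ℂ) := by
    intro n m
    rw [← hκ, integral_mul_exp_neg_norm_sq volume (monomialConj n m) (∑ c, (n c + m c))
      (fun r u _ => monomialConj_smul n m r u), hfin]
  have hΓ : ∀ k : ℕ, 1 ≤ k → (Real.Gamma ((2 * k : ℕ) / 2) : ℝ) = (k - 1).factorial := by
    intro k hk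
    rw [← Real.Gamma_nat_eq_factorial]
    congr 1
    rw [Nat.cast_sub hk]
    push_cast
    ring
  have hmass : ς.real univ ≠ 0 := by
    rw [Measure.real, ENNReal.toReal_ne_zero]
    exact ⟨Measure.measure_univ_ne_zero.mpr (Measure.toSphere_ne_zero _), measure_ne_top _ _⟩
  have hunif : ∫ u : UnitVec d, monomialConj n m u ∂uniformUnitVec d =
      (ς.real univ : ℂ)⁻¹ * ∫ u, monomialConj n m u ∂ς := by
    rw [uniformUnitVec, integral_smul_measure, ENNReal.toReal_inv, Complex.real_smul,
      Complex.ofReal_inv]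
    rfl
  rw [hunif]
  -- The constant monomial expresses κ through the total mass of the sphere.
  have h0 := hpolar 0 0
  have h1 : ∫ u : Metric.sphere (0 : EuclideanSpace ℂ (Fin d)) 1,
      monomialConj (0 : Fin d → ℕ) 0 u ∂ς = (ς.real univ : ℂ) := by
    simp [monomialConj]
  rw [h1] at h0
  simp only [Pi.zero_apply, add_zero, Finset.sum_const_zero, zero_add, if_true,
    Nat.factorial_zero, Nat.cast_one, Finset.prod_const_one, mul_one, hΓ d hd] at h0
  have h2 := hpolar n m
  split_ifs at h2 ⊢ with hnm
  · subst hnm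
    have h3 : ∑ c, (n c + n c) + 2 * d = 2 * (∑ c, n c + d) := by
      rw [Finset.sum_add_distrib]
      ring
    rw [h3, hΓ _ (by omega), h0] at h2
    have h4 : ((∑ c, n c + d - 1).factorial : ℂ) =
        ((d - 1).factorial : ℂ) * (d.ascFactorial (∑ c, n c) : ℂ) := by
      have := Nat.factorial_mul_ascFactorial (d - 1) (∑ c, n c)
      rw [show d - 1 + 1 = d by omega] at this
      rw [← Nat.cast_mul, this]
      congr 2
      omega
    have h5 : ((d - 1).factorial : ℂ) ≠ 0 := by exact_mod_cast (d - 1).factorial_ne_zero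
    have h6 : (d.ascFactorial (∑ c, n c) : ℂ) ≠ 0 := by
      have : NeZero d := ⟨by omega⟩
      have := Nat.ascFactorial_pos (d - 1) (∑ c, n c)
      rw [show d - 1 + 1 = d by omega] at this
      exact_mod_cast this.ne'
    have h7 : (ς.real univ : ℂ) ≠ 0 := by exact_mod_cast hmass
    push_cast at h2
    rw [h4] at h2
    field_simp
    field_simp at h2
    linear_combination (-1 : ℂ) * h2
  · have h8 : ((1 / 2 * Real.Gamma ((∑ c, (n c + m c) + 2 * d : ℕ) / 2) : ℝ) : ℂ) ≠ 0 := by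
      have : 0 < ((∑ c, (n c + m c) + 2 * d : ℕ) : ℝ) / 2 := by
        have : 0 < ∑ c, (n c + m c) + 2 * d := by omega
        positivity
      have := Real.Gamma_pos_of_pos this
      exact_mod_cast (by positivity : (1 / 2 * Real.Gamma _ : ℝ) ≠ 0)
    rw [mul_zero, eq_comm, mul_eq_zero] at h2
    rw [h2.resolve_right h8, mul_zero]

end SphereMoments

/-! ### Traces of powers as sums over closed walks -/

section WalkSums

open Matrix

variable {I J R : Type*} [Fintype I] [DecidableEq I] [Fintype J] [DecidableEq J] [CommRing R]

theorem Matrix.mul_mul_pow_comm (A : Matrix I J R) (B : Matrix J I R) (n : ℕ) :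
    (A * B) ^ (n + 1) = A * ((B * A) ^ n * B) := by
  induction n with
  | zero => simp
  | succ n ih => rw [pow_succ, ih, pow_succ]; simp only [Matrix.mul_assoc]

theorem Matrix.trace_mul_pow_comm (A : Matrix I J R) (B : Matrix J I R) (n : ℕ) :
    ((A * B) ^ (n + 1)).trace = ((B * A) ^ (n + 1)).trace := by
  rw [Matrix.mul_mul_pow_comm, Matrix.trace_mul_comm, pow_succ, Matrix.mul_assoc]

theorem Matrix.pow_succ_apply_eq_sum (G : Matrix I I R) (n : ℕ) (a b : I) :
    (G ^ (n + 1)) a b =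
      ∑ t : Fin n → I, ∏ j, G ((Fin.cons a t : Fin (n + 1) → I) j)
        ((Fin.snoc t b : Fin (n + 1) → I) j) := by
  induction n generalizing a with
  | zero => simp [Fin.snoc]
  | succ n ih =>
    rw [pow_succ', Matrix.mul_apply, ← (Fin.consEquiv fun _ : Fin (n + 1) => I).sum_comp,
      Fintype.sum_prod_type]
    refine Finset.sum_congr rfl fun x _ => ?_
    rw [ih, Finset.mul_sum]
    refine Finset.sum_congr rfl fun t _ => ?_
    have h : (Fin.snoc (Fin.cons x t : Fin (n + 1) → I) b : Fin (n + 2) → I) =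
        Fin.cons x (Fin.snoc t b : Fin (n + 1) → I) := by
      rw [Fin.cons_snoc_eq_snoc_cons]
    change _ = ∏ j, G ((Fin.cons a (Fin.cons x t : Fin (n + 1) → I) : Fin (n + 2) → I) j)
      ((Fin.snoc (Fin.cons x t : Fin (n + 1) → I) b : Fin (n + 2) → I) j)
    rw [h, Fin.prod_univ_succ (n := n + 1)]
    simp only [Fin.cons_zero, Fin.cons_succ]

theorem Matrix.trace_pow_succ_eq_sum (G : Matrix I I R) (n : ℕ) :
    (G ^ (n + 1)).trace = ∑ s : Fin (n + 1) → I, ∏ j, G (s j) (s (finRotate (n + 1) j)) := by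
  simp only [Matrix.trace, Matrix.diag_apply, Matrix.pow_succ_apply_eq_sum]
  rw [← (Fin.consEquiv fun _ : Fin (n + 1) => I).sum_comp, Fintype.sum_prod_type]
  refine Finset.sum_congr rfl fun a _ => Finset.sum_congr rfl fun t _ =>
    Finset.prod_congr rfl fun j _ => ?_
  rw [Fin.snoc_eq_cons_rotate]
  rfl

end WalkSums

section TraceExpansion

/-- The p × p Gram matrix X*X has the same traces of powers as X X*, and its entries are products of
overlaps over the tensor legs. -/
theorem trace_stateSum_pow {p d k : ℕ} (φ : Fin p → Fin k → UnitVec d) (n : ℕ) :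
    ((stateSum φ) ^ (n + 1)).trace = ∑ s : Fin (n + 1) → Fin p, ∏ j, ∏ i, ∑ c,
      starRingEnd ℂ ((φ (s j) i).1 c) * (φ (s (finRotate (n + 1) j)) i).1 c := by
  let X : Matrix (Fin k → Fin d) (Fin p) ℂ := Matrix.of fun a s => productVec (φ s) a
  have h1 : stateSum φ = X * X.conjTranspose := by
    ext a b
    simp [stateSum, Matrix.sum_apply, Matrix.vecMulVec_apply, Matrix.mul_apply, X]
  rw [h1, Matrix.trace_mul_pow_comm, Matrix.trace_pow_succ_eq_sum]
  refine Finset.sum_congr rfl fun s _ => Finset.prod_congr rfl fun j _ => ?_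
  rw [Fintype.prod_sum]
  simp [Matrix.mul_apply, X, productVec, Finset.prod_mul_distrib]

theorem Finset.prod_comp_eq_prod_pow_card {ι Λ M : Type*} [Fintype ι] [Fintype Λ] [DecidableEq Λ]
    [CommMonoid M] (g : ι → Λ) (f : Λ → M) :
    ∏ i, f (g i) = ∏ b, f b ^ Finset.card {i | g i = b} := by
  rw [← Finset.prod_fiberwise Finset.univ g]
  refine Finset.prod_congr rfl fun b _ => ?_
  rw [Finset.prod_congr rfl fun i hi => by rw [(Finset.mem_filter.mp hi).2], Finset.prod_const]

/-- The number of positions with label `t` and coordinate `y`. -/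
def jointCount {ι Λ Δ : Type*} [Fintype ι] [DecidableEq Λ] [DecidableEq Δ] (s : ι → Λ) (α : ι → Δ)
    (t : Λ) (y : Δ) : ℕ :=
  Finset.card {j | (s j, α j) = (t, y)}

theorem sum_jointCount {ι Λ Δ : Type*} [Fintype ι] [DecidableEq Λ] [DecidableEq Δ] [Fintype Δ]
    (s : ι → Λ) (α : ι → Δ) (t : Λ) :
    ∑ y, jointCount s α t y = Finset.card {j | s j = t} := by
  rw [Finset.card_eq_sum_card_fiberwise (f := α) (t := Finset.univ) (by simp)]
  refine Finset.sum_congr rfl fun y _ => ?_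
  rw [jointCount, Finset.filter_filter]
  simp only [Prod.mk.injEq]

theorem trace_stateSum_pow_eq_monomials {p d k : ℕ} (φ : Fin p → Fin k → UnitVec d) (n : ℕ) :
    ((stateSum φ) ^ (n + 1)).trace = ∑ s : Fin (n + 1) → Fin p,
      ∑ α : Fin k → Fin (n + 1) → Fin d, ∏ t, ∏ i,
        monomialConj (jointCount (s ∘ finRotate (n + 1)) (α i) t) (jointCount s (α i) t)
          (φ t i).1 := by
  rw [trace_stateSum_pow]
  refine Finset.sum_congr rfl fun s _ => ?_
  rw [Finset.prod_comm]
  simp_rw [Fintype.prod_sum]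
  refine Finset.sum_congr rfl fun α _ => ?_
  rw [Finset.prod_comm (s := (Finset.univ : Finset (Fin p)))]
  refine Finset.prod_congr rfl fun i _ => ?_
  simp only [monomialConj, jointCount]
  rw [Finset.prod_mul_distrib,
    Finset.prod_comp_eq_prod_pow_card (fun j => (s j, α i j))
      (fun q => starRingEnd ℂ ((φ q.1 i).1 q.2)),
    Finset.prod_comp_eq_prod_pow_card (fun j => (s (finRotate (n + 1) j), α i j))
      (fun q => (φ q.1 i).1 q.2), Fintype.prod_prod_type, Fintype.prod_prod_type,
    ← Finset.prod_mul_distrib]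
  refine Finset.prod_congr rfl fun t _ => ?_
  rw [← Finset.prod_mul_distrib]
  refine Finset.prod_congr rfl fun y _ => ?_
  rw [mul_comm]
  rfl

end TraceExpansion

/-! ### Counting permutations that match two labellings -/

section Counting

open Equiv.Perm

variable {ι Λ Δ : Type*} [Fintype ι] [DecidableEq ι] [Fintype Λ] [DecidableEq Λ]

/-- If the multiplicities match, one solution σ₀ exists and translation by it identifies the
solutions with the stabiliser of g. This turns the factorials of the sphere moments into Wick
pairings. -/
theorem card_perm_comp_eq (f g : ι → Λ) :
    Finset.card {σ : Equiv.Perm ι | f ∘ σ = g} =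
      if ∀ y, Finset.card {i | g i = y} = Finset.card {i | f i = y} then
        ∏ y, (Finset.card {i | g i = y}).factorial else 0 := by
  split_ifs with h
  · let e : ∀ y, {i // g i = y} ≃ {i // f i = y} := fun y =>
      Fintype.equivOfCardEq (by rw [Fintype.card_subtype, Fintype.card_subtype, h])
    let σ₀ : Equiv.Perm ι := (Equiv.sigmaFiberEquiv g).symm.trans
      ((Equiv.sigmaCongrRight e).trans (Equiv.sigmaFiberEquiv f))
    have h₀ : ∀ i, f (σ₀ i) = g i := fun i => (e (g i) ⟨i, rfl⟩).2
    have h1 : Finset.card {σ : Equiv.Perm ι | f ∘ σ = g} =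
        Finset.card {σ : Equiv.Perm ι | g ∘ σ = g} := by
      refine Finset.card_equiv (Equiv.mulLeft σ₀⁻¹) fun σ => ?_
      simp only [Finset.mem_filter, Finset.mem_univ, true_and, Equiv.coe_mulLeft, funext_iff,
        Function.comp_apply]
      refine forall_congr' fun i => ?_
      rw [← h₀ ((σ₀⁻¹ * σ) i)]
      simp
    rw [h1, ← Fintype.card_subtype, DomMulAct.stabilizer_card]
    refine Finset.prod_congr rfl fun y _ => ?_
    rw [Fintype.card_subtype]
  · rw [Finset.card_eq_zero, Finset.filter_eq_empty_iff]
    intro σ _ hσ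
    refine h fun y => Finset.card_equiv σ fun i => ?_
    simp [← hσ]

/-- Functions that are constant on the cycles of a permutation. -/
def cycleFunctionEquiv (σ : Equiv.Perm ι) (Δ : Type*) :
    {α : ι → Δ // ∀ i, α (σ i) = α i} ≃ (Quotient (SameCycle.setoid σ) → Δ) where
  toFun α := Quotient.lift α.1 fun _ _ h =>
    SameCycle.of_forall_apply (Setoid.ker α.1) (fun i => (α.2 i).symm) h
  invFun f := ⟨fun i => f (Quotient.mk _ i), fun i => congrArg f (Quotient.sound
    (show σ.SameCycle (σ i) i from sameCycle_apply_left.mpr (SameCycle.refl _ _)))⟩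
  left_inv α := rfl
  right_inv f := by
    funext q
    induction q using Quotient.inductionOn
    rfl

theorem card_cycleFunctions [Fintype Δ] [DecidableEq Δ] (σ : Equiv.Perm ι) :
    Finset.card {α : ι → Δ | ∀ i, α (σ i) = α i} = Fintype.card Δ ^ numCycles σ := by
  rw [← Fintype.card_subtype, ← Nat.card_eq_fintype_card,
    Nat.card_congr (cycleFunctionEquiv σ Δ), Nat.card_fun, Nat.card_eq_fintype_card]
  rfl

/-- Put σ = τ c: the condition on labels says that τ preserves s, and that on coordinates says that
α is constant on the cycles of τ c, leaving |Δ|^{#(τc)} choices. -/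
theorem sum_card_perm_eq_twistedSum [Fintype Δ] [DecidableEq Δ] (c : Equiv.Perm ι) (s : ι → Λ) :
    ∑ α : ι → Δ, Finset.card {σ : Equiv.Perm ι | (fun j => (s j, α j)) ∘ σ =
      fun j => (s (c j), α j)} = twistedSum (Fintype.card Δ) c s := by
  simp only [Finset.card_filter]
  rw [Finset.sum_comm]
  unfold twistedSum labelPerms
  rw [Finset.sum_filter, ← Equiv.sum_comp (Equiv.mulRight c)]
  refine Finset.sum_congr rfl fun τ _ => ?_
  have h1 : ∀ α : ι → Δ, ((fun j => (s j, α j)) ∘ ((Equiv.mulRight c) τ : Equiv.Perm ι) =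
      fun j => (s (c j), α j)) ↔ (s ∘ τ = s ∧ ∀ i, α ((τ * c) i) = α i) := by
    intro α
    simp only [funext_iff, Function.comp_apply, Equiv.coe_mulRight, Prod.mk.injEq, forall_and,
      Equiv.Perm.mul_apply]
    refine and_congr_left fun _ => ?_
    exact ⟨fun h x => by simpa using h (c.symm x), fun h x => h (c x)⟩
  simp only [h1]
  split_ifs with h
  · simp only [h, true_and]
    rw [← Finset.card_filter, card_cycleFunctions]
  · simp [h]

end Counting

/-! ### The exact formula for the moments -/

section MomentFormula

open Equiv.Perm

theorem continuous_monomialConj {d : ℕ} (n m : Fin d → ℕ) :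
    Continuous fun u : UnitVec d => monomialConj n m u.1 := by
  unfold monomialConj
  refine continuous_finsetProd _ fun c _ => ?_
  have h : Continuous fun u : UnitVec d => u.1 c :=
    (EuclideanSpace.proj c : EuclideanSpace ℂ (Fin d) →L[ℂ] ℂ).continuous.comp
      continuous_subtype_val
  exact (h.pow _).mul ((Complex.continuous_conj.comp h).pow _)

theorem integrable_monomialConj {d : ℕ} (hd : 1 ≤ d) (n m : Fin d → ℕ) :
    Integrable (fun u : UnitVec d => monomialConj n m u.1) (uniformUnitVec d) := by
  have := isProbabilityMeasure_uniformUnitVec d hd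
  exact (continuous_monomialConj n m).integrable_of_hasCompactSupport
    (HasCompactSupport.of_compactSpace _)

theorem prod_integral_monomialConj {p d : ℕ} {ι : Type*} [Fintype ι] [DecidableEq ι] (hd : 1 ≤ d)
    (c : Equiv.Perm ι) (s : ι → Fin p) (α : ι → Fin d) :
    ∏ t, ∫ u : UnitVec d, monomialConj (jointCount (s ∘ c) α t) (jointCount s α t) u.1
        ∂uniformUnitVec d =
      (Finset.card {σ : Equiv.Perm ι | (fun j => (s j, α j)) ∘ σ = fun j => (s (c j), α j)} : ℂ) /
        risingProd d s := by
  have hr : ∏ t, d.ascFactorial (∑ y, jointCount (s ∘ c) α t y) = risingProd d s := by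
    unfold risingProd
    refine Finset.prod_congr rfl fun t _ => ?_
    rw [sum_jointCount]
    congr 1
    exact Finset.card_equiv c fun i => by simp
  simp only [integral_monomialConj_uniformUnitVec hd]
  rw [card_perm_comp_eq, Fintype.prod_prod_type, ← hr]
  change _ = ((if ∀ y : Fin p × Fin d, jointCount (s ∘ c) α y.1 y.2 = jointCount s α y.1 y.2 then
    ∏ t, ∏ y, (jointCount (s ∘ c) α t y).factorial else 0 : ℕ) : ℂ) / _
  by_cases h : ∀ t, jointCount (s ∘ c) α t = jointCount s α t
  · have h' : ∀ y : Fin p × Fin d, jointCount (s ∘ c) α y.1 y.2 = jointCount s α y.1 y.2 :=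
      fun y => congrFun (h y.1) y.2
    rw [if_pos h']
    simp only [h, if_true]
    push_cast
    rw [Finset.prod_div_distrib]
  · rw [if_neg fun h' => h fun t => funext fun y => h' (t, y)]
    obtain ⟨t, ht⟩ := not_forall.mp h
    rw [Finset.prod_eq_zero (Finset.mem_univ t) (if_neg ht)]
    simp

/-- Independence factors the expectation over labels and legs. All legs have the same law, so the
sum over coordinates is a k-th power. -/
theorem integral_trace_stateSum_pow {p d k : ℕ} (hd : 1 ≤ d) (n : ℕ) :
    Integrable (fun φ => (stateSum φ ^ (n + 1)).trace) (productEnsemble p d k) ∧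
    ∫ φ, (stateSum φ ^ (n + 1)).trace ∂(productEnsemble p d k) =
      ∑ s : Fin (n + 1) → Fin p,
        ((twistedSum d (finRotate (n + 1)) s : ℂ) / risingProd d s) ^ k := by
  have := isProbabilityMeasure_uniformUnitVec d hd
  have hint : ∀ (s : Fin (n + 1) → Fin p) (α : Fin k → Fin (n + 1) → Fin d),
      Integrable (fun φ : Fin p → Fin k → UnitVec d => ∏ t, ∏ i,
        monomialConj (jointCount (s ∘ finRotate (n + 1)) (α i) t) (jointCount s (α i) t)
          (φ t i).1) (productEnsemble p d k) := by
    intro s α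
    refine Integrable.fintype_prod (f := fun t (ψ : Fin k → UnitVec d) => ∏ i,
        monomialConj (jointCount (s ∘ finRotate (n + 1)) (α i) t) (jointCount s (α i) t)
          (ψ i).1) fun t => ?_
    exact Integrable.fintype_prod (f := fun i (u : UnitVec d) =>
        monomialConj (jointCount (s ∘ finRotate (n + 1)) (α i) t) (jointCount s (α i) t)
          u.1) fun i => integrable_monomialConj hd _ _
  simp only [trace_stateSum_pow_eq_monomials]
  refine ⟨integrable_finsetSum _ fun s _ => integrable_finsetSum _ fun α _ => hint s α, ?_⟩
  rw [integral_finsetSum _ fun s _ => integrable_finsetSum _ fun α _ => hint s α]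
  refine Finset.sum_congr rfl fun s _ => ?_
  rw [integral_finsetSum _ fun α _ => hint s α]
  have h1 : ∀ α : Fin k → Fin (n + 1) → Fin d,
      ∫ φ : Fin p → Fin k → UnitVec d, ∏ t, ∏ i,
        monomialConj (jointCount (s ∘ finRotate (n + 1)) (α i) t) (jointCount s (α i) t)
          (φ t i).1 ∂(productEnsemble p d k) =
      ∏ i, ((Finset.card {σ : Equiv.Perm (Fin (n + 1)) | (fun j => (s j, α i j)) ∘ σ =
        fun j => (s (finRotate (n + 1) j), α i j)} : ℂ) / risingProd d s) := by
    intro α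
    rw [productEnsemble, integral_fintype_prod_eq_prod (fun t (ψ : Fin k → UnitVec d) => ∏ i,
        monomialConj (jointCount (s ∘ finRotate (n + 1)) (α i) t) (jointCount s (α i) t)
          (ψ i).1)]
    have h2 : ∀ t, ∫ ψ : Fin k → UnitVec d, ∏ i,
        monomialConj (jointCount (s ∘ finRotate (n + 1)) (α i) t) (jointCount s (α i) t)
          (ψ i).1 ∂(Measure.pi fun _ => uniformUnitVec d) = ∏ i, ∫ u : UnitVec d,
        monomialConj (jointCount (s ∘ finRotate (n + 1)) (α i) t) (jointCount s (α i) t)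
          u.1 ∂(uniformUnitVec d) := fun t =>
      integral_fintype_prod_eq_prod fun i (u : UnitVec d) =>
        monomialConj (jointCount (s ∘ finRotate (n + 1)) (α i) t) (jointCount s (α i) t) u.1
    simp only [h2]
    rw [Finset.prod_comm]
    simp only [prod_integral_monomialConj hd]
  simp only [h1]
  rw [← Fintype.prod_sum fun (_ : Fin k) (α : Fin (n + 1) → Fin d) =>
    (Finset.card {σ : Equiv.Perm (Fin (n + 1)) | (fun j => (s j, α j)) ∘ σ =
        fun j => (s (finRotate (n + 1) j), α j)} : ℂ) / risingProd d s, Finset.prod_const, Finset.card_univ, Fintype.card_fin]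
  congr 1
  rw [← Finset.sum_div, ← Nat.cast_sum, sum_card_perm_eq_twistedSum, Fintype.card_fin]

theorem normMoment_succ_eq {p d k : ℕ} (hd : 1 ≤ d) (n : ℕ) :
    normMoment p d k (n + 1) = 1 / (d : ℝ) ^ k * ∑ s : Fin (n + 1) → Fin p,
      ((twistedSum d (finRotate (n + 1)) s : ℝ) / risingProd d s) ^ k := by
  obtain ⟨h1, h2⟩ := integral_trace_stateSum_pow (p := p) (k := k) hd n
  unfold normMoment
  congr 1
  have h3 := integral_re h1
  rw [show (∫ φ, ((stateSum φ ^ (n + 1)).trace).re ∂(productEnsemble p d k)) =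
    (∫ φ, (stateSum φ ^ (n + 1)).trace ∂(productEnsemble p d k)).re from h3, h2]
  rw [← Complex.ofReal_re (∑ s : Fin (n + 1) → Fin p,
      ((twistedSum d (finRotate (n + 1)) s : ℝ) / risingProd d s) ^ k)]
  push_cast
  rfl

end MomentFormula

/-! ### The upper bound for the moments -/

section UpperBound

open Equiv.Perm

/-- Prefix a value a to f: each of the p choices contributes at most Y, and the at most N values
already taken contribute an extra 1 each. -/
theorem sum_pow_card_image_le {Y : ℝ} (hY : 0 ≤ Y) (p N : ℕ) :
    ∑ f : Fin N → Fin p, Y ^ (Finset.univ.image f).card ≤ ∏ i ∈ Finset.range N, (p * Y + i) := by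
  induction N with
  | zero => simp
  | succ N ih =>
    rw [← Equiv.sum_comp (Fin.consEquiv fun _ : Fin (N + 1) => Fin p), Fintype.sum_prod_type_right,
      Finset.prod_range_succ]
    refine le_trans ?_ (mul_le_mul_of_nonneg_right ih (by positivity))
    rw [Finset.sum_mul]
    refine Finset.sum_le_sum fun f _ => ?_
    have himg : ∀ a : Fin p, Finset.univ.image (Fin.cons a f : Fin (N + 1) → Fin p) =
        insert a (Finset.univ.image f) := by
      intro a
      ext b
      simp [Fin.exists_fin_succ, eq_comm]
    have hcard : ((Finset.univ.image f).card : ℝ) ≤ N := by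
      have := Finset.card_image_le (s := Finset.univ) (f := f)
      rw [Finset.card_univ, Fintype.card_fin] at this
      exact_mod_cast this
    have hterm : ∀ a : Fin p, Y ^ (insert a (Finset.univ.image f)).card ≤
        Y ^ (Finset.univ.image f).card * (Y + if a ∈ Finset.univ.image f then 1 else 0) := by
      intro a
      split_ifs with ha
      · rw [Finset.insert_eq_of_mem ha]
        have := pow_nonneg hY (Finset.univ.image f).card
        nlinarith
      · rw [Finset.card_insert_of_notMem ha, pow_succ, add_zero]
    calc ∑ a : Fin p, Y ^ (Finset.univ.image (Fin.cons a f : Fin (N + 1) → Fin p)).card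
        ≤ ∑ a : Fin p, Y ^ (Finset.univ.image f).card *
            (Y + if a ∈ Finset.univ.image f then 1 else 0) := by
          refine Finset.sum_le_sum fun a _ => ?_
          rw [himg]
          exact hterm a
      _ = Y ^ (Finset.univ.image f).card * (p * Y + (Finset.univ.image f).card) := by
          rw [← Finset.mul_sum, Finset.sum_add_distrib]
          simp
      _ ≤ _ := by gcongr

theorem prod_add_natCast_le {z : ℝ} (hz : 0 < z) (N : ℕ) :
    ∏ i ∈ Finset.range N, (z + i) ≤ z ^ N * Real.exp ((N : ℝ) ^ 2 / z) := by
  have h : ∀ i ∈ Finset.range N, z + i ≤ z * Real.exp (N / z) := by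
    intro i hi
    have h1 : (i : ℝ) / z ≤ N / z := by
      have : (i : ℝ) ≤ N := by exact_mod_cast (Finset.mem_range.mp hi).le
      gcongr
    have h2 := Real.add_one_le_exp ((N : ℝ) / z)
    calc z + i = z * (i / z + 1) := by field_simp; ring
      _ ≤ _ := by gcongr; linarith
  calc ∏ i ∈ Finset.range N, (z + i) ≤ ∏ i ∈ Finset.range N, (z * Real.exp (N / z)) :=
        Finset.prod_le_prod (fun i _ => by positivity) h
    _ = _ := by
      rw [Finset.prod_const, Finset.card_range, mul_pow, ← Real.exp_nat_mul]
      congr 2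
      ring

/-- Labellings preserved by σ are functions on its cycles with the same image. -/
theorem sum_pow_card_image_cycleFunctions_le {ι : Type*} [Fintype ι] [DecidableEq ι] {p : ℕ} {Y : ℝ}
    (hY : 0 < Y) (hp : 1 ≤ p) (σ : Equiv.Perm ι) :
    ∑ s : ι → Fin p with σ ∈ labelPerms s, Y ^ (Finset.univ.image s).card ≤
      (p * Y) ^ numCycles σ * Real.exp ((Fintype.card ι : ℝ) ^ 2 / (p * Y)) := by
  have hz : 0 < p * Y := by positivity
  let e : Quotient (SameCycle.setoid σ) ≃ Fin (numCycles σ) := Finite.equivFin _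
  have h1 : ∑ s : ι → Fin p with σ ∈ labelPerms s, Y ^ (Finset.univ.image s).card =
      ∑ f : Fin (numCycles σ) → Fin p, Y ^ (Finset.univ.image f).card := by
    symm
    refine Finset.sum_bij (fun f _ i => f (e (Quotient.mk _ i))) ?_ ?_ ?_ ?_
    · intro f _
      simp only [Finset.mem_filter, Finset.mem_univ, true_and, mem_labelPerms]
      intro i
      exact congrArg (fun q => f (e q)) (Quotient.sound
        (show σ.SameCycle (σ i) i from sameCycle_apply_left.mpr (SameCycle.refl _ _)))
    · intro f _ g _ h
      funext a
      obtain ⟨i, hi⟩ := Quotient.exists_rep (e.symm a)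
      have := congrFun h i
      simpa only [hi, Equiv.apply_symm_apply] using this
    · intro s hs
      simp only [Finset.mem_filter, Finset.mem_univ, true_and, mem_labelPerms] at hs
      refine ⟨fun a => cycleFunctionEquiv σ (Fin p) ⟨s, hs⟩ (e.symm a), Finset.mem_univ _, ?_⟩
      funext i
      simp only [Equiv.symm_apply_apply]
      rfl
    · intro f _
      congr 2
      ext b
      simp only [Finset.mem_image, Finset.mem_univ, true_and]
      constructor
      · rintro ⟨a, rfl⟩
        obtain ⟨i, hi⟩ := Quotient.exists_rep (e.symm a)
        exact ⟨i, by rw [hi, Equiv.apply_symm_apply]⟩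
      · rintro ⟨i, rfl⟩
        exact ⟨_, rfl⟩
  rw [h1]
  refine (sum_pow_card_image_le hY.le _ _).trans ((prod_add_natCast_le hz _).trans ?_)
  have h2 : ((numCycles σ : ℕ) : ℝ) ≤ Fintype.card ι := by
    exact_mod_cast numCycles_le_card (S := Finset.univ)
      fun x => ⟨x, SameCycle.refl σ x, Finset.mem_univ x⟩
  gcongr

theorem pow_card_le_risingProd {ι : Type*} [Fintype ι] {Λ : Type*} [Fintype Λ] [DecidableEq Λ]
    (d : ℕ) (s : ι → Λ) : d ^ Fintype.card ι ≤ risingProd d s := by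
  unfold risingProd
  calc d ^ Fintype.card ι = ∏ b, d ^ (Finset.card {i | s i = b}) := by
        rw [Finset.prod_pow_eq_pow_sum, ← Finset.card_eq_sum_card_fiberwise (by simp)]
        rfl
    _ ≤ _ := Finset.prod_le_prod' fun b _ => Nat.pow_succ_le_ascFactorial _ _

/-- Of the k + 1 factors, k are bounded by d · d^{-l}. In the last one only the denominator is
bounded, by d^{n+1}, so that its sum over σ remains available for the genus expansion. -/
theorem pow_twistedSum_div_le {n p d k : ℕ} (hd : 1 ≤ d) (s : Fin (n + 1) → Fin p) :
    1 / (d : ℝ) ^ (k + 1) * ((twistedSum d (finRotate (n + 1)) s : ℝ) / risingProd d s) ^ (k + 1) ≤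
      (1 / (d : ℝ) ^ k) ^ (Finset.univ.image s).card *
        (twistedSum d (finRotate (n + 1)) s / (d : ℝ) ^ (n + 2)) := by
  have hd0 : (0 : ℝ) < d := by exact_mod_cast hd
  set l := (Finset.univ.image s).card
  have hr : (d : ℝ) ^ (n + 1) ≤ risingProd d s := by
    have := pow_card_le_risingProd d s
    rw [Fintype.card_fin] at this
    exact_mod_cast this
  have hr0 : (0 : ℝ) < risingProd d s := lt_of_lt_of_le (by positivity) hr
  have h1 : (twistedSum d (finRotate (n + 1)) s : ℝ) * (d : ℝ) ^ l ≤ d * risingProd d s := by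
    exact_mod_cast twistedSum_finRotate_mul_pow_le hd s
  set t : ℝ := (twistedSum d (finRotate (n + 1)) s : ℝ)
  set r : ℝ := (risingProd d s : ℝ)
  have ht : 0 ≤ t := Nat.cast_nonneg _
  have h2 : t / r ≤ d * (1 / d) ^ l := by
    rw [div_le_iff₀ hr0, one_div, inv_pow]
    field_simp
    exact h1
  have h3 : t / r ≤ t / (d : ℝ) ^ (n + 1) := by gcongr
  calc 1 / (d : ℝ) ^ (k + 1) * (t / r) ^ (k + 1)
      = 1 / (d : ℝ) ^ (k + 1) * ((t / r) ^ k * (t / r)) := by rw [pow_succ (t / r)]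
    _ ≤ 1 / (d : ℝ) ^ (k + 1) * ((d * (1 / d) ^ l) ^ k * (t / (d : ℝ) ^ (n + 1))) := by
        gcongr
    _ = _ := by
        rw [mul_pow, ← pow_mul, one_div_pow, one_div_pow, ← pow_mul, mul_comm l k]
        field_simp
        ring

/-- With Y = d^{-k} one has pY = xd, so the bound becomes a Wishart moment in dimension d with ratio
x. The exponents (n+1)²/(xd) and 2(n+1)⁵/(xd) add up to at most 3(n+1)⁵/(xd). -/
theorem normMoment_succ_le {n p d k : ℕ} (hp : 1 ≤ p) (hd : 1 ≤ d) :
    normMoment p d (k + 1) (n + 1) ≤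
      Real.exp (3 * ((n + 1 : ℕ) : ℝ) ^ 5 / (p / (d : ℝ) ^ (k + 1) * d)) *
        narayanaPoly (n + 1) (p / (d : ℝ) ^ (k + 1)) := by
  have hd0 : (0 : ℝ) < d := by exact_mod_cast hd
  have hp0 : (0 : ℝ) < p := by exact_mod_cast hp
  set x : ℝ := p / (d : ℝ) ^ (k + 1) with hx
  have hx0 : 0 < x := by positivity
  set Y : ℝ := 1 / (d : ℝ) ^ k with hY
  have hY0 : 0 < Y := by positivity
  have hz : p * Y = x * d := by
    rw [hx, hY, pow_succ]
    field_simp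
  have hβ : 0 ≤ narayanaPoly (n + 1) x :=
    Finset.sum_nonneg fun l _ => mul_nonneg (narayana_nonneg _ _) (by positivity)
  set A := Real.exp (((n + 1 : ℕ) : ℝ) ^ 2 / (x * d))
  rw [normMoment_succ_eq hd, Finset.mul_sum]
  calc ∑ s : Fin (n + 1) → Fin p, 1 / (d : ℝ) ^ (k + 1) *
        ((twistedSum d (finRotate (n + 1)) s : ℝ) / risingProd d s) ^ (k + 1)
      ≤ ∑ s : Fin (n + 1) → Fin p, Y ^ (Finset.univ.image s).card *
          (twistedSum d (finRotate (n + 1)) s / (d : ℝ) ^ (n + 2)) :=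
        Finset.sum_le_sum fun s _ => pow_twistedSum_div_le hd s
    _ = ∑ σ : Equiv.Perm (Fin (n + 1)), (d : ℝ) ^ numCycles (σ * finRotate (n + 1)) /
          (d : ℝ) ^ (n + 2) * ∑ s : Fin (n + 1) → Fin p with σ ∈ labelPerms s,
            Y ^ (Finset.univ.image s).card := by
        simp only [twistedSum, Nat.cast_sum, Nat.cast_pow, Finset.sum_div, Finset.mul_sum]
        rw [Finset.sum_comm' (t' := Finset.univ)
          (s' := fun σ => Finset.univ.filter fun s => σ ∈ labelPerms s) (by simp)]
        refine Finset.sum_congr rfl fun σ _ => Finset.sum_congr rfl fun s _ => mul_comm _ _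
    _ ≤ ∑ σ : Equiv.Perm (Fin (n + 1)), (d : ℝ) ^ numCycles (σ * finRotate (n + 1)) /
          (d : ℝ) ^ (n + 2) * ((x * d) ^ numCycles σ * A) := by
        refine Finset.sum_le_sum fun σ _ => mul_le_mul_of_nonneg_left ?_ (by positivity)
        have := sum_pow_card_image_cycleFunctions_le hY0 hp σ
        rwa [hz, Fintype.card_fin] at this
    _ = A / (d : ℝ) ^ (n + 2) * ∑ σ : Equiv.Perm (Fin (n + 1)), x ^ numCycles σ *
          (d : ℝ) ^ (numCycles σ + numCycles (finRotate (n + 1) * σ)) := by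
        rw [Finset.mul_sum]
        refine Finset.sum_congr rfl fun σ _ => ?_
        rw [numCycles_mul_comm, mul_pow, pow_add]
        ring
    _ ≤ A / (d : ℝ) ^ (n + 2) * ((d : ℝ) ^ (n + 2) *
          (Real.exp (2 * ((n + 1 : ℕ) : ℝ) ^ 5 / (x * d)) * narayanaPoly (n + 1) x)) := by
        have hA : 0 < A := Real.exp_pos _
        exact mul_le_mul_of_nonneg_left (sum_pow_numCycles_le hx0 hd0) (by positivity)
    _ = A * Real.exp (2 * ((n + 1 : ℕ) : ℝ) ^ 5 / (x * d)) * narayanaPoly (n + 1) x := by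
        field_simp
    _ ≤ _ := by
        refine mul_le_mul_of_nonneg_right ?_ hβ
        rw [← Real.exp_add, Real.exp_le_exp, ← add_div]
        have h1 : (1 : ℝ) ≤ ((n + 1 : ℕ) : ℝ) := by simp
        have h2 : ((n + 1 : ℕ) : ℝ) ^ 2 ≤ ((n + 1 : ℕ) : ℝ) ^ 5 := pow_le_pow_right₀ h1 (by norm_num)
        gcongr
        linarith

theorem normMoment_le_exp_mul_narayanaPoly {m p d k : ℕ} (hk : 1 ≤ k) (hm : 1 ≤ m) (hp : 1 ≤ p)
    (hd : 1 ≤ d) :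
    normMoment p d k m ≤
      Real.exp (3 * (m : ℝ) ^ (k + 4) / (p / (d : ℝ) ^ k * (d : ℝ) ^ (1 / (k : ℝ)))) *
        narayanaPoly m (p / (d : ℝ) ^ k) := by
  obtain ⟨n, rfl⟩ : ∃ n, m = n + 1 := ⟨m - 1, by omega⟩
  obtain ⟨k, rfl⟩ : ∃ j, k = j + 1 := ⟨k - 1, by omega⟩
  have hd1 : (1 : ℝ) ≤ d := by exact_mod_cast hd
  have hp0 : (0 : ℝ) < p := by exact_mod_cast hp
  have hd0 : (0 : ℝ) < d := by linarith
  refine (normMoment_succ_le hp hd).trans (mul_le_mul_of_nonneg_right ?_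
    (Finset.sum_nonneg fun l _ => mul_nonneg (narayana_nonneg _ _) (by positivity)))
  rw [Real.exp_le_exp]
  have h1 : (1 : ℝ) ≤ ((n + 1 : ℕ) : ℝ) := by simp
  have h2 : ((n + 1 : ℕ) : ℝ) ^ 5 ≤ ((n + 1 : ℕ) : ℝ) ^ (k + 1 + 4) :=
    pow_le_pow_right₀ h1 (by omega)
  have h3 : (d : ℝ) ^ (1 / ((k + 1 : ℕ) : ℝ)) ≤ d := by
    refine (Real.rpow_le_rpow_of_exponent_le hd1 ?_).trans_eq (Real.rpow_one _)
    rw [div_le_one (by positivity)]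
    simp
  gcongr

end UpperBound

/-! ### The lower bound for the moments -/

section LowerBound

open Equiv.Perm

/-- Labellings whose level sets are exactly the cycles of a permutation. -/
def cycleEmbeddingEquiv {ι : Type*} (σ : Equiv.Perm ι) (Λ : Type*) :
    {s : ι → Λ // ∀ i j, s i = s j ↔ σ.SameCycle i j} ≃
      (Quotient (SameCycle.setoid σ) ↪ Λ) where
  toFun s := ⟨Quotient.lift s.1 fun i j h => (s.2 i j).mpr h, by
    intro q r
    induction q using Quotient.inductionOn
    induction r using Quotient.inductionOn
    exact fun h => Quotient.sound ((s.2 _ _).mp h)⟩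
  invFun f := ⟨fun i => f (Quotient.mk _ i), fun i j =>
    ⟨fun h => Quotient.exact (f.injective h), fun h => congrArg f (Quotient.sound h)⟩⟩
  left_inv s := rfl
  right_inv f := by
    ext q
    induction q using Quotient.inductionOn
    rfl

theorem card_cycleEmbeddings {ι : Type*} [Finite ι] (σ : Equiv.Perm ι) (p : ℕ) :
    Nat.card {s : ι → Fin p // ∀ i j, s i = s j ↔ σ.SameCycle i j} =
      p.descFactorial (numCycles σ) := by
  classical
  have : Fintype (Quotient (SameCycle.setoid σ)) := Fintype.ofFinite _
  rw [Nat.card_congr (cycleEmbeddingEquiv σ (Fin p)), Nat.card_eq_fintype_card,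
    Fintype.card_embedding_eq, Fintype.card_fin, ← Nat.card_eq_fintype_card]
  rfl

/-- The falling factorial is at least (p + 1 - l)^l = p^l (1 - (l-1)/p)^l, to which Bernoulli's
inequality applies. -/
theorem one_sub_mul_pow_le_descFactorial {l m p : ℕ} (hl : 1 ≤ l) (hlm : l ≤ m) (hmp : m ≤ p) :
    (1 - (m : ℝ) ^ 2 / p) * (p : ℝ) ^ l ≤ p.descFactorial l := by
  have hp : (0 : ℝ) < p := by exact_mod_cast (by omega : 0 < p)
  have hlp : (l : ℝ) ≤ p := by exact_mod_cast hlm.trans hmp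
  have hl1 : (1 : ℝ) ≤ l := by exact_mod_cast hl
  have hlm' : (l : ℝ) ≤ m := by exact_mod_cast hlm
  have h1 : ((p + 1 - l : ℕ) : ℝ) ^ l ≤ p.descFactorial l := by
    exact_mod_cast Nat.pow_sub_le_descFactorial p l
  rw [Nat.cast_sub (by omega)] at h1
  push_cast at h1
  refine le_trans ?_ h1
  have hb := one_add_mul_le_pow (a := -((l - 1) / p : ℝ))
    (by rw [neg_le_neg_iff, div_le_iff₀ hp]; linarith) l
  have h2 : ((p : ℝ) + 1 - l) ^ l = (1 + -((l - 1) / p : ℝ)) ^ l * (p : ℝ) ^ l := by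
    rw [← mul_pow]
    congr 1
    field_simp
    ring
  rw [h2]
  refine mul_le_mul_of_nonneg_right (le_trans ?_ hb) (by positivity)
  have h3 : (l : ℝ) * (l - 1) / p ≤ (m : ℝ) ^ 2 / p := by
    gcongr
    nlinarith
  have h4 : (l : ℝ) * -((l - 1) / p) = -(l * (l - 1) / p) := by ring
  linarith

theorem pow_twistedSum_div_eq {n p d k : ℕ} (hd : 1 ≤ d) {σ : Equiv.Perm (Fin (n + 1))}
    (hσ : GenusZero (finRotate (n + 1)) σ) {s : Fin (n + 1) → Fin p}
    (hs : ∀ i j, s i = s j ↔ σ.SameCycle i j) :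
    1 / (d : ℝ) ^ k * ((twistedSum d (finRotate (n + 1)) s : ℝ) / risingProd d s) ^ k =
      (1 / (d : ℝ) ^ k) ^ numCycles σ := by
  have hd0 : (0 : ℝ) < d := by exact_mod_cast hd
  have hr0 : (0 : ℝ) < risingProd d s := by
    have := pow_card_le_risingProd d s
    exact_mod_cast lt_of_lt_of_le (by positivity) this
  have h1 : (twistedSum d (finRotate (n + 1)) s : ℝ) * (d : ℝ) ^ numCycles σ =
      d * risingProd d s := by
    exact_mod_cast twistedSum_mul_pow_eq n (Fin (n + 1)) (Fintype.card_fin _) _ σ s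
      numCycles_finRotate hσ hs
  have h2 : (twistedSum d (finRotate (n + 1)) s : ℝ) / risingProd d s =
      d * (1 / d) ^ numCycles σ := by
    rw [div_eq_iff hr0.ne', one_div, inv_pow]
    field_simp
    exact h1
  rw [h2, mul_pow, ← pow_mul, one_div_pow, one_div_pow, ← pow_mul, mul_comm k]
  field_simp

-- All terms of the moment formula are nonnegative, so it suffices to keep the labellings by cycles
-- of genus zero permutations. Distinct σ give disjoint families because a genus zero permutation is
-- determined by its orbits.
open Classical in
theorem sum_genusZero_descFactorial_le {n p d k : ℕ} (hd : 1 ≤ d) :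
    ∑ σ : Equiv.Perm (Fin (n + 1)) with GenusZero (finRotate (n + 1)) σ,
      (p.descFactorial (numCycles σ) : ℝ) * (1 / (d : ℝ) ^ k) ^ numCycles σ ≤
        normMoment p d k (n + 1) := by
  let S : Equiv.Perm (Fin (n + 1)) → Finset (Fin (n + 1) → Fin p) := fun σ =>
    {s | ∀ i j, s i = s j ↔ σ.SameCycle i j}
  have hcard : ∀ σ, (S σ).card = p.descFactorial (numCycles σ) := by
    intro σ
    rw [← card_cycleEmbeddings σ p, Nat.card_eq_fintype_card, Fintype.card_subtype]
  have hdisj : ((Finset.univ.filter fun σ : Equiv.Perm (Fin (n + 1)) =>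
      GenusZero (finRotate (n + 1)) σ : Finset _) : Set _).PairwiseDisjoint S := by
    intro σ hσ τ hτ hne
    refine Finset.disjoint_left.mpr fun s hs ht => hne ?_
    simp only [S, Finset.coe_filter, Finset.mem_filter, Finset.mem_univ, true_and,
      Set.mem_ofPred_eq] at hσ hτ hs ht
    exact hσ.eq_of_sameCycle_iff hτ fun x y => (hs x y).symm.trans (ht x y)
  rw [normMoment_succ_eq hd, Finset.mul_sum]
  calc _ = ∑ σ : Equiv.Perm (Fin (n + 1)) with GenusZero (finRotate (n + 1)) σ, ∑ s ∈ S σ,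
        1 / (d : ℝ) ^ k * ((twistedSum d (finRotate (n + 1)) s : ℝ) / risingProd d s) ^ k := by
        refine Finset.sum_congr rfl fun σ hσ => ?_
        rw [Finset.sum_congr rfl fun s hs => pow_twistedSum_div_eq hd
          (Finset.mem_filter.mp hσ).2 (Finset.mem_filter.mp hs).2, Finset.sum_const, hcard,
          nsmul_eq_mul]
    _ = _ := (Finset.sum_biUnion hdisj).symm
    _ ≤ _ := Finset.sum_le_sum_of_subset_of_nonneg (Finset.subset_univ _)
        fun s _ _ => by positivity

theorem le_normMoment {m p d k : ℕ} (hm : 1 ≤ m) (hd : 1 ≤ d) (hmp : (m : ℝ) < Real.sqrt p) :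
    (1 - (m : ℝ) ^ 2 / p) * narayanaPoly m (p / (d : ℝ) ^ k) ≤ normMoment p d k m := by
  classical
  obtain ⟨n, rfl⟩ : ∃ n, m = n + 1 := ⟨m - 1, by omega⟩
  have hlt : (n + 1) ^ 2 < p := by
    have := (Real.lt_sqrt (by positivity)).mp hmp
    exact_mod_cast this
  have hle : n + 1 ≤ p := by nlinarith
  refine le_trans ?_ (sum_genusZero_descFactorial_le hd)
  have hmaps : ∀ σ ∈ Finset.univ.filter fun σ : Equiv.Perm (Fin (n + 1)) =>
      GenusZero (finRotate (n + 1)) σ, numCycles σ ∈ Finset.Icc 1 (n + 1) := by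
    intro σ _
    refine Finset.mem_Icc.mpr ⟨numCycles_pos σ, ?_⟩
    simpa using numCycles_le_card (S := Finset.univ)
      fun x => ⟨x, SameCycle.refl σ x, Finset.mem_univ x⟩
  rw [← Finset.sum_fiberwise_of_maps_to hmaps, narayanaPoly, Finset.mul_sum]
  refine Finset.sum_le_sum fun l hl => ?_
  rw [Finset.mem_Icc] at hl
  rw [Finset.sum_congr rfl fun σ hσ => by rw [(Finset.mem_filter.mp hσ).2], Finset.sum_const,
    Finset.filter_filter, nsmul_eq_mul, ← Fintype.card_subtype, ← Nat.card_eq_fintype_card,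
    card_genusZero hl.1 hl.2]
  have h1 := one_sub_mul_pow_le_descFactorial hl.1 hl.2 hle
  have h2 : (0 : ℝ) ≤ narayana (n + 1) l * (1 / (d : ℝ) ^ k) ^ l :=
    mul_nonneg (narayana_nonneg _ _) (by positivity)
  calc (1 - ((n + 1 : ℕ) : ℝ) ^ 2 / p) * (narayana (n + 1) l * (p / (d : ℝ) ^ k) ^ l)
      = ((1 - ((n + 1 : ℕ) : ℝ) ^ 2 / p) * (p : ℝ) ^ l) *
          (narayana (n + 1) l * (1 / (d : ℝ) ^ k) ^ l) := by
        rw [div_eq_mul_one_div (p : ℝ) ((d : ℝ) ^ k), mul_pow]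
        ring
    _ ≤ p.descFactorial l * (narayana (n + 1) l * (1 / (d : ℝ) ^ k) ^ l) := by gcongr
    _ = _ := by ring

end LowerBound

/-! ### The limit -/

section Limit

theorem continuous_narayanaPoly (m : ℕ) : Continuous (narayanaPoly m) := by
  unfold narayanaPoly
  fun_prop

theorem tendsto_normMoment {k m : ℕ} (hk : 1 ≤ k) (hm : 1 ≤ m) {x : ℝ} (hx : 0 < x) {p d : ℕ → ℕ}
    (hd : Tendsto d atTop atTop)
    (hpd : Tendsto (fun n => (p n : ℝ) / (d n : ℝ) ^ k) atTop (𝓝 x)) :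
    Tendsto (fun n => normMoment (p n) (d n) k m) atTop (𝓝 (narayanaPoly m x)) := by
  have hdR : Tendsto (fun n => (d n : ℝ)) atTop atTop := tendsto_natCast_atTop_atTop.comp hd
  have hd1 : ∀ᶠ n in atTop, 1 ≤ d n := hd.eventually_ge_atTop 1
  -- Since p = (p/d^k) d^k and x > 0, also p → ∞; thus the condition m < √p eventually holds and
  -- m²/p → 0.
  have hpR : Tendsto (fun n => (p n : ℝ)) atTop atTop := by
    refine (hpd.pos_mul_atTop hx ((tendsto_pow_atTop (by omega : k ≠ 0)).comp hdR)).congr' ?_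
    filter_upwards [hd1] with n hn
    have : (0 : ℝ) < d n := by exact_mod_cast hn
    simp only [Function.comp_apply]
    field_simp
  have hp1 : ∀ᶠ n in atTop, 1 ≤ p n := by
    filter_upwards [hpR.eventually_ge_atTop 1] with n hn
    exact_mod_cast hn
  have hmp : ∀ᶠ n in atTop, (m : ℝ) < Real.sqrt (p n) :=
    (Real.tendsto_sqrt_atTop.comp hpR).eventually_gt_atTop _
  have hβ : Tendsto (fun n => narayanaPoly m ((p n : ℝ) / (d n : ℝ) ^ k)) atTop
      (𝓝 (narayanaPoly m x)) := ((continuous_narayanaPoly m).tendsto x).comp hpd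
  have hlow : Tendsto (fun n => (1 - (m : ℝ) ^ 2 / p n) *
      narayanaPoly m ((p n : ℝ) / (d n : ℝ) ^ k)) atTop (𝓝 (narayanaPoly m x)) := by
    simpa using ((tendsto_const_nhds (x := (1 : ℝ))).sub
      ((tendsto_const_nhds (x := (m : ℝ) ^ 2)).div_atTop hpR)).mul hβ
  have hden : Tendsto (fun n => (p n : ℝ) / (d n : ℝ) ^ k * (d n : ℝ) ^ (1 / (k : ℝ)))
      atTop atTop :=
    hpd.pos_mul_atTop hx ((tendsto_rpow_atTop (by positivity)).comp hdR)
  have hexp : Tendsto (fun n => Real.exp (3 * (m : ℝ) ^ (k + 4) /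
      ((p n : ℝ) / (d n : ℝ) ^ k * (d n : ℝ) ^ (1 / (k : ℝ))))) atTop (𝓝 1) := by
    have := (Real.continuous_exp.tendsto 0).comp
      ((tendsto_const_nhds (x := 3 * (m : ℝ) ^ (k + 4))).div_atTop hden)
    rwa [Real.exp_zero] at this
  have hup := hexp.mul hβ
  rw [one_mul] at hup
  refine tendsto_of_tendsto_of_tendsto_of_le_of_le' hlow hup ?_ ?_
  · filter_upwards [hd1, hmp] with n h1 h2 using le_normMoment hm h1 h2
  · filter_upwards [hd1, hp1] with n h1 h2 using normMoment_le_exp_mul_narayanaPoly hk hm h2 h1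

end Limit

theorem theorem1 (k m : ℕ) (hk : 1 ≤ k) (hm : 1 ≤ m) :
    (∀ p d : ℕ, 1 ≤ p → 1 ≤ d →
      ((m : ℝ) < Real.sqrt (p : ℝ) →
        (1 - (m : ℝ) ^ 2 / (p : ℝ)) * narayanaPoly m ((p : ℝ) / (d : ℝ) ^ k)
          ≤ normMoment p d k m) ∧
      normMoment p d k m
        ≤ Real.exp (3 * (m : ℝ) ^ (k + 4) /
              (((p : ℝ) / (d : ℝ) ^ k) * (d : ℝ) ^ (1 / (k : ℝ)))) *
            narayanaPoly m ((p : ℝ) / (d : ℝ) ^ k)) ∧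
    (∀ x : ℝ, 0 < x → ∀ p d : ℕ → ℕ, Tendsto d atTop atTop →
      Tendsto (fun n => (p n : ℝ) / (d n : ℝ) ^ k) atTop (𝓝 x) →
      Tendsto (fun n => normMoment (p n) (d n) k m) atTop (𝓝 (narayanaPoly m x))) :=
  ⟨fun _ _ hp hd => ⟨le_normMoment hm hd, normMoment_le_exp_mul_narayanaPoly hk hm hp hd⟩,
    fun _ hx _ _ hd hpd => tendsto_normMoment hk hm hx hd hpd⟩
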